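/- Fix $n\ge 0$ and let $\mathrm{Poly}_n[\beta]=\mathbb Z[x_1,\dots,x_n][\beta]$. A weak composition is $a=(a_1,\dots,a_n)\in\mathbb Z_{\ge0}^n$; put $|a|=\sum_i a_i$, $\mathbf x^a=\prod_i x_i^{a_i}$, let $a^+$ be the list of nonzero entries of $a$ in order, and write $b\ge a$ if $b_1+\dots+b_i\ge a_1+\dots+a_i$ for all $i$. **Fillings.** The skyline diagram $D(a)$ has $a_i$ left-justified boxes in row $i$, row $1$ being the lowest. A set-valued filling puts a nonempty set of positive integers in each box; the maximum of a box is its anchor, the other entries are free. Consider the conditions: (S1) no entry repeats in a column; (S2) if $A,B$ are adjacent boxes in a row, $A$ left of $B$, then $\min A\ge\max B$; (S3) whenever two boxes with anchors $\beta_0,\alpha_0$ (left, right) are adjacent in a row and a third box with anchor $\gamma_0$ is either above the right one, the lower row being weakly longer, or below the left one, the higher row being strictly longer, then $\gamma_0<\alpha_0\le\beta_0$ or $\alpha_0\le\beta_0<\gamma_0$; (S4) each free entry is in the box with the least anchor of its column in which it can be a free entry without violating (S2). For a filling $T$ let $\mathrm{wt}(T)_i$ be the number of $i$'s in $T$ and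 $\mathrm{ex}(T)$ the number of free entries. - The Lascoux atom is $\overline{\mathfrak A}_a=\sum_T\beta^{\mathrm{ex}(T)}\mathbf x^{\mathrm{wt}(T)}$ over the fillings $T$ of $D(a)$ with (S1)–(S4) whose first-column anchors equal their row index. - $\mathfrak Q\mathrm{SSF}(a)$ is the set of fillings of $D(a)$ with (S1)–(S4) whose first-column anchors are at most their row index and decrease from top to bottom. Such an $S$ is quasiYamanouchi if for every $i$ appearing in $S$, either the leftmost $i$ is an anchor in row $i$ of the leftmost column, or some $i+1$ lies weakly right of the leftmost $i$ in a different box. - The Lascoux polynomial is $\overline{\mathfrak D}_a=\sum_T\beta^{\mathrm{ex}(T)}\mathbf x^{\mathrm{wt}(T)}$ over the fillings $T$ of $D(a_n,\dots,a_1)$, augmented by a column $0$ with the single entry $n-i+1$ in each row $i=1,\dots,n$, that satisfy (S1)–(S4) with column $0$ included; column $0$ does not count in $\mathrm{wt}(T)$. - The quasiLascoux polynomial is $\overline{\mathfrak Q}_a=\sum_{b\ge a,\ b^+=a^+}\overline{\mathfrak A}_b$. For a list $\alpha$ of at most $n$ positive integers the quasiGrothendieck polynomial is $\overline S_\alpha=\sum_{a^+=\alpha}\overline{\mathfrak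 A}_a$. **Glides.** Let $a$ have its nonzero entries in positions $n_1<\dots<n_\ell$. Let $b$ be a weak composition some of whose positive entries are coloured red, the others black; $\mathrm{ex}$ counts red entries. $b$ is a glide of $a$ if there are $0=i_0<i_1<\dots<i_\ell$ such that, for each $j$, $a_{n_j}=b_{i_{j-1}+1}+\dots+b_{i_j}-\mathrm{ex}(b_{i_{j-1}+1},\dots,b_{i_j})$, $i_j\le n_j$, and the leftmost nonzero entry among $b_{i_{j-1}+1},\dots,b_{i_j}$ is black, and such that $b_k=0$ for all $k>i_\ell$. The glide polynomial is $\overline{\mathfrak F}_a=\sum_b\beta^{\mathrm{ex}(b)}\mathbf x^b$ over all glides $b$ of $a$. **Quasikeys.** The quasikey polynomial is $\mathfrak Q_a=\sum_K\prod_{\text{cells of }K}x_{\text{row}}$ over the quasi-Kohnert tableaux $K$ of content $a$: finite sets of cells in rows $1,\dots,n$, each cell labelled by one of $1,\dots,n$, such that label $i$ occurs exactly once in each of the columns $1,\dots,a_i$ and nowhere else; labels in row $r$ are at least $r$; the cells with label $i$ weakly descend from left to right; if $i<j$ are in a column with $i$ above $j$, then there is an $i$ in the next column to the right, strictly above that $j$;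 the first column increases from bottom to top; and if $i<j$ and $a_i<a_j$, then each $i$ is strictly below the $j$ in the next column to the right. **Quasisymmetry, swaps.** $\mathrm{QSym}_n[\beta]$ consists of the $f\in\mathrm{Poly}_n[\beta]$ that, for each $i$, are invariant under exchanging $x_i$ and $x_{i+1}$ in those terms in which not both variables appear. A left swap of $a$ exchanges entries $a_i\le a_j$ with $i<j$; $\mathtt{lswap}(a)$ is the set of weak compositions obtained from $a$ by finitely many (possibly zero) left swaps; $\mathtt{Qlswap}(a)$ is the set of $b\in\mathtt{lswap}(a)$ such that $c\ge b$ for all $c\in\mathtt{lswap}(a)$ with $c^+=b^+$. **Theorem.** The family $\{\overline{\mathfrak Q}_a\}$, over all weak compositions $a$ of length $n$, is a $\mathbb Z[\beta]$-basis of $\mathrm{Poly}_n[\beta]$. The family $\{\overline S_\alpha\}$, over all lists $\alpha$ of at most $n$ positive integers, is a $\mathbb Z[\beta]$-basis of $\mathrm{QSym}_n[\beta]$, and $$\{\overline{\mathfrak Q}_a\}\cap\mathrm{QSym}_n[\beta]=\{\overline S_\alpha\}.$$ For every weak composition $a$ of length $n$, setting $\beta=0$ in $\overline{\mathfrak Q}_a$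 gives $\mathfrak Q_a$, and $$\overline{\mathfrak D}_a=\sum_{b\in\mathtt{Qlswap}(a)}\overline{\mathfrak Q}_b,\qquad \overline{\mathfrak Q}_a=\sum_{S}\beta^{\mathrm{ex}(S)}\,\overline{\mathfrak F}_{\mathrm{wt}(S)},\qquad \overline{\mathfrak Q}_a=\sum_{b\ge a,\ b^+=a^+}\overline{\mathfrak A}_b,$$ the middle sum being over the quasiYamanouchi $S\in\mathfrak Q\mathrm{SSF}(a)$. In particular these are finite expansions $\overline{\mathfrak D}_a=\sum_bL^a_b\overline{\mathfrak Q}_b$, $\overline{\mathfrak Q}_a=\sum_bM^a_b\overline{\mathfrak F}_b$, $\overline{\mathfrak Q}_a=\sum_bN^a_b\overline{\mathfrak A}_b$ with all $L^a_b,M^a_b,N^a_b\in\mathbb Z_{\ge0}[\beta]$. -/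

import Mathlib

open scoped Polynomial

noncomputable section

namespace QuasiLascoux

/-! ### Weak compositions

A weak composition of length `n` is a function `a : Fin n → ℕ`. Rows, labels and variables
`1, …, n` are indexed by `Fin n`, that is, by `0, …, n - 1`. -/

/-- The positive part `a⁺`: delete all zero terms. -/
def positivePart {n : ℕ} (a : Fin n → ℕ) : List ℕ := (List.ofFn a).filter (fun x => x ≠ 0)

/-- The dominance order `b ≥ a`: `b₁ + ⋯ + bᵢ ≥ a₁ + ⋯ + aᵢ` for all `i`. -/
def Dominates {n : ℕ} (b a : Fin n → ℕ) : Prop :=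
  ∀ i : Fin n, ∑ j ∈ Finset.Iic i, a j ≤ ∑ j ∈ Finset.Iic i, b j

theorem finite_setOf_le {n : ℕ} (N : ℕ) : {a : Fin n → ℕ | ∀ i, a i ≤ N}.Finite := by
  have h : {a : Fin n → ℕ | ∀ i, a i ≤ N} = Set.Iic (fun _ => N) := by
    ext a; simp [Pi.le_def]
  rw [h]; exact Set.finite_Iic _

theorem finite_setOf_positivePart_eq {n : ℕ} (α : List ℕ) :
    {a : Fin n → ℕ | positivePart a = α}.Finite := by
  refine (finite_setOf_le α.sum).subset ?_
  rintro a rfl i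
  by_cases h : a i = 0
  · simp [h]
  · refine List.single_le_sum (by simp) _ ?_
    simp [positivePart, h]

/-- The ring `Poly_n[β] = ℤ[x₁, …, xₙ][β]`, written as polynomials in `x₁, …, xₙ` with
coefficients in `ℤ[β]`; the parameter `β` is `Polynomial.X : ℤ[X]`. -/
abbrev PolyBeta (n : ℕ) : Type := MvPolynomial (Fin n) ℤ[X]

/-- The element `β ^ k x₁ ^ w₁ ⋯ xₙ ^ wₙ` of `Poly_n[β]`. -/
def betaMonomial {n : ℕ} (k : ℕ) (w : Fin n → ℕ) : PolyBeta n :=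
  MvPolynomial.monomial (Finsupp.equivFunOnFinite.symm w) (Polynomial.X ^ k)

/-- The specialization `β = 0`. -/
def specializeZero {n : ℕ} : PolyBeta n →+* MvPolynomial (Fin n) ℤ :=
  MvPolynomial.map (Polynomial.evalRingHom 0)

/-! ### Set-valued skyline fillings -/

/-- A set of labels for every box of the skyline diagram `D(a)`, which has `a i` left-justified
boxes in row `i`; row `0` is the lowest row, and columns are counted from `0`. -/
abbrev SetFilling {n : ℕ} (a : Fin n → ℕ) : Type := (i : Fin n) → Fin (a i) → Finset (Fin n)

/-- The set in row `i` and column `c`, which is empty where there is no box. -/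
def cell {n : ℕ} {a : Fin n → ℕ} (T : SetFilling a) (i : Fin n) (c : ℕ) : Finset (Fin n) :=
  if h : c < a i then T i ⟨c, h⟩ else ∅

/-- The anchor of a box: its maximum entry (`⊥` where there is no box). -/
def anchor {n : ℕ} {a : Fin n → ℕ} (T : SetFilling a) (i : Fin n) (c : ℕ) : WithBot (Fin n) :=
  (cell T i c).max

/-- A triple with entries `α, β, γ` is an inversion triple. -/
def IsInversionTriple {n : ℕ} (α β γ : WithBot (Fin n)) : Prop :=
  (γ < α ∧ α ≤ β) ∨ (α ≤ β ∧ β < γ)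

/-- The conditions on a set-valued filling that all families of semistandard fillings below share
(they differ in the conditions on the first column). -/
structure IsSemistandard {n : ℕ} {a : Fin n → ℕ} (T : SetFilling a) : Prop where
  /-- Every box holds a non-empty set. -/
  nonempty : ∀ i c, (T i c).Nonempty
  /-- Entries do not repeat in a column. -/
  column : ∀ i j c k, k ∈ cell T i c → k ∈ cell T j c → i = j
  /-- Rows are weakly decreasing: every entry of a box is at most every entry of the box to its left. -/
  row : ∀ i c, ∀ x ∈ cell T i c, ∀ y ∈ cell T i (c + 1), y ≤ x
  /-- Anchors, triples of type A: the lower row `i` is weakly longer, two boxes are adjacent in row `i`, and the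
  third one is above the right one of them. -/
  tripleA : ∀ i j, i < j → a j ≤ a i → ∀ c, c + 1 < a j →
    IsInversionTriple (anchor T i (c + 1)) (anchor T i c) (anchor T j (c + 1))
  /-- Anchors, triples of type B: the higher row `j` is strictly longer, two boxes are adjacent in row `j`, and
  the third one is below the left one of them. -/
  tripleB : ∀ i j, i < j → a i < a j → ∀ c, c < a i →
    IsInversionTriple (anchor T j (c + 1)) (anchor T j c) (anchor T i c)
  /-- A free entry `k` lies in the cell of the least anchor of its column among those cells
  `(j, c)` in which `k` can be a free entry without violating the decrease of rows. -/
  free : ∀ i c, ∀ k ∈ cell T i c, (k : WithBot (Fin n)) < anchor T i c →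
    ∀ j, (k : WithBot (Fin n)) < anchor T j c → (∀ y ∈ cell T j (c + 1), y ≤ k) →
      anchor T i c ≤ anchor T j c

/-- The excess of a set-valued filling: the number of free (non-anchor) entries. -/
def excess {n : ℕ} {a : Fin n → ℕ} (T : SetFilling a) : ℕ := ∑ i, ∑ c, ((T i c).card - 1)

/-- The weight of a set-valued filling: `wt T k` is the number of boxes that contain `k`. -/
def wt {n : ℕ} {a : Fin n → ℕ} (T : SetFilling a) (k : Fin n) : ℕ :=
  ∑ i, ∑ c, if k ∈ T i c then 1 else 0

/-- Semistandard set-valued skyline fillings of shape `a`: anchors in the first column are equal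
to their row index. -/
structure IsAtomFilling {n : ℕ} {a : Fin n → ℕ} (T : SetFilling a) : Prop where
  semistandard : IsSemistandard T
  first : ∀ i, 0 < a i → anchor T i 0 = i

/-- Set-valued quasi-skyline fillings of shape `a`: anchors in the first column are at most
their row index and decrease from top to bottom. -/
structure IsQuasiFilling {n : ℕ} {a : Fin n → ℕ} (T : SetFilling a) : Prop where
  semistandard : IsSemistandard T
  first_le : ∀ i, 0 < a i → anchor T i 0 ≤ i
  first_lt : ∀ i j, i < j → 0 < a i → 0 < a j → anchor T i 0 < anchor T j 0

/-- A quasi-skyline filling is quasiYamanouchi if, for every `k` appearing in it, either the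
leftmost `k` is an anchor in row `k` of the leftmost column, or there is a `k + 1` weakly to the
right of the leftmost `k` and in a different box. -/
structure IsQuasiYamanouchi {n : ℕ} {a : Fin n → ℕ} (T : SetFilling a) : Prop where
  quasi : IsQuasiFilling T
  yamanouchi : ∀ k i c, k ∈ cell T i c → (∀ i' c', k ∈ cell T i' c' → c ≤ c') →
    (c = 0 ∧ i = k ∧ anchor T i c = k) ∨
    ∃ k' : Fin n, (k' : ℕ) = k + 1 ∧ ∃ i' c', c ≤ c' ∧ k' ∈ cell T i' c' ∧ (i', c') ≠ (i, c)

open Classical in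
/-- The (combinatorial) Lascoux atom. -/
def lascouxAtom {n : ℕ} (a : Fin n → ℕ) : PolyBeta n :=
  ∑ T : SetFilling a with IsAtomFilling T, betaMonomial (excess T) (wt T)

/-- The weak compositions `b` of length `n` with `b ≥ a` and `b⁺ = a⁺`. -/
def dominatingRearrangements {n : ℕ} (a : Fin n → ℕ) : Set (Fin n → ℕ) :=
  {b | Dominates b a ∧ positivePart b = positivePart a}

theorem finite_dominatingRearrangements {n : ℕ} (a : Fin n → ℕ) :
    (dominatingRearrangements a).Finite :=
  (finite_setOf_positivePart_eq (positivePart a)).subset fun _ h => h.2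

/-- The quasiLascoux polynomial. -/
def quasiLascoux {n : ℕ} (a : Fin n → ℕ) : PolyBeta n :=
  ∑ b ∈ (finite_dominatingRearrangements a).toFinset, lascouxAtom b

/-! ### Quasisymmetric polynomials and quasiGrothendieck polynomials -/

/-- `QSym_n[β]`: the polynomials that are invariant under exchanging `xᵢ` and `xᵢ₊₁` in those
terms in which not both variables appear. -/
def QSymBeta (n : ℕ) : Submodule ℤ[X] (PolyBeta n) where
  carrier := {f | ∀ (m : Fin n →₀ ℕ) (i j : Fin n), (j : ℕ) = i + 1 → (m i = 0 ∨ m j = 0) →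
    MvPolynomial.coeff (m.mapDomain (Equiv.swap i j)) f = MvPolynomial.coeff m f}
  add_mem' hf hg m i j hij hm := by
    simp only [MvPolynomial.coeff_add, hf m i j hij hm, hg m i j hij hm]
  zero_mem' m i j _ _ := by simp
  smul_mem' r f hf m i j hij hm := by
    simp only [MvPolynomial.coeff_smul, hf m i j hij hm]

/-- The quasiGrothendieck polynomial in `n` variables of a strong composition `α`. -/
def quasiGrothendieck (n : ℕ) (α : List ℕ) : PolyBeta n :=
  ∑ a ∈ (finite_setOf_positivePart_eq (n := n) α).toFinset, lascouxAtom a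

/-- The strong compositions with at most `n` parts (for longer ones the quasiGrothendieck
polynomial in `n` variables is an empty sum). -/
abbrev StrongComposition (n : ℕ) : Type :=
  {α : List ℕ // (∀ x ∈ α, 0 < x) ∧ α.length ≤ n}

/-! ### Quasikey polynomials -/

/-- Quasi-Kohnert tableaux of content `a`: diagrams filled with labels, one per cell, such that
label `i` occurs exactly once in each of the first `a i` columns and in no other column; `f i c` is
the row of the label `i` in column `c`. -/
structure IsQuasiKohnert {n : ℕ} {a : Fin n → ℕ} (f : (i : Fin n) → Fin (a i) → Fin n) :
    Prop where
  /-- Distinct labels occupy distinct cells. -/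
  cells : ∀ i j c hi hj, f i ⟨c, hi⟩ = f j ⟨c, hj⟩ → i = j
  /-- Each label in row `r` is at least `r`. -/
  flagged : ∀ i c, f i c ≤ i
  /-- The cells with label `i` weakly descend from left to right. -/
  descend : ∀ i, Antitone (f i)
  /-- If `i < j` appear in a column with `i` above `j`, then there is an `i` in the column
  immediately to the right, strictly above that `j`. -/
  above : ∀ i j, i < j → ∀ c hi hj, f j ⟨c, hj⟩ < f i ⟨c, hi⟩ →
    ∃ h : c + 1 < a i, f j ⟨c, hj⟩ < f i ⟨c + 1, h⟩
  /-- The labels of the first column increase from bottom to top. -/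
  first : ∀ i j, i < j → ∀ hi hj, f i ⟨0, hi⟩ < f j ⟨0, hj⟩
  /-- If `i < j` and `a i < a j`, then each `i` lies strictly below the `j` in the next column. -/
  short : ∀ i j, i < j → ∀ h : a i < a j, ∀ c (hc : c < a i),
    f i ⟨c, hc⟩ < f j ⟨c + 1, (Nat.succ_le_of_lt hc).trans_lt h⟩

open Classical in
/-- The quasikey polynomial: each cell contributes the variable of its row. -/
def quasikey {n : ℕ} (a : Fin n → ℕ) : MvPolynomial (Fin n) ℤ :=
  ∑ f : (i : Fin n) → Fin (a i) → Fin n with IsQuasiKohnert f, ∏ i, ∏ c, MvPolynomial.X (f i c)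

/-! ### Glide polynomials -/

/-- The nonzero positions `n₁ < ⋯ < n_ℓ` of `a`. -/
def nonzeroPositions {n : ℕ} (a : Fin n → ℕ) : Finset (Fin n) :=
  Finset.univ.filter fun i => a i ≠ 0

/-- The positions `s + 1, …, t` (counted from `1`) as a subset of `Fin n`. -/
def block (n s t : ℕ) : Finset (Fin n) :=
  Finset.univ.filter fun k => s ≤ (k : ℕ) ∧ (k : ℕ) < t

/-- The weak komposition with parts `b` and set `R` of red entries is a glide of `a`: its entries can
be cut into consecutive blocks, the `j`-th of which sums, minus its number of red entries, to the
`j`-th nonzero entry of `a`, ends weakly left of the position of that entry, and has a black leftmost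
nonzero entry. The last clause says that nothing remains after the last block. -/
def IsGlide {n : ℕ} (a b : Fin n → ℕ) (R : Finset (Fin n)) : Prop :=
  (∀ k ∈ R, 0 < b k) ∧
  ∃ e : Fin ((nonzeroPositions a).card + 1) → ℕ, StrictMono e ∧ e 0 = 0 ∧
    (∀ j : Fin (nonzeroPositions a).card,
      (a ((nonzeroPositions a).orderEmbOfFin rfl j) +
          (R ∩ block n (e j.castSucc) (e j.succ)).card =
        ∑ k ∈ block n (e j.castSucc) (e j.succ), b k) ∧
      e j.succ ≤ ((nonzeroPositions a).orderEmbOfFin rfl j : ℕ) + 1 ∧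
      (∀ k ∈ block n (e j.castSucc) (e j.succ), b k ≠ 0 →
        (∀ k' ∈ block n (e j.castSucc) (e j.succ), k' < k → b k' = 0) → k ∉ R)) ∧
    (∀ k : Fin n, e (Fin.last _) ≤ k → b k = 0)

theorem exists_block {m : ℕ} (e : Fin (m + 1) → ℕ) (h0 : e 0 = 0) (k : ℕ)
    (hk : k < e (Fin.last m)) : ∃ j : Fin m, e j.castSucc ≤ k ∧ k < e j.succ := by
  by_contra! h
  have : ∀ j : Fin (m + 1), e j ≤ k := by
    intro j
    induction j using Fin.induction with
    | zero => simp [h0]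
    | succ j ih => exact h j ih
  exact absurd hk (not_lt.mpr (this _))

theorem finite_glides {n : ℕ} (a : Fin n → ℕ) :
    {p : (Fin n → ℕ) × Finset (Fin n) | IsGlide a p.1 p.2}.Finite := by
  refine ((finite_setOf_le (n := n) (∑ i, a i + n)).prod
    (Set.finite_univ (α := Finset (Fin n)))).subset ?_
  rintro ⟨b, R⟩ ⟨-, e, -, h0, hb, hlast⟩
  refine ⟨fun k => ?_, Set.mem_univ _⟩
  by_cases hk : (k : ℕ) < e (Fin.last _)
  · obtain ⟨j, hj1, hj2⟩ := exists_block e h0 k hk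
    have h1 : b k ≤ ∑ k ∈ block n (e j.castSucc) (e j.succ), b k :=
      Finset.single_le_sum (f := b) (fun _ _ => Nat.zero_le _) (by simp [block, hj1, hj2])
    have h2 : a ((nonzeroPositions a).orderEmbOfFin rfl j) ≤ ∑ i, a i :=
      Finset.single_le_sum (f := a) (fun _ _ => Nat.zero_le _) (Finset.mem_univ _)
    have h3 : (R ∩ block n (e j.castSucc) (e j.succ)).card ≤ n := by
      simpa using Finset.card_le_univ (R ∩ block n (e j.castSucc) (e j.succ))
    have h4 := (hb j).1
    dsimp only at h4 ⊢
    omega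
  · have h5 := hlast k (not_lt.mp hk)
    dsimp only at h5 ⊢
    omega

/-- The glide polynomial. -/
def glide {n : ℕ} (a : Fin n → ℕ) : PolyBeta n :=
  ∑ p ∈ (finite_glides a).toFinset, betaMonomial p.2.card p.1

/-! ### Lascoux polynomials and left swaps -/

/-- The shape of fillings of the reversal of `a` that are augmented on the left by a basement
column; the basement is column `0` of this shape. -/
def basementShape {n : ℕ} (a : Fin n → ℕ) : Fin n → ℕ := fun i => a i.rev + 1

/-- Semistandard set-valued fillings, basement included, with basement entry `n - i + 1` in row `i`
(rows counted from `1`). -/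
structure IsLascouxFilling {n : ℕ} {a : Fin n → ℕ} (T : SetFilling (basementShape a)) : Prop where
  semistandard : IsSemistandard T
  basement : ∀ i, cell T i 0 = {i.rev}

/-- The weight of a filling with basement, in which basement entries do not count. -/
def basementWt {n : ℕ} {a : Fin n → ℕ} (T : SetFilling (basementShape a)) (k : Fin n) : ℕ :=
  ∑ i, ∑ c : Fin (basementShape a i), if (c : ℕ) ≠ 0 ∧ k ∈ T i c then 1 else 0

open Classical in
/-- The (combinatorial) Lascoux polynomial. -/
def lascoux {n : ℕ} (a : Fin n → ℕ) : PolyBeta n :=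
  ∑ T : SetFilling (basementShape a) with IsLascouxFilling T, betaMonomial (excess T) (basementWt T)

/-- `b` arises from `a` by a left swap: the exchange of two entries `a i ≤ a j` with `i < j`. -/
def LeftSwap {n : ℕ} (a b : Fin n → ℕ) : Prop :=
  ∃ i j, i < j ∧ a i ≤ a j ∧ b = a ∘ Equiv.swap i j

/-- All weak compositions obtained from `a` by a (possibly empty) sequence of left swaps. -/
def lswap {n : ℕ} (a : Fin n → ℕ) : Set (Fin n → ℕ) := {b | Relation.ReflTransGen LeftSwap a b}

/-- All `b ∈ lswap a` such that `c ≥ b` whenever `c ∈ lswap a` and `b⁺ = c⁺`. -/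
def Qlswap {n : ℕ} (a : Fin n → ℕ) : Set (Fin n → ℕ) :=
  {b | b ∈ lswap a ∧ ∀ c ∈ lswap a, positivePart b = positivePart c → Dominates c b}

theorem finite_Qlswap {n : ℕ} (a : Fin n → ℕ) : (Qlswap a).Finite := by
  refine (finite_setOf_le (∑ i, a i)).subset ?_
  rintro b ⟨hb, -⟩
  have : ∀ i, b i ≤ ∑ i, a i := by
    induction hb with
    | refl => exact fun i => Finset.single_le_sum (fun _ _ => Nat.zero_le _) (Finset.mem_univ i)
    | tail _ h ih =>
      obtain ⟨i, j, -, -, rfl⟩ := h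
      exact fun k => ih _
  exact this

/-! ### Positive expansions -/

/-- `f` is a finite linear combination of the members of the family `B` with coefficients in
`ℤ_{≥ 0}[β]`. -/
def HasPositiveExpansion {n : ℕ} {ι : Type} (B : ι → PolyBeta n) (f : PolyBeta n) : Prop :=
  ∃ N : ι →₀ ℕ[X], f = N.sum fun b p => p.map (Nat.castRingHom ℤ) • B b

end QuasiLascoux

end

open scoped Polynomial

noncomputable section

namespace QuasiLascoux

open Finset

/-! Everything is controlled by column data. By (S4), a filling is recovered from its array of
anchors and the set of labels in each column (`IsSemistandard.mem_cell_iff`). Its weight and excess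
depend only on the label sets and on the number of boxes in each column. Whether given label sets
fit an array depends only on the sets of anchors in adjacent columns, not on their distribution over
the rows (`Admissible.of_sameColumns`). So the free entries can be forgotten, and the question
becomes how given columns of anchors are threaded into weakly decreasing rows.

If the first column increases upwards, the triple conditions say that the threading is greedy from
left to right (`Fwd`): lower rows choose first and take the largest entry allowed. In a Lascoux
filling with rows indexed by basement entries, they say that it is greedy from right to left
(`Bwd`). Greedy threadings exist by exchange arguments. The counting comparisons `forward_compare`
and `back_compare` make them unique and compare them with other threadings. For given column data
there is exactly one atom filling, of some shape `b`, and a Lascoux filling for `a` exists precisely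
if `b ∈ lswap a`, because `lswap` is an order on initial counts (`mem_lswap_iff`). Thus the Lascoux
polynomial is the sum of the atoms over `lswap a`, and this set is the disjoint union of the sets of
`c ≥ b` with `c⁺ = b⁺` over `b ∈ Qlswap a`. Similarly, moving rows to the positions named by their
first anchors turns quasi-skyline fillings into atom fillings, so the quasiLascoux polynomial counts
quasi-skyline fillings. At `β = 0`, quasi-Kohnert tableaux are `Bwd` arrays with the additional
property `Short`, which characterizes the case in which both greedy threadings have the same shape.

The glide expansion interpolates between monomials and glide polynomials. For each `m`, sum over the
fillings that are quasiYamanouchi at the values from `m` on, weighting each by the glides of its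
weight that change nothing before position `m`. The sum does not depend on `m`. The recursion
`glideFrom_eq_add`, which splits off a part at a vacant position `m`, is matched on fillings by
lowering the next larger value to `m` from some column on; `IsMove.unique` and
`IsYamanouchiFrom.exists_move` show that each filling violating the condition at `m` arises exactly
once.

For the bases, `quasiLascoux a` has leading term `x ^ a` and all its exponents dominate `a`, so the
family is unitriangular. If the zeros of `a` come first, every rearrangement with the same positive
part dominates `a`, so `quasiLascoux a` is the quasiGrothendieck polynomial of `a⁺`. It is
quasisymmetric, because the position bounds in its glides are then void. For any other `a`,
quasisymmetry would force an exponent that does not dominate `a`; the same argument at a minimal `a`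
shows that the right-justified ones span `QSym_n[β]`. -/

/-! ### Arrays of numbers with decreasing rows -/

/-- Rows decrease weakly and the nonzero entries of a column are distinct. -/
structure IsArray {n : ℕ} (t : Fin n → ℕ → ℕ) : Prop where
  anti : ∀ i c, t i (c + 1) ≤ t i c
  inj : ∀ i j c, 0 < t i c → t i c = t j c → i = j

/-- Lower rows do not want the entries of the higher rows in the next column. -/
def Fwd {n : ℕ} (t : Fin n → ℕ → ℕ) : Prop :=
  ∀ k j c, k < j → 0 < t j (c + 1) → t j (c + 1) ≤ t k c → t j (c + 1) < t k (c + 1)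

/-- Lower rows do not want the entries of the higher rows in the previous column. -/
def Bwd {n : ℕ} (t : Fin n → ℕ → ℕ) : Prop :=
  ∀ i j c, i < j → 0 < t j c → t j c < t i c → t j c < t i (c + 1)

/-- The columns of the two arrays agree up to the order of their entries. -/
def SameColumns {n : ℕ} (t z : Fin n → ℕ → ℕ) : Prop :=
  ∀ c, ∃ π : Equiv.Perm (Fin n), ∀ i, z i c = t (π i) c

theorem SameColumns.symm {n : ℕ} {t z : Fin n → ℕ → ℕ} (h : SameColumns t z) :
    SameColumns z t := fun c => by
  obtain ⟨π, hπ⟩ := h c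
  exact ⟨π.symm, fun i => by rw [hπ, Equiv.apply_symm_apply]⟩

theorem SameColumns.trans {n : ℕ} {t z y : Fin n → ℕ → ℕ} (h : SameColumns t z)
    (h' : SameColumns z y) : SameColumns t y := fun c => by
  obtain ⟨π, hπ⟩ := h c
  obtain ⟨ρ, hρ⟩ := h' c
  exact ⟨ρ.trans π, fun i => by rw [hρ, hπ]; rfl⟩

theorem card_filter_perm {n : ℕ} {f g : Fin n → ℕ} (π : Equiv.Perm (Fin n))
    (h : ∀ i, g i = f (π i)) (p : ℕ → Prop) [DecidablePred p] :
    #{i | p (g i)} = #{i | p (f i)} := by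
  refine Finset.card_bij (fun i _ => π i) ?_ ?_ ?_
  · intro i hi; simpa [h] using hi
  · intro i _ j _ hij; exact π.injective hij
  · intro i hi; exact ⟨π.symm i, by simpa [h] using hi, by simp⟩

theorem SameColumns.card {n : ℕ} {t z : Fin n → ℕ → ℕ} (h : SameColumns t z) (c : ℕ) (p : ℕ → Prop)
    [DecidablePred p] : #{i | p (z i c)} = #{i | p (t i c)} := by
  obtain ⟨π, hπ⟩ := h c
  exact card_filter_perm π hπ p

theorem card_filter_split {n : ℕ} (I : Finset (Fin n)) (f : Fin n → ℕ) {u w : ℕ} (h : u ≤ w) :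
    #{i ∈ I | u ≤ f i} = #{i ∈ I | w ≤ f i} + #{i ∈ I | u ≤ f i ∧ f i < w} := by
  rw [← card_union_of_disjoint]
  · congr 1; ext i; simp only [mem_filter, mem_union]
    constructor
    · rintro ⟨h1, h2⟩
      by_cases h3 : w ≤ f i
      · exact Or.inl ⟨h1, h3⟩
      · exact Or.inr ⟨h1, h2, by omega⟩
    · rintro (⟨h1, h2⟩ | ⟨h1, h2, h3⟩)
      · exact ⟨h1, by omega⟩
      · exact ⟨h1, h2⟩
  · rw [disjoint_left]; intro i; simp only [mem_filter]; omega

/-- Induction on the column. Let `w` be the least entry of column `c + 1` of `t` that is at least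
`u` and lies outside `J`. Entries in `[u, w)` all lie in rows of `J`, so those of `I` cannot
outnumber them. An entry of `z` that is at least `w` has such an entry on its left; the induction
hypothesis provides as many rows of `J` with entries at least `w` in column `c`, and each of these,
having declined `w`, holds a larger entry in column `c + 1`. -/
theorem forward_compare {n : ℕ} {t z : Fin n → ℕ → ℕ} (I J : Finset (Fin n))
    (hz : ∀ i c, z i (c + 1) ≤ z i c) (hc : SameColumns t z)
    (hJ : ∀ k ∈ J, ∀ j ∉ J, ∀ c, 0 < t j (c + 1) → t j (c + 1) ≤ t k c →
      t j (c + 1) < t k (c + 1))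
    (h0 : ∀ u, 0 < u → #{i ∈ I | u ≤ z i 0} ≤ #{j ∈ J | u ≤ t j 0}) (c : ℕ) :
    ∀ u, 0 < u → #{i ∈ I | u ≤ z i c} ≤ #{j ∈ J | u ≤ t j c} := by
  induction c with
  | zero => exact h0
  | succ c ih =>
    intro u hu
    by_cases hex : ∃ j, j ∉ J ∧ u ≤ t j (c + 1)
    · have hne : ({j ∈ Jᶜ | u ≤ t j (c + 1)} : Finset (Fin n)).Nonempty := by
        obtain ⟨j, h1, h2⟩ := hex; exact ⟨j, by simp [h1, h2]⟩
      obtain ⟨j₀, hj, hmin⟩ := exists_min_image _ (fun j => t j (c + 1)) hne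
      simp only [mem_filter, mem_compl] at hj hmin
      set w := t j₀ (c + 1)
      rw [card_filter_split I _ hj.2, card_filter_split J _ hj.2]
      refine add_le_add ?_ ?_
      · calc #{i ∈ I | w ≤ z i (c + 1)} ≤ #{i ∈ I | w ≤ z i c} := by
              refine card_le_card fun i => ?_
              simp only [mem_filter]
              exact fun h => ⟨h.1, h.2.trans (hz i c)⟩
          _ ≤ #{j ∈ J | w ≤ t j c} := ih w (by omega)
          _ ≤ #{j ∈ J | w ≤ t j (c + 1)} := by
              refine card_le_card fun i => ?_
              simp only [mem_filter]
              exact fun h => ⟨h.1, (hJ i h.1 j₀ hj.1 c (by omega) h.2).le⟩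
      · calc #{i ∈ I | u ≤ z i (c + 1) ∧ z i (c + 1) < w}
              ≤ #{i | u ≤ z i (c + 1) ∧ z i (c + 1) < w} := by
              refine card_le_card fun i => ?_
              simp only [mem_filter, mem_univ, true_and]
              exact fun h => h.2
          _ = #{i | u ≤ t i (c + 1) ∧ t i (c + 1) < w} := hc.card (c + 1) (fun x => u ≤ x ∧ x < w)
          _ ≤ _ := by
              refine card_le_card fun i => ?_
              simp only [mem_filter, mem_univ, true_and]
              intro h
              refine ⟨?_, h⟩
              by_contra hi
              have := hmin i ⟨hi, h.1⟩
              omega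
    · push Not at hex
      calc #{i ∈ I | u ≤ z i (c + 1)} ≤ #{i | u ≤ z i (c + 1)} := by
            refine card_le_card fun i => ?_
            simp only [mem_filter, mem_univ, true_and]
            exact fun h => h.2
        _ = #{i | u ≤ t i (c + 1)} := hc.card (c + 1) (fun x => u ≤ x)
        _ ≤ _ := by
            refine card_le_card fun i => ?_
            simp only [mem_filter, mem_univ, true_and]
            intro h
            refine ⟨?_, h⟩
            by_contra hi
            have := hex i hi
            omega

/-- The mirror image, from column `N` leftwards: rows of `J` that choose greedily from the right
have as few large entries as possible. The critical value is now the largest nonzero entry below `u`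
outside `J`; if there is none, the number of boxes decides. -/
theorem back_compare {n : ℕ} {e z : Fin n → ℕ → ℕ} (J I : Finset (Fin n))
    (hz : ∀ i c, z i (c + 1) ≤ z i c) (hc : SameColumns e z)
    (hJ : ∀ i ∈ J, ∀ j ∉ J, ∀ c, 0 < e j c → e j c < e i c → e j c < e i (c + 1)) (N : ℕ)
    (hN : ∀ u, 0 < u → #{i ∈ J | u ≤ e i N} ≤ #{i ∈ I | u ≤ z i N})
    (hs : ∀ c < N, #{i ∈ J | 0 < e i c} ≤ #{i ∈ I | 0 < z i c}) (c : ℕ) (hcN : c ≤ N) :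
    ∀ u, 0 < u → #{i ∈ J | u ≤ e i c} ≤ #{i ∈ I | u ≤ z i c} := by
  induction hcN using Nat.decreasingInduction with
  | self => exact hN
  | of_succ c hcN ih =>
    intro u hu
    -- A bound above `w` becomes a bound from `u` on by subtracting the entries strictly between `w`
    -- and `u`: in `e` all of these lie in `J`, so `J` has at least as many of them as `I` has in
    -- `z`.
    have key : ∀ w < u, (∀ j, w < e j c → e j c < u → j ∈ J) →
        #{i ∈ J | w < e i c} ≤ #{i ∈ I | w < z i c} →
        #{i ∈ J | u ≤ e i c} ≤ #{i ∈ I | u ≤ z i c} := by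
      intro w hw h1 h2
      have e1 := card_filter_split J (fun i => e i c) (u := w + 1) (w := u) hw
      have e2 := card_filter_split I (fun i => z i c) (u := w + 1) (w := u) hw
      have e3 : #{i ∈ I | w + 1 ≤ z i c ∧ z i c < u} ≤ #{i ∈ J | w + 1 ≤ e i c ∧ e i c < u} :=
        calc #{i ∈ I | w + 1 ≤ z i c ∧ z i c < u} ≤ #{i | w + 1 ≤ z i c ∧ z i c < u} := by
              refine card_le_card fun i => ?_
              simp only [mem_filter, mem_univ, true_and]
              exact fun h => h.2
          _ = #{i | w + 1 ≤ e i c ∧ e i c < u} := hc.card c (fun x => w + 1 ≤ x ∧ x < u)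
          _ ≤ _ := by
              refine card_le_card fun i => ?_
              simp only [mem_filter, mem_univ, true_and]
              exact fun h => ⟨h1 i h.1 h.2, h⟩
      simp only [Nat.lt_iff_add_one_le (m := w)] at h2
      omega
    by_cases hex : ∃ j, j ∉ J ∧ 0 < e j c ∧ e j c < u
    · have hne : ({j ∈ Jᶜ | 0 < e j c ∧ e j c < u} : Finset (Fin n)).Nonempty := by
        obtain ⟨j, h1, h2⟩ := hex; exact ⟨j, by simp [h1, h2]⟩
      obtain ⟨j₀, hj, hmax⟩ := exists_max_image _ (fun j => e j c) hne
      simp only [mem_filter, mem_compl] at hj hmax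
      refine key (e j₀ c) hj.2.2 ?_ ?_
      · intro j h1 h2
        by_contra h3
        have := hmax j ⟨h3, by omega, h2⟩
        omega
      · calc #{i ∈ J | e j₀ c < e i c} ≤ #{i ∈ J | e j₀ c + 1 ≤ e i (c + 1)} := by
              refine card_le_card fun i => ?_
              simp only [mem_filter]
              exact fun h => ⟨h.1, hJ i h.1 j₀ hj.1 c hj.2.1 h.2⟩
          _ ≤ #{i ∈ I | e j₀ c + 1 ≤ z i (c + 1)} := ih _ (by omega)
          _ ≤ #{i ∈ I | e j₀ c < z i c} := by
              refine card_le_card fun i => ?_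
              simp only [mem_filter]
              exact fun h => ⟨h.1, lt_of_lt_of_le h.2 (hz i c)⟩
    · push Not at hex
      refine key 0 hu ?_ (hs c hcN)
      intro j h1 h2
      by_contra h3
      have := hex j h3 h1
      omega

theorem card_filter_le_succ {n : ℕ} (v : Fin n) (p : Fin n → Prop) [DecidablePred p] :
    #{i ∈ Finset.Iic v | p i} = #{i ∈ Finset.Iio v | p i} + (if p v then 1 else 0) := by
  rw [← Finset.Iio_insert, Finset.filter_insert]
  split_ifs
  · rw [card_insert_of_notMem (by simp)]
  · rfl

theorem card_filter_Iio_eq {n : ℕ} {p q : Fin n → Prop} [DecidablePred p] [DecidablePred q]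
    (h : ∀ v, #{i ∈ Finset.Iic v | p i} = #{i ∈ Finset.Iic v | q i}) (v : Fin n) :
    #{i ∈ Finset.Iio v | p i} = #{i ∈ Finset.Iio v | q i} := by
  by_cases hv : (v : ℕ) = 0
  · have : Finset.Iio v = ∅ := by
      ext i; simp only [Finset.mem_Iio, Fin.lt_def, Finset.notMem_empty, iff_false]; omega
    simp [this]
  · have : Finset.Iio v = Finset.Iic ⟨(v : ℕ) - 1, by omega⟩ := by
      ext i; simp only [Finset.mem_Iio, Finset.mem_Iic, Fin.lt_def, Fin.le_def]; omega
    rw [this]; exact h _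

/-- A set of positions is determined by the sizes of its initial parts. -/
theorem iff_of_card_Iic {n : ℕ} {p q : Fin n → Prop} [DecidablePred p] [DecidablePred q]
    (h : ∀ v, #{i ∈ Finset.Iic v | p i} = #{i ∈ Finset.Iic v | q i}) (v : Fin n) : p v ↔ q v := by
  have h1 := card_filter_Iio_eq h v
  have h2 := h v
  rw [card_filter_le_succ, card_filter_le_succ, h1] at h2
  split_ifs at h2 <;> simp_all

theorem eq_of_pos_le_iff {x y : ℕ} (h : ∀ u, 0 < u → (u ≤ x ↔ u ≤ y)) : x = y := by
  rcases Nat.lt_trichotomy x y with h1 | h1 | h1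
  · have := (h y (by omega)).2 le_rfl; omega
  · exact h1
  · have := (h x (by omega)).1 le_rfl; omega

theorem Fwd.closed {n : ℕ} {t : Fin n → ℕ → ℕ} (h : Fwd t) (v : Fin n) :
    ∀ k ∈ Finset.Iic v, ∀ j ∉ Finset.Iic v, ∀ c, 0 < t j (c + 1) → t j (c + 1) ≤ t k c →
      t j (c + 1) < t k (c + 1) := by
  intro k hk j hj c
  simp only [Finset.mem_Iic, not_le] at hk hj
  exact h k j c (hk.trans_lt hj)

theorem Bwd.closed {n : ℕ} {t : Fin n → ℕ → ℕ} (h : Bwd t) (v : Fin n) :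
    ∀ i ∈ Finset.Iic v, ∀ j ∉ Finset.Iic v, ∀ c, 0 < t j c → t j c < t i c →
      t j c < t i (c + 1) := by
  intro k hk j hj c
  simp only [Finset.mem_Iic, not_le] at hk hj
  exact h k j c (hk.trans_lt hj)

/-- On every initial set of rows each array can be compared with the other, so all the counts agree;
counts over initial sets determine the entries. -/
theorem Fwd.unique {n : ℕ} {t t' : Fin n → ℕ → ℕ} (ha : IsArray t) (ha' : IsArray t') (h : Fwd t)
    (h' : Fwd t') (h0 : ∀ i, t i 0 = t' i 0) (hc : SameColumns t t') : t = t' := by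
  funext i c
  refine eq_of_pos_le_iff fun u hu => ?_
  refine iff_of_card_Iic (p := fun i => u ≤ t i c) (q := fun i => u ≤ t' i c) (fun v => ?_) i
  refine le_antisymm ?_ ?_
  · exact forward_compare _ _ ha.anti hc.symm (h'.closed v) (by simp [h0]) c u hu
  · exact forward_compare _ _ ha'.anti hc (h.closed v) (by simp [h0]) c u hu

/-- As for `Fwd.unique`, with the last column and the shape in place of the first column. -/
theorem Bwd.unique {n : ℕ} {t t' : Fin n → ℕ → ℕ} (ha : IsArray t) (ha' : IsArray t') (h : Bwd t)
    (h' : Bwd t') (N : ℕ) (h0 : ∀ i, t i N = t' i N) (hs : ∀ i c, 0 < t i c ↔ 0 < t' i c)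
    (hc : SameColumns t t') (c : ℕ) (hcN : c ≤ N) (i : Fin n) : t i c = t' i c := by
  refine eq_of_pos_le_iff fun u hu => ?_
  refine iff_of_card_Iic (p := fun i => u ≤ t i c) (q := fun i => u ≤ t' i c) (fun v => ?_) i
  refine le_antisymm ?_ ?_
  · exact back_compare _ _ ha'.anti hc (h.closed v) N (by simp [h0]) (by simp [hs]) c hcN u hu
  · exact back_compare _ _ ha.anti hc.symm (h'.closed v) N (by simp [h0]) (by simp [hs]) c hcN u hu

/-! ### Existence of greedy arrays -/

theorem exists_perm_of_card_fiber_eq {n : ℕ} {α : Type*} [DecidableEq α] {f g : Fin n → α}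
    (h : ∀ x, #{i | f i = x} = #{i | g i = x}) : ∃ π : Equiv.Perm (Fin n), ∀ i, g i = f (π i) := by
  have e₀ : ∀ x, Nonempty ({i // g i = x} ≃ {i // f i = x}) := fun x => by
    refine ⟨Fintype.equivOfCardEq ?_⟩
    rw [Fintype.card_subtype, Fintype.card_subtype, h]
  let e := fun x => (e₀ x).some
  exact ⟨Equiv.ofFiberEquiv e, fun i => (Equiv.ofFiberEquiv_map e i).symm⟩

/-- Among the assignments of the next column that keep rows decreasing, take one that minimizes `∑ i
* s' (π i)`, which drives large entries to low rows. At a violation the two entries could be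
exchanged, with a smaller sum. -/
theorem exists_perm_forward {n : ℕ} {s s' : Fin n → ℕ} (h : ∀ i, s' i ≤ s i)
    (hinj : ∀ i j, 0 < s' i → s' i = s' j → i = j) :
    ∃ π : Equiv.Perm (Fin n), (∀ i, s' (π i) ≤ s i) ∧
      ∀ k j, k < j → 0 < s' (π j) → s' (π j) ≤ s k → s' (π j) < s' (π k) := by
  classical
  have hne : ({π | ∀ i, s' (π i) ≤ s i} : Finset (Equiv.Perm (Fin n))).Nonempty :=
    ⟨1, by simpa using h⟩
  obtain ⟨π, hπ, hmin⟩ := exists_min_image _ (fun π => ∑ i : Fin n, (i : ℕ) * s' (π i)) hne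
  simp only [mem_filter, mem_univ, true_and] at hπ hmin
  refine ⟨π, hπ, fun k j hkj hpos hle => ?_⟩
  by_contra hlt
  have hlt' : s' (π k) < s' (π j) := by
    refine lt_of_le_of_ne (not_lt.1 hlt) fun he => hkj.ne ?_
    exact (π.injective (hinj _ _ hpos he.symm)).symm
  have h1 := hmin (π * Equiv.swap k j) (fun i => by
    rcases eq_or_ne i k with rfl | hik
    · simpa using hle
    · rcases eq_or_ne i j with rfl | hij
      · simpa using hlt'.le.trans (hπ i)
      · simpa [Equiv.swap_apply_of_ne_of_ne hik hij] using hπ i)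
  have hs : ∀ f : Fin n → ℕ, ∑ i, f i = f k + (f j + ∑ i ∈ (univ.erase k).erase j, f i) := by
    intro f
    rw [← Finset.add_sum_erase univ f (mem_univ k),
      ← Finset.add_sum_erase (univ.erase k) f (a := j) (by simp [hkj.ne'])]
  rw [hs, hs (fun i => (i : ℕ) * s' ((π * Equiv.swap k j) i))] at h1
  have h2 : ∑ i ∈ (univ.erase k).erase j, (i : ℕ) * s' ((π * Equiv.swap k j) i) =
      ∑ i ∈ (univ.erase k).erase j, (i : ℕ) * s' (π i) := by
    refine sum_congr rfl fun i hi => ?_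
    simp only [mem_erase] at hi
    simp [Equiv.swap_apply_of_ne_of_ne hi.2.1 hi.1]
  rw [h2] at h1
  simp only [Equiv.Perm.mul_apply, Equiv.swap_apply_left, Equiv.swap_apply_right] at h1
  have hkj' : (k : ℕ) < j := hkj
  obtain ⟨d, hd⟩ := Nat.exists_eq_add_of_lt hkj'
  obtain ⟨d', hd'⟩ := Nat.exists_eq_add_of_lt hlt'
  rw [hd, hd'] at h1
  -- The exchange lowers the sum by `(j - k) * (s' (π j) - s' (π k)) = (d + 1) * (d' + 1)`.
  nlinarith [Nat.zero_le (d * d')]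

/-- The dual exchange argument, with a maximum. The competing permutations must also preserve which
rows have a box, so that the shape does not change. -/
theorem exists_perm_backward {n : ℕ} {s' s : Fin n → ℕ} (h : ∀ i, s' i ≤ s i) :
    ∃ π : Equiv.Perm (Fin n), (∀ i, s' i ≤ s (π i)) ∧ (∀ i, 0 < s (π i) ↔ 0 < s i) ∧
      ∀ i j, i < j → 0 < s (π j) → s (π j) < s (π i) → s (π j) < s' i := by
  classical
  have hne : ({π | (∀ i, s' i ≤ s (π i)) ∧ (∀ i, 0 < s (π i) ↔ 0 < s i)} :
      Finset (Equiv.Perm (Fin n))).Nonempty :=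
    ⟨1, by simpa using h⟩
  obtain ⟨π, hπ, hmax⟩ := exists_max_image _ (fun π => ∑ i : Fin n, (i : ℕ) * s (π i)) hne
  simp only [mem_filter, mem_univ, true_and] at hπ hmax
  refine ⟨π, hπ.1, hπ.2, fun k j hkj hpos hlt' => ?_⟩
  by_contra hle
  have h1 := hmax (π * Equiv.swap k j) (by
    have e1 := hπ.2 k
    have e2 := hπ.2 j
    constructor
    all_goals
      intro i
      rcases eq_or_ne i k with rfl | hik
      · simp; omega
      · rcases eq_or_ne i j with rfl | hij
        · have := hπ.1 i
          simp; omega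
        · simp [Equiv.swap_apply_of_ne_of_ne hik hij, hπ.1 i, hπ.2 i])
  have hs : ∀ f : Fin n → ℕ, ∑ i, f i = f k + (f j + ∑ i ∈ (univ.erase k).erase j, f i) := by
    intro f
    rw [← Finset.add_sum_erase univ f (mem_univ k),
      ← Finset.add_sum_erase (univ.erase k) f (a := j) (by simp [hkj.ne'])]
  rw [hs, hs (fun i => (i : ℕ) * s (π i))] at h1
  have h2 : ∑ i ∈ (univ.erase k).erase j, (i : ℕ) * s ((π * Equiv.swap k j) i) =
      ∑ i ∈ (univ.erase k).erase j, (i : ℕ) * s (π i) := by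
    refine sum_congr rfl fun i hi => ?_
    simp only [mem_erase] at hi
    simp [Equiv.swap_apply_of_ne_of_ne hi.2.1 hi.1]
  rw [h2] at h1
  simp only [Equiv.Perm.mul_apply, Equiv.swap_apply_left, Equiv.swap_apply_right] at h1
  have hkj' : (k : ℕ) < j := hkj
  obtain ⟨d, hd⟩ := Nat.exists_eq_add_of_lt hkj'
  obtain ⟨d', hd'⟩ := Nat.exists_eq_add_of_lt hlt'
  rw [hd, hd'] at h1
  nlinarith [Nat.zero_le (d * d')]

/-- The array has nonzero entries exactly in the boxes of the diagram of `a`. -/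
def HasShape {n : ℕ} (t : Fin n → ℕ → ℕ) (a : Fin n → ℕ) : Prop := ∀ i c, 0 < t i c ↔ c < a i

theorem IsArray.of_sameColumns {n : ℕ} {t z : Fin n → ℕ → ℕ} (hz : IsArray z)
    (hc : SameColumns z t) (ht : ∀ i c, t i (c + 1) ≤ t i c) : IsArray t := by
  refine ⟨ht, fun i j c hpos he => ?_⟩
  obtain ⟨π, hπ⟩ := hc c
  rw [hπ] at hpos
  rw [hπ, hπ] at he
  exact π.injective (hz.inj _ _ _ hpos he)

theorem IsArray.antitone {n : ℕ} {t : Fin n → ℕ → ℕ} (h : IsArray t) (i : Fin n) :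
    Antitone (t i) := antitone_nat_of_succ_le (h.anti i)

/-- The columns are arranged one after another, each greedily against the one before; the
arrangement `π₀` of the first column is free. -/
theorem exists_fwd {n : ℕ} {z : Fin n → ℕ → ℕ} (hz : IsArray z) (π₀ : Equiv.Perm (Fin n)) :
    ∃ t : Fin n → ℕ → ℕ, IsArray t ∧ Fwd t ∧ SameColumns z t ∧ ∀ i, t i 0 = z (π₀ i) 0 := by
  have step : ∀ (c : ℕ) (π : Equiv.Perm (Fin n)), ∃ ρ : Equiv.Perm (Fin n),
      (∀ i, z (ρ i) (c + 1) ≤ z (π i) c) ∧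
      ∀ k j, k < j → 0 < z (ρ j) (c + 1) → z (ρ j) (c + 1) ≤ z (π k) c →
        z (ρ j) (c + 1) < z (ρ k) (c + 1) := by
    intro c π
    obtain ⟨σ, h1, h2⟩ := exists_perm_forward (s := fun i => z (π i) c)
      (s' := fun i => z (π i) (c + 1)) (fun i => hz.anti _ _)
      (fun i j hp he => π.injective (hz.inj _ _ _ hp he))
    exact ⟨σ.trans π, h1, h2⟩
  choose f hf1 hf2 using step
  let π : ℕ → Equiv.Perm (Fin n) := fun c => Nat.rec π₀ (fun c p => f c p) c
  have hc : SameColumns z fun i c => z (π c i) c := fun c => ⟨π c, fun i => rfl⟩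
  exact ⟨fun i c => z (π c i) c, hz.of_sameColumns hc fun i c => hf1 c (π c) i,
    fun k j c => hf2 c (π c) k j, hc, fun i => rfl⟩

/-- Only the number of boxes in each column has to agree with `a`, not the row lengths of `z`. The
first column is stripped off and the rest is threaded into the shape `a - 1`. The first column of
`z` is then redistributed so that each entry stands beside the value that was on its right in `z`,
and is finally rearranged greedily. -/
theorem exists_bwd {n : ℕ} (N : ℕ) : ∀ {z : Fin n → ℕ → ℕ} {a : Fin n → ℕ}, IsArray z →
    (∀ i c, N ≤ c → z i c = 0) → (∀ c, #{i | 0 < z i c} = #{i | c < a i}) →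
    ∃ e : Fin n → ℕ → ℕ, IsArray e ∧ Bwd e ∧ SameColumns z e ∧ HasShape e a := by
  induction N with
  | zero =>
    intro z a hz h0 hcard
    refine ⟨z, hz, fun i j c _ h => ?_, fun c => ⟨1, fun i => rfl⟩, fun i c => ?_⟩
    · simp [h0] at h
    · have := hcard c
      simp only [h0 _ _ (Nat.zero_le _), lt_self_iff_false, filter_false, card_empty] at this
      have := Finset.card_eq_zero.1 this.symm
      simp only [h0 _ _ (Nat.zero_le _), lt_self_iff_false, false_iff]
      intro h
      have h' : i ∈ ({i | c < a i} : Finset (Fin n)) := by simpa using h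
      simp [this] at h'
  | succ N ih =>
    intro z a hz h0 hcard
    obtain ⟨e', he', hb', hc', hs'⟩ := ih (z := fun i c => z i (c + 1)) (a := fun i => a i - 1)
      ⟨fun i c => hz.anti _ _, fun i j c => hz.inj _ _ _⟩ (fun i c h => h0 i (c + 1) (by omega))
      (fun c => by
        rw [hcard (c + 1)]; congr 1; ext i; simp only [mem_filter, mem_univ, true_and]; omega)
    have hs0 : ∀ i, 0 < e' i 0 ↔ 1 < a i := fun i => by rw [hs' i 0]; dsimp only; omega
    have hzz : ∀ i, 0 < z i 1 → 0 < z i 0 := fun i h => h.trans_le (hz.anti i 0)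
    -- The Boolean separates rows with one box from empty rows: both have `0` in the next column,
    -- but only the former must receive an entry.
    obtain ⟨ρ, hρ⟩ := exists_perm_of_card_fiber_eq (f := fun r => (z r 1, decide (0 < z r 0)))
      (g := fun i => (e' i 0, decide (0 < a i))) (by
        rintro ⟨v, b⟩
        simp only [Prod.mk.injEq]
        rcases Nat.eq_zero_or_pos v with rfl | hv
        · have c0 := hcard 0
          have c1 := hcard 1
          have s1 := card_filter_split univ (fun i => z i 0) (u := 0) (w := 1) (by omega)
          have e1 : #{i | z i 1 = 0 ∧ 0 < z i 0} + #{i | 0 < z i 1} = #{i | 0 < z i 0} := by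
            rw [← card_union_of_disjoint]
            · congr 1; ext i
              have := hzz i
              simp only [mem_union, mem_filter, mem_univ, true_and]; omega
            · rw [disjoint_left]; intro i; simp only [mem_filter, mem_univ, true_and]; omega
          have e2 : #{i | e' i 0 = 0 ∧ 0 < a i} + #{i | 1 < a i} = #{i | 0 < a i} := by
            rw [← card_union_of_disjoint]
            · congr 1; ext i
              have := hs0 i
              simp only [mem_union, mem_filter, mem_univ, true_and]; omega
            · rw [disjoint_left]; intro i
              have := hs0 i
              simp only [mem_filter, mem_univ, true_and]; omega
          have e3 : #{i | z i 1 = 0 ∧ ¬ 0 < z i 0} + #{i | 0 < z i 0} = n := by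
            conv_rhs => rw [← Fintype.card_fin n, ← card_univ]
            rw [← card_union_of_disjoint]
            · congr 1; ext i
              have := hzz i
              simp only [mem_union, mem_filter, mem_univ, true_and, iff_true]; omega
            · rw [disjoint_left]; intro i; simp only [mem_filter, mem_univ, true_and]; omega
          have e4 : #{i | e' i 0 = 0 ∧ ¬ 0 < a i} + #{i | 0 < a i} = n := by
            conv_rhs => rw [← Fintype.card_fin n, ← card_univ]
            rw [← card_union_of_disjoint]
            · congr 1; ext i
              have := hs0 i
              simp only [mem_union, mem_filter, mem_univ, true_and, iff_true]; omega
            · rw [disjoint_left]; intro i; simp only [mem_filter, mem_univ, true_and]; omega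
          cases b
          · simp only [decide_eq_false_iff_not]; omega
          · simp only [decide_eq_true_eq]; omega
        · have e1 := hc'.card 0 (fun x => x = v)
          cases b
          · trans 0
            · rw [card_eq_zero, filter_eq_empty_iff]
              intro i _ h
              have := hzz i
              simp only [decide_eq_false_iff_not] at h; omega
            · symm; rw [card_eq_zero, filter_eq_empty_iff]
              intro i _ h
              have := hs0 i
              simp only [decide_eq_false_iff_not] at h; omega
          · trans #{i | z i 1 = v}
            · congr 1; ext i
              have := hzz i
              simp only [mem_filter, mem_univ, true_and, decide_eq_true_eq]; omega
            · refine e1.symm.trans ?_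
              congr 1; ext i
              have := hs0 i
              simp only [mem_filter, mem_univ, true_and, decide_eq_true_eq]; omega)
    simp only [Prod.mk.injEq, decide_eq_decide] at hρ
    obtain ⟨π, h1, h2, h3⟩ := exists_perm_backward (s' := fun i => e' i 0)
      (s := fun i => z (ρ i) 0) (fun i => by rw [(hρ i).1]; exact hz.anti _ _)
    have hc : SameColumns z fun i c => Nat.casesOn c (z (ρ (π i)) 0) (fun c => e' i c) := by
      intro c
      cases c with
      | zero => exact ⟨π.trans ρ, fun i => rfl⟩
      | succ c => exact hc' c
    refine ⟨fun i c => Nat.casesOn c (z (ρ (π i)) 0) (fun c => e' i c),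
      hz.of_sameColumns hc ?_, ?_, hc, ?_⟩
    · intro i c
      cases c with
      | zero => exact h1 i
      | succ c => exact he'.anti i c
    · intro i j c
      cases c with
      | zero => exact h3 i j
      | succ c => exact hb' i j c
    · intro i c
      cases c with
      | zero => exact (h2 i).trans (hρ i).2.symm
      | succ c => exact (hs' i c).trans (by dsimp only; omega)

/-- As `t` starts with the row indices, its rows up to `v` hold all first-column entries up to `v +
1`, and by the bound on `z` its rows up to `v` start with nothing larger. So the comparison holds in
column `0`, and `forward_compare` carries it to the right. -/
theorem prefix_le_of_fwd {n : ℕ} {t z : Fin n → ℕ → ℕ} (hf : Fwd t)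
    (ht0 : ∀ i, t i 0 = 0 ∨ t i 0 = i + 1) (hz : ∀ i c, z i (c + 1) ≤ z i c)
    (hc : SameColumns t z) (hz0 : ∀ i, z i 0 ≤ i + 1) (v : Fin n) (c u : ℕ) (hu : 0 < u) :
    #{i ∈ Finset.Iic v | u ≤ z i c} ≤ #{i ∈ Finset.Iic v | u ≤ t i c} := by
  refine forward_compare _ _ hz hc (hf.closed v) ?_ c u hu
  intro u hu
  calc #{i ∈ Finset.Iic v | u ≤ z i 0} ≤ #{i | u ≤ z i 0 ∧ z i 0 ≤ v + 1} := by
        refine card_le_card fun i => ?_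
        have := hz0 i
        simp only [mem_filter, mem_univ, true_and, Finset.mem_Iic, Fin.le_def]
        omega
    _ = #{i | u ≤ t i 0 ∧ t i 0 ≤ v + 1} := hc.card 0 (fun x => u ≤ x ∧ x ≤ v + 1)
    _ ≤ _ := by
        refine card_le_card fun i => ?_
        have := ht0 i
        simp only [mem_filter, mem_univ, true_and, Finset.mem_Iic, Fin.le_def]
        omega

/-! ### Comparison of the shapes of greedy arrays -/

/-- The left swap order on shapes in terms of initial parts. -/
def PrefixLE {n : ℕ} (a b : Fin n → ℕ) : Prop :=
  ∀ v c, #{i ∈ Finset.Iic v | c < a i} ≤ #{i ∈ Finset.Iic v | c < b i}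

theorem prefixLE_of_arrays {n : ℕ} {t z : Fin n → ℕ → ℕ} {a b : Fin n → ℕ} (hf : Fwd t)
    (ht0 : ∀ i, t i 0 = 0 ∨ t i 0 = i + 1) (hz : ∀ i c, z i (c + 1) ≤ z i c)
    (hc : SameColumns t z) (hz0 : ∀ i, z i 0 ≤ i + 1) (ha : HasShape z a) (hb : HasShape t b) :
    PrefixLE a b := by
  intro v c
  simp only [← ha _ _, ← hb _ _]
  exact prefix_le_of_fwd hf ht0 hz hc hz0 v c 1 one_pos

theorem card_shape_eq {n : ℕ} {t z : Fin n → ℕ → ℕ} {a b : Fin n → ℕ}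
    (hc : SameColumns t z) (ha : HasShape z a) (hb : HasShape t b) (c : ℕ) :
    #{i | c < a i} = #{i | c < b i} := by
  simp only [← ha _ _, ← hb _ _]
  exact hc.card c (fun x => 0 < x)

/-- Converse of `prefixLE_of_arrays`. If row `i` of the `Bwd` array started with an entry above `i +
1`, `back_compare` on the rows up to `i` would find an entry that large among the first entries of
the same rows of `t`, which are at most `i + 1`. `PrefixLE` supplies the hypothesis on the numbers
of boxes. -/
theorem exists_flagged_bwd {n : ℕ} {t : Fin n → ℕ → ℕ} {a b : Fin n → ℕ} (ht : IsArray t)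
    (ht0 : ∀ i, t i 0 = 0 ∨ t i 0 = i + 1) (hb : HasShape t b) (hab : PrefixLE a b)
    (hcard : ∀ c, #{i | c < a i} = #{i | c < b i}) :
    ∃ e : Fin n → ℕ → ℕ, IsArray e ∧ Bwd e ∧ SameColumns t e ∧ HasShape e a ∧
      ∀ i, e i 0 ≤ i + 1 := by
  have h0 : ∀ i c, univ.sup b ≤ c → t i c = 0 := fun i c h => by
    have h1 : b i ≤ univ.sup b := Finset.le_sup (mem_univ i)
    have h2 := hb i c
    omega
  obtain ⟨e, he, hbw, hc, hs⟩ := exists_bwd (univ.sup b) (a := a) ht h0 (fun c => by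
    rw [hcard]; simp only [hb _ _])
  refine ⟨e, he, hbw, hc, hs, fun i => ?_⟩
  by_contra hlt
  have h1 := back_compare (Finset.Iic i) (Finset.Iic i) ht.anti hc.symm (hbw.closed i) (univ.sup b)
    (fun u hu => by
      have : ∀ j, e j (univ.sup b) = 0 := fun j => by
        obtain ⟨π, hπ⟩ := hc (univ.sup b)
        rw [hπ, h0 _ _ le_rfl]
      simp [this, hu.ne'])
    (fun c _ => by
      simp only [hs _ _, hb _ _]; exact hab i c) 0 (Nat.zero_le _) (e i 0) (by omega)
  have h2 : #{j ∈ Finset.Iic i | e i 0 ≤ t j 0} = 0 := by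
    rw [card_eq_zero, filter_eq_empty_iff]
    intro j hj
    have := ht0 j
    simp only [Finset.mem_Iic, Fin.le_def] at hj
    omega
  have h3 : 0 < #{j ∈ Finset.Iic i | e i 0 ≤ e j 0} := card_pos.2 ⟨i, by simp⟩
  omega

/-- Induction from the end of row `i` to the left. If row `i` had the larger entry in column `c`,
then `Bwd` would give `z j c < z i (c + 1)`; past the end of row `i` the right side is `0`, and
before it this contradicts the inequality in column `c + 1`. -/
theorem Bwd.lt_of_le {n : ℕ} {z : Fin n → ℕ → ℕ} {a : Fin n → ℕ} (hz : IsArray z) (hb : Bwd z)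
    (hs : HasShape z a) {i j : Fin n} (hij : i < j) (ha : a i ≤ a j) :
    ∀ c < a i, z i c < z j c := by
  suffices h : ∀ d c, c + d + 1 = a i → z i c < z j c from
    fun c hc => h (a i - c - 1) c (by omega)
  intro d
  induction d with
  | zero =>
    intro c hc
    by_contra hlt
    have h1 : 0 < z j c := (hs j c).2 (by omega)
    have h2 : z j c ≠ z i c := fun h => hij.ne' (hz.inj _ _ _ h1 h)
    have h3 := hb i j c hij h1 (by omega)
    have h4 := (hs i (c + 1)).1 (by omega)
    omega
  | succ d ih =>
    intro c hc
    by_contra hlt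
    have h1 : 0 < z j c := (hs j c).2 (by omega)
    have h2 : z j c ≠ z i c := fun h => hij.ne' (hz.inj _ _ _ h1 h)
    have h3 := hb i j c hij h1 (by omega)
    have h4 := ih (c + 1) (by omega)
    have h5 := hz.anti j c
    omega

/-- Again by induction from the end of row `i`: were `t j (c + 1) ≤ t i c`, row `i` would have to
continue with something larger. -/
theorem Fwd.strong {n : ℕ} {t : Fin n → ℕ → ℕ} {a : Fin n → ℕ} (ht : IsArray t) (hf : Fwd t)
    (hs : HasShape t a) {i j : Fin n} (hij : i < j) (ha : a i < a j) :
    ∀ c < a i, t i c < t j (c + 1) := by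
  suffices h : ∀ d c, c + d + 1 = a i → t i c < t j (c + 1) from
    fun c hc => h (a i - c - 1) c (by omega)
  intro d
  induction d with
  | zero =>
    intro c hc
    by_contra hlt
    have h1 : 0 < t j (c + 1) := (hs j (c + 1)).2 (by omega)
    have h3 := hf i j c hij h1 (by omega)
    have h4 := (hs i (c + 1)).1 (by omega)
    omega
  | succ d ih =>
    intro c hc
    by_contra hlt
    have h1 : 0 < t j (c + 1) := (hs j (c + 1)).2 (by omega)
    have h3 := hf i j c hij h1 (by omega)
    have h4 := ih (c + 1) (by omega)
    have h5 := ht.anti j (c + 1)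
    omega

/-- Quasi-Kohnert condition on rows of different lengths. -/
def Short {n : ℕ} (z : Fin n → ℕ → ℕ) (a : Fin n → ℕ) : Prop :=
  ∀ i j, i < j → a i < a j → ∀ c < a i, z i c < z j (c + 1)

/-- One inequality of initial counts is `prefixLE_of_arrays`. For the other, `Bwd` and `Short`
together make the set of all rows longer than `c` eligible for `back_compare`, from column `c` back
to column `0`. -/
theorem shape_eq_of_short {n : ℕ} {t z : Fin n → ℕ → ℕ} {a b : Fin n → ℕ} (ht : IsArray t)
    (hf : Fwd t) (ht0 : ∀ i, t i 0 = 0 ∨ t i 0 = i + 1) (hb : HasShape t b) (hz : IsArray z)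
    (hbz : Bwd z) (hz0 : ∀ i, z i 0 = 0 ∨ z i 0 = i + 1) (ha : HasShape z a) (hsh : Short z a)
    (hc : SameColumns t z) : a = b := by
  have hD := prefixLE_of_arrays hf ht0 hz.anti hc (fun i => by have := hz0 i; omega) ha hb
  have hE : ∀ v c, #{i ∈ Finset.Iic v | c < b i} ≤ #{i ∈ Finset.Iic v | c < a i} := by
    intro v c
    have h1 := back_compare {i | c < a i} {i | c < b i} ht.anti hc.symm (e := z) (by
      intro i hi j hj c' hpos hlt
      simp only [mem_filter, mem_univ, true_and] at hi hj
      rcases lt_trichotomy i j with hij | rfl | hij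
      · exact hbz i j c' hij hpos hlt
      · omega
      · exact hsh j i hij (by omega) c' ((ha j c').1 hpos)) c
      (by
        intro u hu
        rw [filter_filter, filter_filter]
        have e1 : #{i | c < a i ∧ u ≤ z i c} = #{i | u ≤ z i c} := by
          congr 1; ext i
          have := ha i c
          simp only [mem_filter, mem_univ, true_and]; omega
        have e2 : #{i | c < b i ∧ u ≤ t i c} = #{i | u ≤ t i c} := by
          congr 1; ext i
          have := hb i c
          simp only [mem_filter, mem_univ, true_and]; omega
        rw [e1, e2]
        exact (hc.card c (fun x => u ≤ x)).le)
      (by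
        intro c' hc'
        rw [filter_filter, filter_filter]
        have e1 : #{i | c < a i ∧ 0 < z i c'} = #{i | c < a i} := by
          congr 1; ext i
          have := ha i c'
          simp only [mem_filter, mem_univ, true_and]; omega
        have e2 : #{i | c < b i ∧ 0 < t i c'} = #{i | c < b i} := by
          congr 1; ext i
          have := hb i c'
          simp only [mem_filter, mem_univ, true_and]; omega
        rw [e1, e2, card_shape_eq hc ha hb])
      -- First entries are row indices counted from `1`, so those that are at least `v + 2` count
      -- the rows strictly above `v`.
      0 (Nat.zero_le _) (v + 2) (by omega)
    rw [filter_filter, filter_filter] at h1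
    have e1 : #{i | c < a i} = #{i ∈ Finset.Iic v | c < a i} +
        #{i | c < a i ∧ (v : ℕ) + 2 ≤ z i 0} := by
      rw [← card_union_of_disjoint]
      · congr 1; ext i
        have h2 := ha i 0
        have h3 := hz0 i
        simp only [mem_union, mem_filter, mem_univ, true_and, Finset.mem_Iic, Fin.le_def]; omega
      · rw [disjoint_left]; intro i
        have h2 := ha i 0
        have h3 := hz0 i
        simp only [mem_filter, mem_univ, true_and, Finset.mem_Iic, Fin.le_def]; omega
    have e2 : #{i | c < b i} = #{i ∈ Finset.Iic v | c < b i} +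
        #{i | c < b i ∧ (v : ℕ) + 2 ≤ t i 0} := by
      rw [← card_union_of_disjoint]
      · congr 1; ext i
        have h2 := hb i 0
        have h3 := ht0 i
        simp only [mem_union, mem_filter, mem_univ, true_and, Finset.mem_Iic, Fin.le_def]; omega
      · rw [disjoint_left]; intro i
        have h2 := hb i 0
        have h3 := ht0 i
        simp only [mem_filter, mem_univ, true_and, Finset.mem_Iic, Fin.le_def]; omega
    have e3 := card_shape_eq hc ha hb c
    omega
  funext i
  have : ∀ c, c < a i ↔ c < b i := fun c =>
    iff_of_card_Iic (p := fun i => c < a i) (q := fun i => c < b i)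
      (fun v => le_antisymm (hD v c) (hE v c)) i
  have h1 := this (a i)
  have h2 := this (b i)
  omega

/-- If the inequality fails in column `c`, the parts of rows `i` and `j` to the right of column `c`
can be exchanged. Row `i` becomes longer, which gives the rows up to `i` one box too many in column
`b i`, against `prefix_le_of_fwd`. -/
theorem short_of_shape_eq {n : ℕ} {t z : Fin n → ℕ → ℕ} {b : Fin n → ℕ}
    (hf : Fwd t) (ht0 : ∀ i, t i 0 = 0 ∨ t i 0 = i + 1) (hb : HasShape t b) (hz : IsArray z)
    (hbz : Bwd z) (hz0 : ∀ i, z i 0 ≤ i + 1) (ha : HasShape z b)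
    (hc : SameColumns t z) : Short z b := by
  intro i j hij hbij c hci
  by_contra hlt
  have hcross := hbz.lt_of_le hz ha hij hbij.le c hci
  -- Rows of `y` still decrease: row `i` continues with `z j (c + 1) ≤ z i c` by assumption, and row
  -- `j` with `z i (c + 1) ≤ z i c < z j c`.
  let y : Fin n → ℕ → ℕ := fun k d => if c < d then z (Equiv.swap i j k) d else z k d
  have hy : ∀ k d, y k (d + 1) ≤ y k d := by
    intro k d
    have h0 : ∀ k, z k (d + 1) ≤ z k d := fun k => hz.anti k d
    simp only [y]
    split_ifs with h1 h2 h2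
    · exact h0 _
    · have : d = c := by omega
      subst this
      rcases eq_or_ne k i with rfl | hki
      · simp only [Equiv.swap_apply_left]; omega
      · rcases eq_or_ne k j with rfl | hkj
        · have := h0 i
          simp only [Equiv.swap_apply_right]; omega
        · rw [Equiv.swap_apply_of_ne_of_ne hki hkj]; exact h0 _
    · omega
    · exact h0 _
  have hcy : SameColumns t y := by
    refine hc.trans fun d => ?_
    by_cases h : c < d
    · exact ⟨Equiv.swap i j, fun k => by simp [y, h]⟩
    · exact ⟨1, fun k => by simp [y, h]⟩
  have h1 := prefix_le_of_fwd hf ht0 hy hcy (fun k => by simpa [y] using hz0 k) i (b i) 1 one_pos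
  have hne : c < b i := hci
  have e1 : ({k ∈ Finset.Iic i | 1 ≤ t k (b i)} : Finset (Fin n)) =
      {k ∈ Finset.Iio i | b i < b k} := by
    ext k
    have h2 := hb k (b i)
    simp only [mem_filter, Finset.mem_Iic, Finset.mem_Iio, Nat.succ_le_iff, h2]
    constructor
    · rintro ⟨h3, h4⟩
      exact ⟨lt_of_le_of_ne h3 (by rintro rfl; omega), h4⟩
    · rintro ⟨h3, h4⟩
      exact ⟨h3.le, h4⟩
  have e2 : insert i ({k ∈ Finset.Iio i | b i < b k} : Finset (Fin n)) ⊆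
      {k ∈ Finset.Iic i | 1 ≤ y k (b i)} := by
    intro k hk
    simp only [mem_insert, mem_filter, Finset.mem_Iio] at hk
    rcases hk with rfl | ⟨h3, h4⟩
    · simp only [mem_filter, Finset.mem_Iic, le_refl, true_and, y, hne, if_true,
        Equiv.swap_apply_left]
      exact (ha _ _).2 hbij
    · simp only [mem_filter, Finset.mem_Iic, h3.le, true_and, y, hne, if_true]
      rw [Equiv.swap_apply_of_ne_of_ne h3.ne (h3.trans hij).ne]
      exact (ha _ _).2 h4
  have h3 := card_le_card e2
  rw [card_insert_of_notMem (by simp)] at h3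
  rw [e1] at h1
  omega

/-! ### Triples -/

/-- Inversion triples of numbers. -/
def InvTriple (α β γ : ℕ) : Prop := (γ < α ∧ α ≤ β) ∨ (α ≤ β ∧ β < γ)

/-- The triples of types A and B of an array are inversion triples. -/
def TripleCondition {n : ℕ} (t : Fin n → ℕ → ℕ) (a : Fin n → ℕ) : Prop :=
  (∀ i j, i < j → a j ≤ a i → ∀ c, c + 1 < a j → InvTriple (t i (c + 1)) (t i c) (t j (c + 1))) ∧
  (∀ i j, i < j → a i < a j → ∀ c, c < a i → InvTriple (t j (c + 1)) (t j c) (t i c))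

/-- If the lower row is weakly longer, a type A triple is the `Fwd` condition in other words. If the
higher row is longer, type B triples propagate the inequality of the first column along the rows to
`t k d < t j (d + 1)`, so the premise of `Fwd` never occurs. -/
theorem fwd_iff_tripleCondition {n : ℕ} {t : Fin n → ℕ → ℕ} {a : Fin n → ℕ} (ht : IsArray t)
    (hs : HasShape t a) (h0 : ∀ i j, i < j → 0 < a i → 0 < a j → t i 0 < t j 0) :
    Fwd t ↔ TripleCondition t a := by
  constructor
  · intro hf
    refine ⟨fun i j hij ha c hc => ?_, fun i j hij ha c hc => ?_⟩
    · have h1 := hf i j c hij ((hs _ _).2 hc)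
      have h2 := ht.anti i c
      unfold InvTriple; omega
    · have h1 := hf.strong ht hs hij ha c hc
      have h2 := ht.anti j c
      unfold InvTriple; omega
  · rintro ⟨hA, hB⟩ k j c hkj hpos hle
    have hcj := (hs j (c + 1)).1 hpos
    have hck := (hs k c).1 (by omega)
    rcases le_or_gt (a j) (a k) with h | h
    · have := hA k j hkj h c hcj
      unfold InvTriple at this; omega
    · exfalso
      have key : ∀ d < a k, t k d < t j (d + 1) := by
        intro d
        induction d with
        | zero =>
          intro hd
          have h1 := hB k j hkj h 0 hd
          have h2 := h0 k j hkj hd (by omega)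
          unfold InvTriple at h1; omega
        | succ d ih =>
          intro hd
          have h1 := hB k j hkj h (d + 1) hd
          have h2 := ih (by omega)
          have h3 := ht.anti k d
          unfold InvTriple at h1; omega
      have := key c hck
      omega

/-- Reversing the rows exchanges the roles of the two types: type B triples now express `Bwd`, and
type A triples propagate the order of the first column so that the premise of `Bwd` cannot occur. -/
theorem bwd_iff_tripleCondition {n : ℕ} {t : Fin n → ℕ → ℕ} {a : Fin n → ℕ} (ht : IsArray t)
    (hs : HasShape t a) (h0 : ∀ i j, i < j → t i 0 < t j 0) :
    Bwd t ↔ TripleCondition (fun i => t i.rev) (fun i => a i.rev) := by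
  constructor
  · intro hf
    refine ⟨fun j i hij ha c hc => ?_, fun j i hij ha c hc => ?_⟩
    · have h1 := hf.lt_of_le ht hs (Fin.rev_lt_rev.2 hij) ha (c + 1) hc
      have h2 := ht.anti j.rev c
      unfold InvTriple; dsimp only; omega
    · have h1 := hf i.rev j.rev c (Fin.rev_lt_rev.2 hij) ((hs _ _).2 hc)
      have h2 := ht.anti i.rev c
      have h3 : t j.rev c ≠ t i.rev c := fun h =>
        hij.ne (Fin.rev_injective (ht.inj _ _ _ ((hs _ _).2 hc) h))
      unfold InvTriple; dsimp only; omega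
  · rintro ⟨hA, hB⟩ i j c hij hpos hlt
    have hB' := hB j.rev i.rev (Fin.rev_lt_rev.2 hij)
    have hA' := hA j.rev i.rev (Fin.rev_lt_rev.2 hij)
    simp only [Fin.rev_rev] at hA' hB'
    rcases le_or_gt (a i) (a j) with h | h
    · exfalso
      have hci := (hs i c).1 (by omega)
      have key : ∀ d < a i, t i d < t j d := by
        intro d
        induction d with
        | zero => intro _; exact h0 i j hij
        | succ d ih =>
          intro hd
          have h1 := hA' h d hd
          have h2 := ih (by omega)
          have h3 := ht.anti i d
          unfold InvTriple at h1; omega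
      have := key c hci
      omega
    · have := hB' h c ((hs j c).1 hpos)
      unfold InvTriple at this; omega

/-! ### Set-valued fillings and arrays -/

/-- The largest element of a set of labels, counted from `1`, and `0` for the empty set. -/
def top {n : ℕ} (s : Finset (Fin n)) : ℕ := s.sup fun k => (k : ℕ) + 1

theorem lt_top_of_mem {n : ℕ} {s : Finset (Fin n)} {k : Fin n} (h : k ∈ s) : (k : ℕ) + 1 ≤ top s :=
  Finset.le_sup (f := fun k : Fin n => (k : ℕ) + 1) h

theorem top_le_iff {n : ℕ} {s : Finset (Fin n)} {m : ℕ} :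
    top s ≤ m ↔ ∀ k ∈ s, (k : ℕ) + 1 ≤ m := Finset.sup_le_iff

theorem exists_mem_top {n : ℕ} {s : Finset (Fin n)} (h : s.Nonempty) :
    ∃ k ∈ s, top s = k + 1 := Finset.exists_mem_eq_sup s h _

theorem top_pos_iff {n : ℕ} {s : Finset (Fin n)} : 0 < top s ↔ s.Nonempty := by
  constructor
  · intro h
    by_contra hs
    rw [not_nonempty_iff_eq_empty] at hs
    simp [hs, top] at h
  · rintro ⟨k, hk⟩
    have := lt_top_of_mem hk
    omega

theorem top_empty {n : ℕ} : top (∅ : Finset (Fin n)) = 0 := rfl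

theorem max_eq_of_top {n : ℕ} {s : Finset (Fin n)} {k : Fin n} (h : k ∈ s)
    (h' : top s = k + 1) : s.max = k := by
  refine le_antisymm (Finset.max_le fun x hx => ?_) (Finset.le_max h)
  have := lt_top_of_mem hx
  exact_mod_cast (show x ≤ k by rw [Fin.le_def]; omega)

theorem max_le_max_iff {n : ℕ} {s s' : Finset (Fin n)} : s.max ≤ s'.max ↔ top s ≤ top s' := by
  rcases s.eq_empty_or_nonempty with rfl | hs
  · simp [top_empty]
  obtain ⟨k, hk, hk'⟩ := exists_mem_top hs
  rw [max_eq_of_top hk hk', hk']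
  rcases s'.eq_empty_or_nonempty with rfl | hs'
  · simp [top_empty]
  obtain ⟨l, hl, hl'⟩ := exists_mem_top hs'
  rw [max_eq_of_top hl hl', hl', WithBot.coe_le_coe, Fin.le_def]
  omega

theorem max_lt_max_iff {n : ℕ} {s s' : Finset (Fin n)} : s.max < s'.max ↔ top s < top s' := by
  rw [← not_le, ← not_le, max_le_max_iff]

theorem coe_lt_max_iff {n : ℕ} {s : Finset (Fin n)} {k : Fin n} :
    (k : WithBot (Fin n)) < s.max ↔ (k : ℕ) + 1 < top s := by
  have : (k : WithBot (Fin n)) = ({k} : Finset (Fin n)).max := by simp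
  rw [this, max_lt_max_iff]
  simp [top]

theorem max_le_coe_iff {n : ℕ} {s : Finset (Fin n)} {k : Fin n} :
    s.max ≤ (k : WithBot (Fin n)) ↔ top s ≤ (k : ℕ) + 1 := by
  rw [← not_lt, coe_lt_max_iff, not_lt]

theorem max_eq_coe_iff {n : ℕ} {s : Finset (Fin n)} {k : Fin n} :
    s.max = (k : WithBot (Fin n)) ↔ top s = (k : ℕ) + 1 := by
  have : (k : WithBot (Fin n)) = ({k} : Finset (Fin n)).max := by simp
  rw [this, le_antisymm_iff, max_le_max_iff, max_le_max_iff, ← le_antisymm_iff]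
  simp [top]

theorem isInversionTriple_iff {n : ℕ} {s s' s'' : Finset (Fin n)} :
    IsInversionTriple s.max s'.max s''.max ↔ InvTriple (top s) (top s') (top s'') := by
  simp only [IsInversionTriple, InvTriple, max_lt_max_iff, max_le_max_iff]

/-- The array of anchors. -/
def tops {n : ℕ} {a : Fin n → ℕ} (T : SetFilling a) (i : Fin n) (c : ℕ) : ℕ := top (cell T i c)

/-- The set of all labels in a column. -/
def colUnion {n : ℕ} {a : Fin n → ℕ} (T : SetFilling a) (c : ℕ) : Finset (Fin n) :=
  univ.biUnion fun i => cell T i c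

theorem mem_colUnion {n : ℕ} {a : Fin n → ℕ} {T : SetFilling a} {c : ℕ} {k : Fin n} :
    k ∈ colUnion T c ↔ ∃ i, k ∈ cell T i c := by simp [colUnion]

theorem lt_of_mem_cell {n : ℕ} {a : Fin n → ℕ} {T : SetFilling a} {i : Fin n} {c : ℕ} {k : Fin n}
    (h : k ∈ cell T i c) : c < a i := by
  by_contra hc
  simp [cell, hc] at h

theorem cell_eq {n : ℕ} {a : Fin n → ℕ} (T : SetFilling a) (i : Fin n) (c : Fin (a i)) :
    cell T i c = T i c := by simp [cell]

theorem cell_injective {n : ℕ} {a : Fin n → ℕ} {T T' : SetFilling a}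
    (h : ∀ i c, cell T i c = cell T' i c) : T = T' := by
  funext i c
  rw [← cell_eq T, ← cell_eq T', h]

/-- The filling with the given sets in the boxes. -/
def ofCell {n : ℕ} (a : Fin n → ℕ) (M : Fin n → ℕ → Finset (Fin n)) : SetFilling a :=
  fun i c => M i c

theorem cell_ofCell {n : ℕ} {a : Fin n → ℕ} {M : Fin n → ℕ → Finset (Fin n)} {i : Fin n} {c : ℕ}
    (h : a i ≤ c → M i c = ∅) : cell (ofCell a M) i c = M i c := by
  by_cases hc : c < a i
  · simp [cell, ofCell, hc]
  · simp [cell, hc, h (not_lt.1 hc)]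

theorem IsSemistandard.hasShape {n : ℕ} {a : Fin n → ℕ} {T : SetFilling a}
    (h : IsSemistandard T) : HasShape (tops T) a := by
  intro i c
  rw [tops, top_pos_iff]
  constructor
  · rintro ⟨k, hk⟩; exact lt_of_mem_cell hk
  · intro hc
    have := h.nonempty i ⟨c, hc⟩
    rwa [← cell_eq T] at this

theorem IsSemistandard.isArray {n : ℕ} {a : Fin n → ℕ} {T : SetFilling a}
    (h : IsSemistandard T) : IsArray (tops T) := by
  constructor
  · intro i c
    rw [tops, top_le_iff]
    intro k hk
    have h1 := (h.hasShape i (c + 1)).2 (lt_of_mem_cell hk)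
    have h2 := (h.hasShape i c).2 (by have := lt_of_mem_cell hk; omega)
    obtain ⟨x, hx⟩ := top_pos_iff.1 h2
    have h3 := h.row i c x hx k hk
    have h4 := lt_top_of_mem hx
    rw [Fin.le_def] at h3
    rw [tops]; omega
  · intro i j c hpos he
    obtain ⟨x, hx, hx'⟩ := exists_mem_top (top_pos_iff.1 hpos)
    rw [he] at hpos
    obtain ⟨y, hy, hy'⟩ := exists_mem_top (top_pos_iff.1 hpos)
    have : x = y := by
      simp only [tops] at he; rw [Fin.ext_iff]; omega
    subst this
    exact h.column i j c x hx hy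

theorem IsSemistandard.tripleCondition {n : ℕ} {a : Fin n → ℕ} {T : SetFilling a}
    (h : IsSemistandard T) : TripleCondition (tops T) a :=
  ⟨fun i j hij ha c hc => isInversionTriple_iff.1 (h.tripleA i j hij ha c hc),
    fun i j hij ha c hc => isInversionTriple_iff.1 (h.tripleB i j hij ha c hc)⟩

/-- The label `k` (counted from `0`) belongs to the box `(i, c)` if it occurs in column `c`. -/
def InBox {n : ℕ} (t : Fin n → ℕ → ℕ) (k : Fin n) (i : Fin n) (c : ℕ) : Prop :=
  t i c = k + 1 ∨ ((∀ j, t j c ≠ k + 1) ∧ (k : ℕ) + 1 < t i c ∧ t i (c + 1) ≤ k + 1 ∧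
    ∀ j, (k : ℕ) + 1 < t j c → t j (c + 1) ≤ k + 1 → t i c ≤ t j c)

theorem InBox.unique {n : ℕ} {t : Fin n → ℕ → ℕ} (ht : IsArray t) {k i i' : Fin n} {c : ℕ}
    (h : InBox t k i c) (h' : InBox t k i' c) : i = i' := by
  rcases h with h | ⟨h1, h2, h3, h4⟩
  · rcases h' with h' | ⟨h1', -⟩
    · exact ht.inj i i' c (by omega) (by omega)
    · exact absurd h (h1' i)
  · rcases h' with h' | ⟨h1', h2', h3', h4'⟩
    · exact absurd h' (h1 i')
    · exact ht.inj i i' c (by omega) (le_antisymm (h4 _ h2' h3') (h4' _ h2 h3))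

theorem IsSemistandard.inBox {n : ℕ} {a : Fin n → ℕ} {T : SetFilling a}
    (h : IsSemistandard T) {k i : Fin n} {c : ℕ} (hk : k ∈ cell T i c) : InBox (tops T) k i c := by
  by_cases hkt : tops T i c = k + 1
  · exact Or.inl hkt
  have hle := lt_top_of_mem hk
  have hlt : (k : ℕ) + 1 < tops T i c := lt_of_le_of_ne hle (Ne.symm hkt)
  refine Or.inr ⟨fun j hj => ?_, hlt, ?_, fun j hj hj' => ?_⟩
  · obtain ⟨x, hx, hx'⟩ := exists_mem_top (top_pos_iff.1 (show 0 < tops T j c by omega))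
    have : x = k := by simp only [tops] at hj; rw [Fin.ext_iff]; omega
    subst this
    exact hkt (h.column i j c x hk hx ▸ hj)
  · rw [tops, top_le_iff]
    intro y hy
    have := h.row i c k hk y hy
    rw [Fin.le_def] at this
    omega
  · refine max_le_max_iff.1 (h.free i c k hk (coe_lt_max_iff.2 hlt) j (coe_lt_max_iff.2 hj) ?_)
    intro y hy
    have := top_le_iff.1 hj' y hy
    rw [Fin.le_def]
    omega

/-- There is no choice for the labels of a column: an anchor sits in its own box, and (S4) names the
box of a free entry. -/
theorem IsSemistandard.mem_cell_iff {n : ℕ} {a : Fin n → ℕ} {T : SetFilling a}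
    (h : IsSemistandard T) {k i : Fin n} {c : ℕ} :
    k ∈ cell T i c ↔ k ∈ colUnion T c ∧ InBox (tops T) k i c := by
  constructor
  · exact fun hk => ⟨mem_colUnion.2 ⟨i, hk⟩, h.inBox hk⟩
  · rintro ⟨hk, hb⟩
    obtain ⟨i', hi'⟩ := mem_colUnion.1 hk
    rwa [hb.unique h.isArray (h.inBox hi')]

theorem top_le {n : ℕ} (s : Finset (Fin n)) : top s ≤ n :=
  top_le_iff.2 fun k _ => k.2

/-- Column contents compatible with an array of anchors. -/
structure Admissible {n : ℕ} (t : Fin n → ℕ → ℕ) (G : ℕ → Finset (Fin n)) : Prop where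
  le : ∀ i c, t i c ≤ n
  anchors : ∀ i c (k : Fin n), t i c = k + 1 → k ∈ G c
  box : ∀ c, ∀ k ∈ G c, ∃ i, InBox t k i c

theorem IsSemistandard.admissible {n : ℕ} {a : Fin n → ℕ} {T : SetFilling a}
    (h : IsSemistandard T) : Admissible (tops T) (colUnion T) := by
  refine ⟨fun i c => top_le _, fun i c k hk => ?_, fun c k hk => ?_⟩
  · obtain ⟨x, hx, hx'⟩ := exists_mem_top (top_pos_iff.1 (show 0 < tops T i c by omega))
    have : x = k := by simp only [tops] at hk; rw [Fin.ext_iff]; omega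
    subst this
    exact mem_colUnion.2 ⟨i, hx⟩
  · obtain ⟨i, hi⟩ := mem_colUnion.1 hk
    exact ⟨i, h.inBox hi⟩

open Classical in
/-- The filling with given anchors and given columns. -/
def fillingOf {n : ℕ} (a : Fin n → ℕ) (t : Fin n → ℕ → ℕ) (G : ℕ → Finset (Fin n)) : SetFilling a :=
  ofCell a fun i c => {k ∈ G c | InBox t k i c}

theorem mem_cell_fillingOf {n : ℕ} {a : Fin n → ℕ} {t : Fin n → ℕ → ℕ} {G : ℕ → Finset (Fin n)}
    (hs : HasShape t a) {k i : Fin n} {c : ℕ} :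
    k ∈ cell (fillingOf a t G) i c ↔ k ∈ G c ∧ InBox t k i c := by
  rw [fillingOf, cell_ofCell]
  · simp
  · intro h
    have h1 : t i c = 0 := by have := hs i c; omega
    refine eq_empty_iff_forall_notMem.2 fun k hk => ?_
    simp only [mem_filter] at hk
    rcases hk.2 with (h2 | ⟨-, h2, -⟩) <;> omega

theorem InBox.le {n : ℕ} {t : Fin n → ℕ → ℕ} {k i : Fin n} {c : ℕ} (h : InBox t k i c) :
    (k : ℕ) + 1 ≤ t i c := by
  rcases h with h | ⟨-, h, -⟩ <;> omega

theorem tops_fillingOf {n : ℕ} {a : Fin n → ℕ} {t : Fin n → ℕ → ℕ} {G : ℕ → Finset (Fin n)}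
    (hs : HasShape t a) (hG : Admissible t G) : tops (fillingOf a t G) = t := by
  funext i c
  refine le_antisymm (top_le_iff.2 fun k hk => ((mem_cell_fillingOf hs).1 hk).2.le) ?_
  rcases Nat.eq_zero_or_pos (t i c) with h0 | h0
  · rw [h0]; exact Nat.zero_le _
  · have h1 := hG.le i c
    have h2 : t i c = ((⟨t i c - 1, by omega⟩ : Fin n) : ℕ) + 1 := by simp only; omega
    have h3 := lt_top_of_mem ((mem_cell_fillingOf hs).2 ⟨hG.anchors i c _ h2, Or.inl h2⟩)
    exact h2 ▸ h3

theorem colUnion_fillingOf {n : ℕ} {a : Fin n → ℕ} {t : Fin n → ℕ → ℕ} {G : ℕ → Finset (Fin n)}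
    (hs : HasShape t a) (hG : Admissible t G) (c : ℕ) : colUnion (fillingOf a t G) c = G c := by
  ext k
  simp only [mem_colUnion, mem_cell_fillingOf hs]
  constructor
  · rintro ⟨i, h, -⟩; exact h
  · intro h
    obtain ⟨i, hi⟩ := hG.box c k h
    exact ⟨i, h, hi⟩

theorem isSemistandard_fillingOf {n : ℕ} {a : Fin n → ℕ} {t : Fin n → ℕ → ℕ}
    {G : ℕ → Finset (Fin n)} (ht : IsArray t) (hs : HasShape t a) (htr : TripleCondition t a)
    (hG : Admissible t G) : IsSemistandard (fillingOf a t G) := by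
  have htops : ∀ i c, top (cell (fillingOf a t G) i c) = t i c := fun i c =>
    congrFun₂ (tops_fillingOf hs hG) i c
  refine ⟨fun i c => ?_, fun i j c k hi hj => ?_, fun i c x hx y hy => ?_, fun i j hij ha c hc => ?_,
    fun i j hij ha c hc => ?_, fun i c k hk hlt j hj hy => ?_⟩
  · rw [← cell_eq (fillingOf a t G), ← top_pos_iff, htops, hs]; exact c.2
  · exact ((mem_cell_fillingOf hs).1 hi).2.unique ht ((mem_cell_fillingOf hs).1 hj).2
  · have h1 := ((mem_cell_fillingOf hs).1 hx).2
    have h2 := ((mem_cell_fillingOf hs).1 hy).2.le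
    have h3 := ht.anti i c
    rw [Fin.le_def]
    rcases h1 with h1 | ⟨-, -, h1, -⟩ <;> omega
  · simp only [anchor, isInversionTriple_iff, htops]
    exact htr.1 i j hij ha c hc
  · simp only [anchor, isInversionTriple_iff, htops]
    exact htr.2 i j hij ha c hc
  · simp only [anchor, coe_lt_max_iff, max_le_max_iff, htops] at hlt hj ⊢
    have h1 := ((mem_cell_fillingOf hs).1 hk).2
    rcases h1 with h1 | ⟨-, -, -, h1⟩
    · omega
    · refine h1 j hj ?_
      rw [← htops, top_le_iff]
      intro y hy'
      have := hy y hy'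
      rw [Fin.le_def] at this
      omega

/-- Removes the minimality from `InBox`: once some box can take `k`, the one with the least anchor
can be chosen. -/
theorem exists_inBox_iff {n : ℕ} {t : Fin n → ℕ → ℕ} {k : Fin n} {c : ℕ} :
    (∃ i, InBox t k i c) ↔
      (∃ i, t i c = k + 1) ∨ ∃ i, (k : ℕ) + 1 < t i c ∧ t i (c + 1) ≤ k + 1 := by
  constructor
  · rintro ⟨i, h | ⟨-, h1, h2, -⟩⟩
    · exact Or.inl ⟨i, h⟩
    · exact Or.inr ⟨i, h1, h2⟩
  · intro h
    by_cases h0 : ∃ i, t i c = k + 1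
    · obtain ⟨i, hi⟩ := h0; exact ⟨i, Or.inl hi⟩
    · obtain ⟨i, hi⟩ := h.resolve_left h0
      obtain ⟨i₀, h1, h2⟩ := exists_min_image
        ({i | (k : ℕ) + 1 < t i c ∧ t i (c + 1) ≤ k + 1} : Finset (Fin n)) (fun i => t i c)
        ⟨i, by simpa using hi⟩
      simp only [mem_filter, mem_univ, true_and] at h1 h2
      push Not at h0
      exact ⟨i₀, Or.inr ⟨h0, h1.1, h1.2, fun j hj hj' => h2 j ⟨hj, hj'⟩⟩⟩

/-- As rows decrease, the rows with an entry above `m` in column `c + 1` are among those with one in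
column `c`. The inclusion is strict precisely if some box can take `m`, and the two counts no longer
see the rows. -/
theorem exists_available_iff {n : ℕ} {t : Fin n → ℕ → ℕ} (ht : IsArray t) (m c : ℕ) :
    (∃ i, m < t i c ∧ t i (c + 1) ≤ m) ↔ #{i | m < t i (c + 1)} < #{i | m < t i c} := by
  have hsub : ({i | m < t i (c + 1)} : Finset (Fin n)) ⊆ ({i | m < t i c} : Finset (Fin n)) := by
    intro i
    have := ht.anti i c
    simp only [mem_filter, mem_univ, true_and]; omega
  constructor
  · rintro ⟨i, h1, h2⟩
    refine card_lt_card (ssubset_iff_of_subset hsub |>.2 ⟨i, by simpa using h1, by simpa using h2⟩)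
  · intro h
    by_contra hne
    push Not at hne
    refine absurd (card_le_card fun i => ?_) (not_le.2 h)
    have := hne i
    simpa using this

theorem SameColumns.exists_eq_iff {n : ℕ} {t z : Fin n → ℕ → ℕ} (h : SameColumns t z) (c x : ℕ) :
    (∃ i, t i c = x) ↔ ∃ i, z i c = x := by
  obtain ⟨π, hπ⟩ := h c
  constructor
  · rintro ⟨i, hi⟩; exact ⟨π.symm i, by rw [hπ]; simpa using hi⟩
  · rintro ⟨i, hi⟩; exact ⟨π i, by rw [← hπ]; exact hi⟩

/-- This lets rows be rethreaded under fixed free entries: the existence of a box for `k` has been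
reduced to counts in two adjacent columns. -/
theorem Admissible.of_sameColumns {n : ℕ} {t z : Fin n → ℕ → ℕ} {G : ℕ → Finset (Fin n)}
    (hG : Admissible t G) (ht : IsArray t) (hz : IsArray z) (h : SameColumns t z) :
    Admissible z G := by
  refine ⟨fun i c => ?_, fun i c k hk => ?_, fun c k hk => ?_⟩
  · obtain ⟨π, hπ⟩ := h c
    rw [hπ]; exact hG.le _ _
  · obtain ⟨j, hj⟩ := (h.exists_eq_iff c (k + 1)).2 ⟨i, hk⟩
    exact hG.anchors j c k hj
  · have h1 := exists_inBox_iff.1 (hG.box c k hk)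
    rw [exists_available_iff ht, h.exists_eq_iff, ← h.card c (fun x => (k : ℕ) + 1 < x),
      ← h.card (c + 1) (fun x => (k : ℕ) + 1 < x), ← exists_available_iff hz] at h1
    exact exists_inBox_iff.2 h1

/-- A filling is determined by its anchors and its columns. -/
theorem IsSemistandard.ext {n : ℕ} {a : Fin n → ℕ} {T T' : SetFilling a}
    (h : IsSemistandard T) (h' : IsSemistandard T') (ht : tops T = tops T')
    (hG : ∀ c, colUnion T c = colUnion T' c) : T = T' := by
  refine cell_injective fun i c => ?_
  ext k
  rw [h.mem_cell_iff, h'.mem_cell_iff, ht, hG]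

/-! ### Weight and excess in terms of columns -/

theorem sum_boxes {n : ℕ} {a : Fin n → ℕ} (T : SetFilling a) (F : ℕ → Finset (Fin n) → ℕ)
    (hF : ∀ c, F c ∅ = 0) {N : ℕ} (hN : ∀ i, a i ≤ N) :
    ∑ i, ∑ c : Fin (a i), F c (T i c) = ∑ c ∈ range N, ∑ i, F c (cell T i c) := by
  rw [sum_comm (s := range N)]
  refine sum_congr rfl fun i _ => ?_
  calc ∑ c : Fin (a i), F c (T i c) = ∑ c : Fin (a i), F c (cell T i c) := by simp [cell_eq]
    _ = ∑ c ∈ range (a i), F c (cell T i c) := Fin.sum_univ_eq_sum_range (fun c => F c (cell T i c)) _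
    _ = _ := by
      refine sum_subset (range_subset_range.2 (hN i)) fun c _ hc => ?_
      simp only [mem_range, not_lt] at hc
      simp [cell, not_lt.2 hc, hF]

theorem IsSemistandard.sum_mem {n : ℕ} {a : Fin n → ℕ} {T : SetFilling a}
    (h : IsSemistandard T) (k : Fin n) (c : ℕ) :
    (∑ i, if k ∈ cell T i c then 1 else 0) = if k ∈ colUnion T c then 1 else 0 := by
  split_ifs with hk
  · obtain ⟨i, hi⟩ := mem_colUnion.1 hk
    rw [Finset.sum_eq_single i]
    · simp [hi]
    · intro j _ hj
      rw [if_neg fun hj' => hj (h.column j i c k hj' hi)]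
    · simp
  · refine sum_eq_zero fun i _ => if_neg fun hi => hk (mem_colUnion.2 ⟨i, hi⟩)

theorem IsSemistandard.wt_eq {n : ℕ} {a : Fin n → ℕ} {T : SetFilling a}
    (h : IsSemistandard T) {N : ℕ} (hN : ∀ i, a i ≤ N) (k : Fin n) :
    wt T k = ∑ c ∈ range N, if k ∈ colUnion T c then 1 else 0 := by
  rw [wt, sum_boxes T (fun _ s => if k ∈ s then 1 else 0) (by simp) hN]
  exact sum_congr rfl fun c _ => h.sum_mem k c

theorem IsSemistandard.sum_card {n : ℕ} {a : Fin n → ℕ} {T : SetFilling a}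
    (h : IsSemistandard T) (c : ℕ) :
    ∑ i, ((cell T i c).card - 1) + #{i | 0 < tops T i c} = (colUnion T c).card := by
  rw [colUnion, card_biUnion, card_filter, ← sum_add_distrib]
  · refine sum_congr rfl fun i _ => ?_
    have : 0 < tops T i c ↔ 0 < #(cell T i c) := top_pos_iff.trans card_pos.symm
    split_ifs <;> omega
  · intro i _ j _ hij
    refine disjoint_left.2 fun k hi hj => ?_
    exact hij (h.column i j c k hi hj)

theorem IsSemistandard.excess_eq {n : ℕ} {a : Fin n → ℕ} {T : SetFilling a}
    (h : IsSemistandard T) {N : ℕ} (hN : ∀ i, a i ≤ N) :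
    excess T = ∑ c ∈ range N, ((colUnion T c).card - #{i | 0 < tops T i c}) := by
  rw [excess, sum_boxes T (fun _ s => s.card - 1) (by simp) hN]
  refine sum_congr rfl fun c _ => ?_
  have := h.sum_card c
  omega

/-- A relation that is total and unique on both sides is a bijection. The correspondences of
fillings below are relations of this kind (equal column data), so no inverse map has to be
constructed. -/
theorem sum_eq_of_rel {α β M : Type*} [AddCommMonoid M] (A : Finset α) (B : Finset β)
    (R : α → β → Prop) (h1 : ∀ a ∈ A, ∃ b ∈ B, R a b) (h2 : ∀ b ∈ B, ∃ a ∈ A, R a b)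
    (h3 : ∀ a ∈ A, ∀ a' ∈ A, ∀ b ∈ B, R a b → R a' b → a = a')
    (h4 : ∀ a ∈ A, ∀ b ∈ B, ∀ b' ∈ B, R a b → R a b' → b = b') {f : α → M} {g : β → M}
    (h5 : ∀ a ∈ A, ∀ b ∈ B, R a b → f a = g b) : ∑ a ∈ A, f a = ∑ b ∈ B, g b := by
  choose F hF1 hF2 using h1
  refine sum_bij F hF1 ?_ ?_ fun a ha => h5 a ha _ (hF1 a ha) (hF2 a ha)
  · intro a ha a' ha' he
    exact h3 a ha a' ha' (F a ha) (hF1 a ha) (hF2 a ha) (he ▸ hF2 a' ha')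
  · intro b hb
    obtain ⟨a, ha, hab⟩ := h2 b hb
    exact ⟨a, ha, h4 a ha _ (hF1 a ha) b hb (hF2 a ha) hab⟩

/-! ### Weak compositions with a given positive part -/

/-- The function `p` lists the nonzero positions of `b` and `L` the nonzero entries. -/
structure IsSpread {n : ℕ} (b : Fin n → ℕ) (L : List ℕ) (p : Fin L.length → Fin n) : Prop where
  mono : StrictMono p
  supp : ∀ i, b i ≠ 0 → ∃ k, p k = i
  val : ∀ k, b (p k) = L.get k
  pos : ∀ x ∈ L, 0 < x

theorem IsSpread.positivePart_eq {n : ℕ} {b : Fin n → ℕ} {L : List ℕ} {p : Fin L.length → Fin n}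
    (h : IsSpread b L p) : positivePart b = L := by
  have h1 : (List.finRange n).filter (fun i => b i ≠ 0) = List.ofFn p := by
    refine List.SortedLT.eq_of_mem_iff ?_ h.mono.sortedLT_ofFn fun i => ?_
    · exact ((List.pairwise_lt_finRange n).filter _).sortedLT
    · simp only [List.mem_filter, List.mem_finRange, true_and, List.mem_ofFn, decide_eq_true_eq]
      constructor
      · exact h.supp i
      · rintro ⟨k, rfl⟩
        rw [h.val]
        exact (h.pos _ (List.get_mem _ _)).ne'
  rw [positivePart, List.ofFn_eq_map, List.filter_map]
  have h2 : ((fun x => decide (x ≠ 0)) ∘ b) = fun i => decide (b i ≠ 0) := rfl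
  rw [h2, h1, List.map_ofFn]
  have h3 : b ∘ p = L.get := funext h.val
  rw [h3, List.ofFn_get]

theorem pos_of_mem_positivePart {n : ℕ} {b : Fin n → ℕ} : ∀ x ∈ positivePart b, 0 < x := by
  intro x hx
  simp only [positivePart, List.mem_filter, decide_eq_true_eq] at hx
  omega

theorem exists_isSpread {n : ℕ} {b : Fin n → ℕ} {L : List ℕ} (h : positivePart b = L) :
    ∃ p, IsSpread b L p := by
  subst h
  have h1 : positivePart b =
      List.ofFn fun k => b ((nonzeroPositions b).orderEmbOfFin rfl k) := by
    have h2 : (List.finRange n).filter (fun i => b i ≠ 0) =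
        List.ofFn ((nonzeroPositions b).orderEmbOfFin rfl) := by
      refine List.SortedLT.eq_of_mem_iff ?_
        ((nonzeroPositions b).orderEmbOfFin rfl).strictMono.sortedLT_ofFn fun i => ?_
      · exact ((List.pairwise_lt_finRange n).filter _).sortedLT
      · simp only [List.mem_filter, List.mem_finRange, true_and, List.mem_ofFn, decide_eq_true_eq]
        change _ ↔ i ∈ Set.range ((nonzeroPositions b).orderEmbOfFin rfl)
        rw [Finset.range_orderEmbOfFin]
        simp [nonzeroPositions]
    have h3 : ((fun x => decide (x ≠ 0)) ∘ b) = fun i => decide (b i ≠ 0) := rfl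
    rw [positivePart, List.ofFn_eq_map, List.filter_map, h3, h2, List.map_ofFn]
    rfl
  have hlen : (positivePart b).length = (nonzeroPositions b).card := by rw [h1, List.length_ofFn]
  refine ⟨fun k => (nonzeroPositions b).orderEmbOfFin rfl (Fin.cast hlen k), ?_, ?_, ?_,
    pos_of_mem_positivePart⟩
  · exact ((nonzeroPositions b).orderEmbOfFin rfl).strictMono.comp (Fin.cast_strictMono hlen)
  · intro i hi
    have : i ∈ Set.range ((nonzeroPositions b).orderEmbOfFin rfl) := by
      rw [Finset.range_orderEmbOfFin]; simpa [nonzeroPositions] using hi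
    obtain ⟨k, hk⟩ := this
    exact ⟨Fin.cast hlen.symm k, by simpa using hk⟩
  · intro k
    simp only [List.get_eq_getElem]
    simp only [h1, List.getElem_ofFn]
    rfl

/-- The weak composition with prescribed positions of its nonzero entries. -/
def spread {n : ℕ} (L : List ℕ) (p : Fin L.length → Fin n) : Fin n → ℕ :=
  Function.extend p L.get 0

theorem isSpread_spread {n : ℕ} {L : List ℕ} {p : Fin L.length → Fin n} (hp : StrictMono p)
    (hL : ∀ x ∈ L, 0 < x) : IsSpread (spread L p) L p := by
  refine ⟨hp, fun i hi => ?_, fun k => hp.injective.extend_apply _ _ _, hL⟩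
  by_contra h
  exact hi (Function.extend_apply' _ _ _ h)

theorem IsSpread.sum_Iic {n : ℕ} {b : Fin n → ℕ} {L : List ℕ} {p : Fin L.length → Fin n}
    (h : IsSpread b L p) (v : Fin n) : ∑ j ∈ Finset.Iic v, b j = ∑ k with p k ≤ v, L.get k := by
  symm
  refine sum_bij_ne_zero (fun k _ _ => p k) ?_ ?_ ?_ ?_
  · intro k hk _; simpa using hk
  · intro k _ _ k' _ _ he; exact h.mono.injective he
  · intro i hi hne
    obtain ⟨k, rfl⟩ := h.supp i hne
    exact ⟨k, by simpa using hi, by rw [← h.val]; exact hne, rfl⟩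
  · intro k _ _; rw [h.val]

theorem IsSpread.card_Iic {n : ℕ} {b : Fin n → ℕ} {L : List ℕ} {p : Fin L.length → Fin n}
    (h : IsSpread b L p) (v : Fin n) (c : ℕ) :
    #{i ∈ Finset.Iic v | c < b i} = #{k | p k ≤ v ∧ c < L.get k} := by
  symm
  refine card_bij (fun k _ => p k) ?_ ?_ ?_
  · intro k hk; simpa [h.val] using hk
  · intro k _ k' _ he; exact h.mono.injective he
  · intro i hi
    simp only [mem_filter, Finset.mem_Iic] at hi
    obtain ⟨k, rfl⟩ := h.supp i (by omega)
    refine ⟨k, ?_, rfl⟩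
    rw [h.val] at hi
    simpa using hi

theorem IsSpread.card_univ {n : ℕ} {b : Fin n → ℕ} {L : List ℕ} {p : Fin L.length → Fin n}
    (h : IsSpread b L p) (c : ℕ) : #{i | c < b i} = #{k | c < L.get k} := by
  symm
  refine card_bij (fun k _ => p k) ?_ ?_ ?_
  · intro k hk; simpa [h.val] using hk
  · intro k _ k' _ he; exact h.mono.injective he
  · intro i hi
    simp only [mem_filter, mem_univ, true_and] at hi
    obtain ⟨k, rfl⟩ := h.supp i (by omega)
    refine ⟨k, ?_, rfl⟩
    rw [h.val] at hi
    simpa using hi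

/-- If the `k`-th nonzero entry of `b` came after position `p k`, then up to `p k` the composition
`b` would have only entries with index below `k`, while `a` has the `k`-th one as well. -/
theorem IsSpread.dominates_iff {n : ℕ} {a b : Fin n → ℕ} {L : List ℕ} {p q : Fin L.length → Fin n}
    (ha : IsSpread a L p) (hb : IsSpread b L q) : Dominates b a ↔ ∀ k, q k ≤ p k := by
  constructor
  · intro h k
    by_contra hlt
    rw [not_le] at hlt
    have h1 := h (p k)
    rw [ha.sum_Iic, hb.sum_Iic] at h1
    have h2 : ({k' | q k' ≤ p k} : Finset (Fin L.length)) ⊆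
        ({k' | p k' ≤ p k} : Finset (Fin L.length)).erase k := by
      intro k' hk'
      simp only [mem_filter, mem_univ, true_and, mem_erase, ha.mono.le_iff_le] at hk' ⊢
      have : k' < k := hb.mono.lt_iff_lt.1 (hk'.trans_lt hlt)
      exact ⟨this.ne, this.le⟩
    have h3 := sum_le_sum_of_subset (f := L.get) h2
    have h4 := sum_erase_add ({k' | p k' ≤ p k} : Finset (Fin L.length)) L.get (a := k) (by simp)
    have h5 := ha.pos _ (List.get_mem L k)
    omega
  · intro h v
    rw [ha.sum_Iic, hb.sum_Iic]
    refine sum_le_sum_of_subset fun k hk => ?_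
    simp only [mem_filter, mem_univ, true_and] at hk ⊢
    exact (h k).trans hk

/-- The form that acts on diagrams: row `l` of `b` is row `π l` of `a`, nonempty rows keep their
order and move weakly down; empty rows go anywhere. -/
theorem mem_dominatingRearrangements_iff_exists_perm {n : ℕ} {a b : Fin n → ℕ} :
    b ∈ dominatingRearrangements a ↔ ∃ π : Equiv.Perm (Fin n), (∀ l, b l = a (π l)) ∧
      (∀ l l', l < l' → 0 < b l → 0 < b l' → π l < π l') ∧ ∀ l, 0 < b l → l ≤ π l := by
  classical
  constructor
  · rintro ⟨hd, he⟩
    obtain ⟨p, hp⟩ := exists_isSpread (b := a) rfl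
    obtain ⟨q, hq⟩ := exists_isSpread he
    rw [hp.dominates_iff hq] at hd
    let e : {x // x ∈ Set.range q} ≃ {x // x ∈ Set.range p} :=
      (Equiv.ofInjective q hq.mono.injective).symm.trans (Equiv.ofInjective p hp.mono.injective)
    have hπ : ∀ k, e.extendSubtype (q k) = p k := by
      intro k
      rw [e.extendSubtype_apply_of_mem _ ⟨k, rfl⟩]
      have : (⟨q k, ⟨k, rfl⟩⟩ : {x // x ∈ Set.range q}) =
          Equiv.ofInjective q hq.mono.injective k := rfl
      simp only [e, Equiv.trans_apply, this, Equiv.symm_apply_apply]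
      rfl
    refine ⟨e.extendSubtype, fun l => ?_, fun l l' hll h1 h2 => ?_, fun l hl => ?_⟩
    · by_cases hl : l ∈ Set.range q
      · obtain ⟨k, rfl⟩ := hl
        rw [hπ, hp.val, hq.val]
      · have h1 := e.extendSubtype_not_mem l hl
        have h2 : b l = 0 := by
          by_contra h; exact hl (hq.supp l h)
        have h3 : a (e.extendSubtype l) = 0 := by
          by_contra h; exact h1 (hp.supp _ h)
        rw [h2, h3]
    · obtain ⟨k, rfl⟩ := hq.supp l h1.ne'
      obtain ⟨k', rfl⟩ := hq.supp l' h2.ne'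
      rw [hπ, hπ]
      exact hp.mono (hq.mono.lt_iff_lt.1 hll)
    · obtain ⟨k, rfl⟩ := hq.supp l hl.ne'
      rw [hπ]; exact hd k
  · rintro ⟨π, h1, h2, h3⟩
    obtain ⟨q, hq⟩ := exists_isSpread (b := b) rfl
    have hpos : ∀ k, 0 < b (q k) := fun k => by
      rw [hq.val]; exact hq.pos _ (List.get_mem _ _)
    have hp : IsSpread a (positivePart b) (fun k => π (q k)) := by
      refine ⟨fun k k' hk => h2 _ _ (hq.mono hk) (hpos k) (hpos k'), fun i hi => ?_, fun k => ?_,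
        hq.pos⟩
      · obtain ⟨k, hk⟩ := hq.supp (π.symm i) (by rwa [h1, Equiv.apply_symm_apply])
        exact ⟨k, by simp [hk]⟩
      · rw [← h1, hq.val]
    exact ⟨(hp.dominates_iff hq).2 fun k => h3 _ (hpos k), hp.positivePart_eq.symm⟩

/-! ### Left swaps -/

theorem PrefixLE.trans {n : ℕ} {a b c : Fin n → ℕ} (h : PrefixLE a b) (h' : PrefixLE b c) :
    PrefixLE a c := fun v x => (h v x).trans (h' v x)

theorem prefixLE_swap {n : ℕ} {a : Fin n → ℕ} {i j : Fin n} (hij : i < j) (ha : a i ≤ a j) :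
    PrefixLE a (a ∘ Equiv.swap i j) := by
  intro v c
  by_cases hv : j ≤ v
  · refine (card_bij (fun k _ => Equiv.swap i j k) ?_ ?_ ?_).le
    · intro k hk
      simp only [mem_filter, Finset.mem_Iic, Function.comp, Equiv.swap_apply_self] at hk ⊢
      refine ⟨?_, hk.2⟩
      rw [Equiv.swap_apply_def]
      split_ifs
      exacts [hv, (hij.trans_le hv).le, hk.1]
    · intro k _ k' _ he; exact (Equiv.swap i j).injective he
    · intro k hk
      simp only [mem_filter, Finset.mem_Iic, Function.comp] at hk ⊢
      refine ⟨Equiv.swap i j k, ⟨?_, hk.2⟩, by simp⟩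
      rw [Equiv.swap_apply_def]
      split_ifs
      exacts [hv, (hij.trans_le hv).le, hk.1]
  · refine card_le_card fun k hk => ?_
    simp only [mem_filter, Finset.mem_Iic, Function.comp] at hk ⊢
    refine ⟨hk.1, ?_⟩
    rw [Equiv.swap_apply_def]
    split_ifs with h1 h2
    · subst h1; omega
    · subst h2; exact absurd hk.1 hv
    · exact hk.2

theorem prefixLE_of_mem_lswap {n : ℕ} {a b : Fin n → ℕ} (h : b ∈ lswap a) :
    PrefixLE a b ∧ ∀ c, #{i | c < a i} = #{i | c < b i} := by
  induction h with
  | refl => exact ⟨fun v c => le_rfl, fun c => rfl⟩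
  | tail _ h ih =>
    obtain ⟨i, j, hij, ha, rfl⟩ := h
    exact ⟨ih.1.trans (prefixLE_swap hij ha), fun c => (ih.2 c).trans
      (card_filter_perm (Equiv.swap i j) (fun _ => rfl) (fun x => c < x)).symm⟩

/-- At the first difference `p` one has `a p < b p`. Since `a` and `b` have the same multiset of
entries, some later entry of `a` lies in `(a p, b p]`; the first such position `j` is swapped with
`p`. -/
theorem exists_leftSwap {n : ℕ} {a b : Fin n → ℕ} (h : PrefixLE a b)
    (hc : ∀ c, #{i | c < a i} = #{i | c < b i}) (hne : a ≠ b) :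
    ∃ i j, i < j ∧ a i < a j ∧ PrefixLE (a ∘ Equiv.swap i j) b := by
  have hne' : ({i | a i ≠ b i} : Finset (Fin n)).Nonempty := by
    obtain ⟨i, hi⟩ := Function.ne_iff.1 hne
    exact ⟨i, by simpa using hi⟩
  obtain ⟨p, hp, hpmin⟩ : ∃ p, a p ≠ b p ∧ ∀ i < p, a i = b i := by
    refine ⟨({i | a i ≠ b i} : Finset (Fin n)).min' hne', by simpa using min'_mem _ hne', ?_⟩
    intro i hi
    by_contra hab
    exact absurd (min'_le _ i (by simpa using hab)) (not_le.2 hi)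
  have hIio : ∀ c, #{i ∈ Finset.Iio p | c < a i} = #{i ∈ Finset.Iio p | c < b i} := by
    intro c
    congr 1; ext i
    simp only [mem_filter, Finset.mem_Iio, and_congr_right_iff]
    intro hi; rw [hpmin i hi]
  have hlt : a p < b p := by
    by_contra hle
    have h1 := h p (b p)
    rw [card_filter_le_succ, card_filter_le_succ, hIio, if_pos (by omega), if_neg (by omega)] at h1
    omega
  have hj : ({j | p < j ∧ a p < a j ∧ a j ≤ b p} : Finset (Fin n)).Nonempty := by
    by_contra hemp
    rw [not_nonempty_iff_eq_empty, filter_eq_empty_iff] at hemp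
    have hcount : ∀ f : Fin n → ℕ, #{i | a p < f i} = #{i | b p < f i} +
        #{i | a p + 1 ≤ f i ∧ f i < b p + 1} := fun f =>
      card_filter_split univ f (u := a p + 1) (w := b p + 1) (by omega)
    have h1 := hcount a
    have h2 := hcount b
    rw [hc, hc] at h1
    have h3 : ({i | a p + 1 ≤ a i ∧ a i < b p + 1} : Finset (Fin n)) ⊂
        ({i | a p + 1 ≤ b i ∧ b i < b p + 1} : Finset (Fin n)) := by
      refine (ssubset_iff_of_subset fun i hi => ?_).2 ⟨p, ?_, ?_⟩
      · simp only [mem_filter, mem_univ, true_and] at hi ⊢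
        have h4 := hemp (mem_univ i)
        rcases lt_trichotomy i p with h5 | rfl | h5
        · rw [← hpmin i h5]; exact hi
        · omega
        · exact absurd ⟨h5, by omega⟩ h4
      · simp only [mem_filter, mem_univ, true_and]; omega
      · simp only [mem_filter, mem_univ, true_and]; omega
    have := card_lt_card h3
    omega
  obtain ⟨j, hjm, hjmin⟩ : ∃ j, (p < j ∧ a p < a j ∧ a j ≤ b p) ∧
      ∀ i, p < i → i < j → a i ≤ a p ∨ b p < a i := by
    refine ⟨_, (mem_filter.1 (min'_mem _ hj)).2, fun i hi hij => ?_⟩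
    by_contra hab
    push Not at hab
    exact absurd (min'_le _ i (by simpa using ⟨hi, hab⟩)) (not_le.2 hij)
  refine ⟨p, j, hjm.1, hjm.2.1, fun v c => ?_⟩
  have hle := h v c
  -- Only for these `v` and `c` does the swap raise a count. Between `p` and `j` the entries of `a`
  -- are at most `a p` or above `b p`, so every counted entry not above `b p` lies at `p` or before
  -- it and is also counted in `b`.
  by_cases hv : p ≤ v ∧ v < j ∧ a p ≤ c ∧ c < a j
  · obtain ⟨hpv, hvj, hc1, hc2⟩ := hv
    have hsplit : ∀ f : Fin n → ℕ, #{i ∈ Finset.Iic v | c < f i} =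
        #{i ∈ Finset.Iic v | b p < f i} + #{i ∈ Finset.Iic v | c + 1 ≤ f i ∧ f i < b p + 1} :=
      fun f => card_filter_split _ f (u := c + 1) (w := b p + 1) (by omega)
    rw [hsplit b]
    have h1 : ({i ∈ Finset.Iic v | c < (a ∘ Equiv.swap p j) i} : Finset (Fin n)) ⊆
        ({i ∈ Finset.Iic v | b p < a i} : Finset (Fin n)) ∪
        ({i ∈ Finset.Iic v | c + 1 ≤ b i ∧ b i < b p + 1} : Finset (Fin n)) := by
      intro i hi
      simp only [mem_filter, Finset.mem_Iic, Function.comp, mem_union] at hi ⊢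
      rcases lt_trichotomy i p with h2 | rfl | h2
      · rw [Equiv.swap_apply_of_ne_of_ne h2.ne (h2.trans hjm.1).ne] at hi
        rw [← hpmin i h2]
        omega
      · right; exact ⟨hpv, by omega, by omega⟩
      · rw [Equiv.swap_apply_of_ne_of_ne h2.ne' (hi.1.trans_lt hvj).ne] at hi
        rcases hjmin i h2 (hi.1.trans_lt hvj) with h3 | h3
        · omega
        · exact Or.inl ⟨hi.1, h3⟩
    have h2 := (card_le_card h1).trans (card_union_le _ _)
    have h3 := h v (b p)
    omega
  · refine le_trans ?_ hle
    by_cases hvj : j ≤ v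
    · refine le_of_eq (card_bij (fun k _ => Equiv.swap p j k) ?_ ?_ ?_)
      · intro k hk
        simp only [mem_filter, Finset.mem_Iic, Function.comp] at hk ⊢
        refine ⟨?_, hk.2⟩
        rw [Equiv.swap_apply_def]
        split_ifs
        exacts [hvj, (hjm.1.trans_le hvj).le, hk.1]
      · intro k _ k' _ he; exact (Equiv.swap p j).injective he
      · intro k hk
        simp only [mem_filter, Finset.mem_Iic, Function.comp] at hk ⊢
        refine ⟨Equiv.swap p j k, ⟨?_, by simpa using hk.2⟩, by simp⟩
        rw [Equiv.swap_apply_def]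
        split_ifs
        exacts [hvj, (hjm.1.trans_le hvj).le, hk.1]
    · refine card_le_card fun k hk => ?_
      simp only [mem_filter, Finset.mem_Iic, Function.comp] at hk ⊢
      refine ⟨hk.1, ?_⟩
      by_cases hkp : k = p
      · subst hkp
        rw [Equiv.swap_apply_left] at hk
        by_contra hk'
        exact hv ⟨hk.1, not_le.1 hvj, by omega, hk.2⟩
      · rw [Equiv.swap_apply_of_ne_of_ne hkp (hk.1.trans_lt (not_le.1 hvj)).ne] at hk
        exact hk.2

/-- Conversely, swaps from `exists_leftSwap` are applied until `b` is reached; each lowers `∑ i * a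
i`. -/
theorem mem_lswap_iff {n : ℕ} {a b : Fin n → ℕ} :
    b ∈ lswap a ↔ PrefixLE a b ∧ ∀ c, #{i | c < a i} = #{i | c < b i} := by
  refine ⟨prefixLE_of_mem_lswap, ?_⟩
  suffices h : ∀ N, ∀ a : Fin n → ℕ, ∑ i : Fin n, (i : ℕ) * a i = N → PrefixLE a b →
      (∀ c, #{i | c < a i} = #{i | c < b i}) → b ∈ lswap a from fun h' => h _ a rfl h'.1 h'.2
  intro N
  induction N using Nat.strong_induction_on with
  | _ N ih =>
    intro a hN h hc
    by_cases hab : a = b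
    · subst hab; exact Relation.ReflTransGen.refl
    obtain ⟨i, j, hij, ha, hle⟩ := exists_leftSwap h hc hab
    refine Relation.ReflTransGen.head ⟨i, j, hij, ha.le, rfl⟩ (ih _ ?_ _ rfl hle fun c => ?_)
    · rw [← hN]
      have hs : ∀ f : Fin n → ℕ, ∑ k, f k = f i + (f j + ∑ k ∈ (univ.erase i).erase j, f k) := by
        intro f
        rw [← Finset.add_sum_erase univ f (mem_univ i),
          ← Finset.add_sum_erase (univ.erase i) f (a := j) (by simp [hij.ne'])]
      rw [hs, hs (fun i => (i : ℕ) * a i)]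
      have h2 : ∑ k ∈ (univ.erase i).erase j, (k : ℕ) * (a ∘ Equiv.swap i j) k =
          ∑ k ∈ (univ.erase i).erase j, (k : ℕ) * a k := by
        refine sum_congr rfl fun k hk => ?_
        simp only [mem_erase] at hk
        simp [Equiv.swap_apply_of_ne_of_ne hk.2.1 hk.1]
      rw [h2]
      simp only [Function.comp, Equiv.swap_apply_left, Equiv.swap_apply_right]
      have hij' : (i : ℕ) < j := hij
      obtain ⟨d, hd⟩ := Nat.exists_eq_add_of_lt hij'
      obtain ⟨d', hd'⟩ := Nat.exists_eq_add_of_lt ha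
      rw [hd, hd']
      nlinarith [Nat.zero_le (d * d')]
    · rw [← hc]
      exact card_filter_perm (Equiv.swap i j) (fun _ => rfl) (fun x => c < x)

theorem mem_lswap_of_dominates {n : ℕ} {a b c : Fin n → ℕ} (hb : b ∈ lswap a)
    (hc : c ∈ dominatingRearrangements b) : c ∈ lswap a := by
  rw [mem_lswap_iff] at hb ⊢
  obtain ⟨p, hp⟩ := exists_isSpread (b := b) rfl
  obtain ⟨q, hq⟩ := exists_isSpread hc.2
  have hle := (hp.dominates_iff hq).1 hc.1
  refine ⟨fun v x => (hb.1 v x).trans ?_, fun x => ?_⟩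
  · rw [hp.card_Iic, hq.card_Iic]
    refine card_le_card fun k hk => ?_
    simp only [mem_filter, mem_univ, true_and] at hk ⊢
    exact ⟨(hle k).trans hk.1, hk.2⟩
  · rw [hb.2, hp.card_univ, hq.card_univ]

/-! ### Classes of `lswap a` with a given positive part -/

/-- Two elements of `lswap a` with the same positive part dominate a common one. -/
theorem exists_common_dominated {n : ℕ} {a b c : Fin n → ℕ} (hb : b ∈ lswap a) (hc : c ∈ lswap a)
    (he : positivePart c = positivePart b) : ∃ m ∈ lswap a, positivePart m = positivePart b ∧
      Dominates b m ∧ Dominates c m := by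
  rw [mem_lswap_iff] at hb hc
  obtain ⟨p, hp⟩ := exists_isSpread (b := b) rfl
  obtain ⟨q, hq⟩ := exists_isSpread he
  -- Each entry is placed at the later of its two positions.
  have hN : StrictMono fun k => max (p k) (q k) := fun k k' h =>
    max_lt_max (hp.mono h) (hq.mono h)
  have hm := isSpread_spread hN hp.pos
  refine ⟨_, mem_lswap_iff.2 ⟨fun v x => ?_, fun x => ?_⟩, hm.positivePart_eq,
    (hm.dominates_iff hp).2 fun k => le_max_left _ _,
    (hm.dominates_iff hq).2 fun k => le_max_right _ _⟩
  · have h1 := hb.1 v x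
    have h2 := hc.1 v x
    rw [hp.card_Iic] at h1
    rw [hq.card_Iic] at h2
    rw [hm.card_Iic]
    -- At a given `v` one of the two sets of indices placed up to `v` contains the other, because
    -- both are initial segments; the count for the maximum is therefore that of `b` or that of `c`.
    by_cases h : ∀ k, p k ≤ v → q k ≤ v
    · refine h1.trans (card_le_card fun k hk => ?_)
      simp only [mem_filter, mem_univ, true_and, max_le_iff] at hk ⊢
      exact ⟨⟨hk.1, h k hk.1⟩, hk.2⟩
    · push Not at h
      obtain ⟨k₀, h3, h4⟩ := h
      refine h2.trans (card_le_card fun k hk => ?_)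
      simp only [mem_filter, mem_univ, true_and, max_le_iff] at hk ⊢
      refine ⟨⟨?_, hk.1⟩, hk.2⟩
      exact (hp.mono (hq.mono.lt_iff_lt.1 (hk.1.trans_lt h4))).le.trans h3
  · rw [hb.2, hp.card_univ, hm.card_univ]

theorem finite_lswap {n : ℕ} (a : Fin n → ℕ) : (lswap a).Finite := by
  refine (finite_setOf_le (∑ i, a i)).subset ?_
  intro b hb
  have : ∀ i, b i ≤ ∑ i, a i := by
    induction hb with
    | refl => exact fun i => Finset.single_le_sum (fun _ _ => Nat.zero_le _) (Finset.mem_univ i)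
    | tail _ h ih =>
      obtain ⟨i, j, -, -, rfl⟩ := h
      exact fun k => ih _
  exact this

theorem Dominates.antisymm {n : ℕ} {a b : Fin n → ℕ} (h : Dominates a b) (h' : Dominates b a) :
    a = b := by
  have h1 : ∀ v, ∑ j ∈ Finset.Iic v, a j = ∑ j ∈ Finset.Iic v, b j := fun v =>
    le_antisymm (h' v) (h v)
  have h2 : ∀ v, ∑ j ∈ Finset.Iio v, a j = ∑ j ∈ Finset.Iio v, b j := by
    intro v
    by_cases hv : (v : ℕ) = 0
    · have : Finset.Iio v = ∅ := by
        ext i; simp only [Finset.mem_Iio, Fin.lt_def, Finset.notMem_empty, iff_false]; omega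
      simp [this]
    · have : Finset.Iio v = Finset.Iic ⟨(v : ℕ) - 1, by omega⟩ := by
        ext i; simp only [Finset.mem_Iio, Finset.mem_Iic, Fin.lt_def, Fin.le_def]; omega
      rw [this]; exact h1 _
  funext v
  have h3 := h1 v
  rw [← Finset.Iio_insert, sum_insert (by simp), sum_insert (by simp), h2] at h3
  omega

/-- An element of the class with the least sum of partial sums is dominated by all others: a common
lower bound with another element has no smaller sum, hence the same partial sums. -/
theorem exists_Qlswap {n : ℕ} {a c : Fin n → ℕ} (hc : c ∈ lswap a) :
    ∃ b ∈ Qlswap a, c ∈ dominatingRearrangements b := by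
  obtain ⟨b, hb, hmin⟩ := Set.exists_min_image {b | b ∈ lswap a ∧ positivePart b = positivePart c}
    (fun b => ∑ v, ∑ j ∈ Finset.Iic v, b j) ((finite_lswap a).subset fun b hb => hb.1) ⟨c, hc, rfl⟩
  have key : ∀ c' ∈ lswap a, positivePart b = positivePart c' → Dominates c' b := by
    intro c' hc' he
    obtain ⟨m, hm, hme, hmb, hmc⟩ := exists_common_dominated hb.1 hc' he.symm
    have h1 := hmin m ⟨hm, hme.trans hb.2⟩
    have h2 := (sum_eq_sum_iff_of_le fun v _ => hmb v).1
      (le_antisymm (sum_le_sum fun v _ => hmb v) h1)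
    intro v
    rw [← h2 v (mem_univ v)]
    exact hmc v
  exact ⟨b, ⟨hb.1, key⟩, key c hc hb.2, hb.2.symm⟩

theorem Qlswap_unique {n : ℕ} {a b b' c : Fin n → ℕ} (hb : b ∈ Qlswap a) (hb' : b' ∈ Qlswap a)
    (h : c ∈ dominatingRearrangements b) (h' : c ∈ dominatingRearrangements b') : b = b' :=
  (hb'.2 b hb.1 (h'.2.symm.trans h.2)).antisymm (hb.2 b' hb'.1 (h.2.symm.trans h'.2))

theorem sum_lswap {n : ℕ} {M : Type*} [AddCommMonoid M] (a : Fin n → ℕ) (f : (Fin n → ℕ) → M) :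
    ∑ c ∈ (finite_lswap a).toFinset, f c =
      ∑ b ∈ (finite_Qlswap a).toFinset, ∑ c ∈ (finite_dominatingRearrangements b).toFinset, f c := by
  classical
  rw [← sum_biUnion]
  · congr 1
    ext c
    simp only [Set.Finite.mem_toFinset, mem_biUnion]
    exact ⟨exists_Qlswap, fun ⟨b, hb, h⟩ => mem_lswap_of_dominates hb.1 h⟩
  · intro b hb b' hb' hne
    refine disjoint_left.2 fun c hc hc' => hne ?_
    simp only [Set.Finite.coe_toFinset, Set.Finite.mem_toFinset] at hb hb' hc hc'
    exact Qlswap_unique hb hb' hc hc'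

/-! ### Relocation of rows -/

/-- A row that starts with `l + 1` is sent to position `l`. The rows not used are empty, and an
arbitrary extension to a permutation distributes them. -/
theorem exists_relocation {n : ℕ} {z : Fin n → ℕ → ℕ} (hz : IsArray z) (hn : ∀ i, z i 0 ≤ n) :
    ∃ π : Equiv.Perm (Fin n), ∀ l, z (π l) 0 = 0 ∨ z (π l) 0 = l + 1 := by
  classical
  have hlt : ∀ r : {r // 0 < z r 0}, z r 0 - 1 < n := fun r => by
    have := hn r; have := r.2; omega
  let f : {r // 0 < z r 0} → {l : Fin n // ∃ r, z r 0 = l + 1} := fun r =>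
    ⟨⟨z r 0 - 1, hlt r⟩, r, by have := r.2; simp only; omega⟩
  have hf : Function.Bijective f := by
    constructor
    · intro r r' h
      simp only [f, Subtype.mk.injEq, Fin.mk.injEq] at h
      have h1 := r.2
      have h2 := r'.2
      exact Subtype.ext (hz.inj _ _ 0 h1 (by omega))
    · rintro ⟨l, r, hr⟩
      exact ⟨⟨r, by omega⟩, Subtype.ext (Fin.ext (by simp only [f]; omega))⟩
  let e := (Equiv.ofBijective f hf).symm
  refine ⟨e.extendSubtype, fun l => ?_⟩
  by_cases hl : ∃ r, z r 0 = l + 1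
  · right
    rw [e.extendSubtype_apply_of_mem l hl]
    have h1 : f (e ⟨l, hl⟩) = ⟨l, hl⟩ := (Equiv.ofBijective f hf).apply_symm_apply _
    have h2 := congrArg (fun x => (x.1 : ℕ)) h1
    have h3 := (e ⟨l, hl⟩).2
    simp only [f] at h2
    omega
  · left
    have := e.extendSubtype_not_mem l hl
    omega

theorem relocation_mono {n : ℕ} {z : Fin n → ℕ → ℕ}
    (hlt : ∀ i j, i < j → 0 < z i 0 → 0 < z j 0 → z i 0 < z j 0) {π : Equiv.Perm (Fin n)}
    (hπ : ∀ l, z (π l) 0 = 0 ∨ z (π l) 0 = l + 1) (l l' : Fin n) (hll : l < l')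
    (h : 0 < z (π l) 0) (h' : 0 < z (π l') 0) : π l < π l' := by
  by_contra hle
  rcases lt_or_eq_of_le (not_lt.1 hle) with h1 | h1
  · have h2 := hlt _ _ h1 h' h
    have h3 := hπ l
    have h4 := hπ l'
    rw [Fin.lt_def] at hll
    omega
  · exact hll.ne' (π.injective h1)

theorem relocation_mem {n : ℕ} {z : Fin n → ℕ → ℕ} {a : Fin n → ℕ} (hs : HasShape z a)
    (hlt : ∀ i j, i < j → 0 < z i 0 → 0 < z j 0 → z i 0 < z j 0) (hle : ∀ i, z i 0 ≤ i + 1)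
    {π : Equiv.Perm (Fin n)} (hπ : ∀ l, z (π l) 0 = 0 ∨ z (π l) 0 = l + 1) :
    (fun l => a (π l)) ∈ dominatingRearrangements a := by
  refine mem_dominatingRearrangements_iff_exists_perm.2 ⟨π, fun l => rfl, ?_, ?_⟩
  · intro l l' hll h h'
    exact relocation_mono hlt hπ l l' hll ((hs _ _).2 h) ((hs _ _).2 h')
  · intro l hl
    have h1 := hπ l
    have h2 := hle (π l)
    have h3 := (hs (π l) 0).2 hl
    rw [Fin.le_def]; omega

theorem IsArray.pos_zero {n : ℕ} {z : Fin n → ℕ → ℕ} (hz : IsArray z) {i : Fin n} {c : ℕ}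
    (h : 0 < z i c) : 0 < z i 0 := h.trans_le (hz.antitone i (Nat.zero_le c))

theorem Fwd.comp {n : ℕ} {z : Fin n → ℕ → ℕ} (hz : IsArray z) (hf : Fwd z)
    {π : Equiv.Perm (Fin n)}
    (hπ : ∀ l l', l < l' → 0 < z (π l) 0 → 0 < z (π l') 0 → π l < π l') :
    Fwd fun l c => z (π l) c := by
  intro k j c hkj hpos hle
  dsimp only at hpos hle
  exact hf _ _ c (hπ k j hkj (hz.pos_zero (c := c) (by omega)) (hz.pos_zero hpos)) hpos hle

theorem Bwd.comp {n : ℕ} {z : Fin n → ℕ → ℕ} (hz : IsArray z) (hf : Bwd z)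
    {π : Equiv.Perm (Fin n)}
    (hπ : ∀ l l', l < l' → 0 < z (π l) 0 → 0 < z (π l') 0 → π l < π l') :
    Bwd fun l c => z (π l) c := by
  intro k j c hkj hpos hlt
  dsimp only at hpos hlt
  exact hf _ _ c (hπ k j hkj (hz.pos_zero (c := c) (by omega)) (hz.pos_zero hpos)) hpos hlt

theorem Short.comp {n : ℕ} {z : Fin n → ℕ → ℕ} {a : Fin n → ℕ} (hs : HasShape z a) (hf : Short z a)
    {π : Equiv.Perm (Fin n)}
    (hπ : ∀ l l', l < l' → 0 < z (π l) 0 → 0 < z (π l') 0 → π l < π l') :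
    Short (fun l c => z (π l) c) fun l => a (π l) := by
  intro k j hkj ha c hc
  dsimp only at ha hc
  exact hf _ _ (hπ k j hkj ((hs _ _).2 (by omega)) ((hs _ _).2 (by omega))) ha c hc

theorem sameColumns_comp {n : ℕ} (z : Fin n → ℕ → ℕ) (π : Equiv.Perm (Fin n)) :
    SameColumns z fun l c => z (π l) c := fun _ => ⟨π, fun _ => rfl⟩

theorem perm_symm_mono {n : ℕ} {b : Fin n → ℕ} {π : Equiv.Perm (Fin n)}
    (h : ∀ l l', l < l' → 0 < b l → 0 < b l' → π l < π l') (i j : Fin n) (hij : i < j)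
    (hi : 0 < b (π.symm i)) (hj : 0 < b (π.symm j)) : π.symm i < π.symm j := by
  by_contra hle
  rcases lt_or_eq_of_le (not_lt.1 hle) with h1 | h1
  · have := h _ _ h1 hj hi
    simp only [Equiv.apply_symm_apply] at this
    exact absurd this hij.le.not_gt
  · exact hij.ne' (π.symm.injective h1)

/-- If `f v < g v`, the values of `g` below `g v` come from positions before `v`; there `f` has
values below `g v` too, and one more at `v`. -/
theorem eq_of_increasing {n : ℕ} {f g : Fin n → ℕ}
    (hs : ∀ i, 0 < f i ↔ 0 < g i) (hf : ∀ i j, i < j → 0 < f i → 0 < f j → f i < f j)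
    (hg : ∀ i j, i < j → 0 < g i → 0 < g j → g i < g j)
    (hc : ∀ x, #{i | 0 < f i ∧ f i < x} = #{i | 0 < g i ∧ g i < x}) : f = g := by
  have key : ∀ (f g : Fin n → ℕ) (hs : ∀ i, 0 < f i ↔ 0 < g i)
      (hf : ∀ i j, i < j → 0 < f i → 0 < f j → f i < f j)
      (hg : ∀ i j, i < j → 0 < g i → 0 < g j → g i < g j)
      (hc : ∀ x, #{i | 0 < f i ∧ f i < x} = #{i | 0 < g i ∧ g i < x}) (v : Fin n), g v ≤ f v := by
    intro f g hs hf hg hc v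
    by_contra hlt
    rw [not_le] at hlt
    have hgv : 0 < g v := by omega
    have hfv := (hs v).2 hgv
    have h1 : ({i | 0 < g i ∧ g i < g v} : Finset (Fin n)) ⊂
        ({i | 0 < f i ∧ f i < g v} : Finset (Fin n)) := by
      refine (ssubset_iff_of_subset fun i hi => ?_).2 ⟨v, by simpa using ⟨hfv, hlt⟩, by simp⟩
      simp only [mem_filter, mem_univ, true_and] at hi ⊢
      have h2 := (hs i).2 hi.1
      refine ⟨h2, ?_⟩
      rcases lt_trichotomy i v with h3 | rfl | h3
      · have := hf i v h3 h2 hfv; omega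
      · exact hlt
      · have := hg v i h3 hgv hi.1; omega
    have := card_lt_card h1
    rw [hc] at this
    exact lt_irrefl _ this
  funext v
  exact le_antisymm (key g f (fun i => (hs i).symm) hg hf (fun x => (hc x).symm) v)
    (key f g hs hf hg hc v)

/-! ### Atoms -/

theorem IsAtomFilling.tops_zero {n : ℕ} {a : Fin n → ℕ} {T : SetFilling a} (h : IsAtomFilling T)
    (i : Fin n) : tops T i 0 = 0 ∨ tops T i 0 = i + 1 := by
  rcases Nat.eq_zero_or_pos (a i) with h0 | h0
  · left
    have := h.semistandard.hasShape i 0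
    omega
  · exact Or.inr (max_eq_coe_iff.1 (h.first i h0))

theorem fwd_of_increasing {n : ℕ} {a : Fin n → ℕ} {T : SetFilling a} (h : IsSemistandard T)
    (h0 : ∀ i j, i < j → 0 < tops T i 0 → 0 < tops T j 0 → tops T i 0 < tops T j 0) :
    Fwd (tops T) :=
  (fwd_iff_tripleCondition h.isArray h.hasShape fun i j hij hi hj =>
    h0 i j hij ((h.hasShape _ _).2 hi) ((h.hasShape _ _).2 hj)).2 h.tripleCondition

theorem increasing_of_index {n : ℕ} {t : Fin n → ℕ → ℕ} (h : ∀ i, t i 0 = 0 ∨ t i 0 = i + 1)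
    (i j : Fin n) (hij : i < j) (hi : 0 < t i 0) (hj : 0 < t j 0) : t i 0 < t j 0 := by
  have h1 := h i
  have h2 := h j
  rw [Fin.lt_def] at hij
  omega

theorem IsAtomFilling.fwd {n : ℕ} {a : Fin n → ℕ} {T : SetFilling a} (h : IsAtomFilling T) :
    Fwd (tops T) := fwd_of_increasing h.semistandard (increasing_of_index h.tops_zero)

theorem IsQuasiFilling.tops_lt {n : ℕ} {a : Fin n → ℕ} {T : SetFilling a} (h : IsQuasiFilling T)
    (i j : Fin n) (hij : i < j) (hi : 0 < tops T i 0) (hj : 0 < tops T j 0) :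
    tops T i 0 < tops T j 0 :=
  max_lt_max_iff.1 (h.first_lt i j hij ((h.semistandard.hasShape _ _).1 hi)
    ((h.semistandard.hasShape _ _).1 hj))

theorem IsQuasiFilling.tops_le {n : ℕ} {a : Fin n → ℕ} {T : SetFilling a} (h : IsQuasiFilling T)
    (i : Fin n) : tops T i 0 ≤ i + 1 := by
  rcases Nat.eq_zero_or_pos (a i) with h0 | h0
  · have := h.semistandard.hasShape i 0
    omega
  · exact max_le_coe_iff.1 (h.first_le i h0)

theorem IsQuasiFilling.fwd {n : ℕ} {a : Fin n → ℕ} {T : SetFilling a} (h : IsQuasiFilling T) :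
    Fwd (tops T) := fwd_of_increasing h.semistandard h.tops_lt

theorem isQuasiFilling_fillingOf {n : ℕ} {a : Fin n → ℕ} {t : Fin n → ℕ → ℕ}
    {G : ℕ → Finset (Fin n)} (ht : IsArray t) (hs : HasShape t a) (hf : Fwd t)
    (hlt : ∀ i j, i < j → 0 < t i 0 → 0 < t j 0 → t i 0 < t j 0) (hle : ∀ i, t i 0 ≤ i + 1)
    (hG : Admissible t G) : IsQuasiFilling (fillingOf a t G) := by
  have htr := (fwd_iff_tripleCondition ht hs fun i j hij hi hj =>
    hlt i j hij ((hs _ _).2 hi) ((hs _ _).2 hj)).1 hf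
  have htops : ∀ i c, top (cell (fillingOf a t G) i c) = t i c := fun i c =>
    congrFun₂ (tops_fillingOf hs hG) i c
  refine ⟨isSemistandard_fillingOf ht hs htr hG, fun i _ => ?_, fun i j hij hi hj => ?_⟩
  · rw [anchor, max_le_coe_iff, htops]; exact hle i
  · rw [anchor, anchor, max_lt_max_iff, htops, htops]
    exact hlt i j hij ((hs _ _).2 hi) ((hs _ _).2 hj)

theorem isAtomFilling_fillingOf {n : ℕ} {a : Fin n → ℕ} {t : Fin n → ℕ → ℕ}
    {G : ℕ → Finset (Fin n)} (ht : IsArray t) (hs : HasShape t a) (hf : Fwd t)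
    (h0 : ∀ i, t i 0 = 0 ∨ t i 0 = i + 1) (hG : Admissible t G) :
    IsAtomFilling (fillingOf a t G) := by
  refine ⟨(isQuasiFilling_fillingOf ht hs hf (increasing_of_index h0)
    (fun i => by have := h0 i; omega) hG).semistandard, fun i hi => ?_⟩
  rw [anchor, max_eq_coe_iff]
  have h1 : top (cell (fillingOf a t G) i 0) = t i 0 := congrFun₂ (tops_fillingOf hs hG) i 0
  rw [h1]
  have := h0 i
  have := (hs i 0).2 hi
  omega

/-! ### Column data of atom and quasi-skyline fillings -/

/-- Two fillings have the same anchors and the same labels in each column. -/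
def SameData {n : ℕ} {a b : Fin n → ℕ} (T : SetFilling a) (T' : SetFilling b) : Prop :=
  SameColumns (tops T) (tops T') ∧ ∀ c, colUnion T c = colUnion T' c

theorem SameData.wt_eq {n : ℕ} {a b : Fin n → ℕ} {T : SetFilling a} {T' : SetFilling b}
    (h : IsSemistandard T) (h' : IsSemistandard T') (hd : SameData T T') : wt T = wt T' := by
  funext k
  have h1 : ∀ i, a i ≤ univ.sup a ⊔ univ.sup b := fun i =>
    (Finset.le_sup (mem_univ i)).trans le_sup_left
  have h2 : ∀ i, b i ≤ univ.sup a ⊔ univ.sup b := fun i =>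
    (Finset.le_sup (mem_univ i)).trans le_sup_right
  rw [h.wt_eq h1, h'.wt_eq h2]
  simp only [hd.2]

theorem SameData.excess_eq {n : ℕ} {a b : Fin n → ℕ} {T : SetFilling a} {T' : SetFilling b}
    (h : IsSemistandard T) (h' : IsSemistandard T') (hd : SameData T T') :
    excess T = excess T' := by
  have h1 : ∀ i, a i ≤ univ.sup a ⊔ univ.sup b := fun i =>
    (Finset.le_sup (mem_univ i)).trans le_sup_left
  have h2 : ∀ i, b i ≤ univ.sup a ⊔ univ.sup b := fun i =>
    (Finset.le_sup (mem_univ i)).trans le_sup_right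
  rw [h.excess_eq h1, h'.excess_eq h2]
  refine sum_congr rfl fun c _ => ?_
  rw [hd.2, hd.1.card c (fun x => 0 < x)]

/-- The set of first-column anchors already places them, since they equal their row indices; the
rest is `Fwd.unique`. In particular the shape of an atom filling is determined by its column data.
-/
theorem atom_tops_unique {n : ℕ} {t t' : Fin n → ℕ → ℕ} (ha : IsArray t) (ha' : IsArray t')
    (hf : Fwd t) (hf' : Fwd t') (h0 : ∀ i, t i 0 = 0 ∨ t i 0 = i + 1)
    (h0' : ∀ i, t' i 0 = 0 ∨ t' i 0 = i + 1) (hc : SameColumns t t') : t = t' := by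
  refine hf.unique ha ha' hf' (fun i => ?_) hc
  have key : ∀ t t' : Fin n → ℕ → ℕ, (∀ i, t i 0 = 0 ∨ t i 0 = i + 1) →
      (∀ i, t' i 0 = 0 ∨ t' i 0 = i + 1) → SameColumns t t' → t i 0 = i + 1 → t' i 0 = i + 1 := by
    intro t t' h0 h0' hc h
    obtain ⟨j, hj⟩ := (hc.exists_eq_iff 0 (i + 1)).1 ⟨i, h⟩
    have h1 := h0' j
    have : j = i := Fin.ext (by omega)
    rwa [this] at hj
  have h1 := key t t' h0 h0' hc
  have h2 := key t' t h0' h0 hc.symm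
  have h3 := h0 i
  have h4 := h0' i
  omega

theorem HasShape.unique {n : ℕ} {t : Fin n → ℕ → ℕ} {a b : Fin n → ℕ} (h : HasShape t a)
    (h' : HasShape t b) : a = b := by
  funext i
  have h1 := (h i (b i)).symm.trans (h' i (b i))
  have h2 := (h i (a i)).symm.trans (h' i (a i))
  omega

theorem IsAtomFilling.sigma_ext {n : ℕ} {a b : Fin n → ℕ} {T : SetFilling a} {T' : SetFilling b}
    (h : IsAtomFilling T) (h' : IsAtomFilling T') (hd : SameData T T') :
    (⟨a, T⟩ : Σ b, SetFilling b) = ⟨b, T'⟩ := by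
  have ht := atom_tops_unique h.semistandard.isArray h'.semistandard.isArray h.fwd h'.fwd
    h.tops_zero h'.tops_zero hd.1
  obtain rfl : a = b :=
    h.semistandard.hasShape.unique (by rw [ht]; exact h'.semistandard.hasShape)
  rw [h.semistandard.ext h'.semistandard ht hd.2]

theorem SameData.symm {n : ℕ} {a b : Fin n → ℕ} {T : SetFilling a} {T' : SetFilling b}
    (h : SameData T T') : SameData T' T := ⟨h.1.symm, fun c => (h.2 c).symm⟩

theorem SameData.trans {n : ℕ} {a b d : Fin n → ℕ} {T : SetFilling a} {T' : SetFilling b}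
    {S : SetFilling d} (h : SameData T T') (h' : SameData T' S) : SameData T S :=
  ⟨h.1.trans h'.1, fun c => (h.2 c).trans (h'.2 c)⟩

/-- Here the shape is fixed, so it is known which rows start, and the increasing order places the
first anchors. -/
theorem IsQuasiFilling.ext {n : ℕ} {a : Fin n → ℕ} {T T' : SetFilling a}
    (h : IsQuasiFilling T) (h' : IsQuasiFilling T') (hd : SameData T T') : T = T' := by
  have hs : ∀ i c, 0 < tops T i c ↔ 0 < tops T' i c := fun i c =>
    (h.semistandard.hasShape i c).trans (h'.semistandard.hasShape i c).symm
  have h0 := eq_of_increasing (f := fun i => tops T i 0) (g := fun i => tops T' i 0)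
    (fun i => hs i 0) h.tops_lt h'.tops_lt
    (fun x => (hd.1.card 0 (fun y => 0 < y ∧ y < x)).symm)
  exact h.semistandard.ext h'.semistandard (h.fwd.unique h.semistandard.isArray
    h'.semistandard.isArray h'.fwd (fun i => congrFun h0 i) hd.1) hd.2

/-- Each row moves down to the position named by its first anchor. The order of the nonempty rows is
kept, so `Fwd` survives, and the free entries are put back by `fillingOf`. -/
theorem IsQuasiFilling.exists_atom {n : ℕ} {a : Fin n → ℕ} {T : SetFilling a}
    (h : IsQuasiFilling T) : ∃ b ∈ dominatingRearrangements a, ∃ T' : SetFilling b,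
      IsAtomFilling T' ∧ SameData T T' := by
  have ha := h.semistandard.isArray
  have hs := h.semistandard.hasShape
  obtain ⟨π, hπ⟩ := exists_relocation ha (fun i => top_le _)
  have hc := sameColumns_comp (tops T) π
  have ht : IsArray fun l c => tops T (π l) c := ha.of_sameColumns hc fun l c => ha.anti _ _
  have hs' : HasShape (fun l c => tops T (π l) c) fun l => a (π l) := fun l c => hs _ _
  have hG := h.semistandard.admissible.of_sameColumns ha ht hc
  refine ⟨_, relocation_mem hs h.tops_lt h.tops_le hπ, fillingOf _ _ (colUnion T),
    isAtomFilling_fillingOf ht hs' (h.fwd.comp ha (relocation_mono h.tops_lt hπ)) hπ hG, ?_, ?_⟩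
  · rw [tops_fillingOf hs' hG]; exact hc
  · intro c; rw [colUnion_fillingOf hs' hG]

theorem IsAtomFilling.exists_quasi {n : ℕ} {a b : Fin n → ℕ} {T' : SetFilling b}
    (h : IsAtomFilling T') (hb : b ∈ dominatingRearrangements a) :
    ∃ T : SetFilling a, IsQuasiFilling T ∧ SameData T T' := by
  have ha := h.semistandard.isArray
  have hs := h.semistandard.hasShape
  obtain ⟨π, h1, h2, h3⟩ := mem_dominatingRearrangements_iff_exists_perm.1 hb
  have hc := sameColumns_comp (tops T') π.symm
  have ht : IsArray fun l c => tops T' (π.symm l) c := ha.of_sameColumns hc fun l c => ha.anti _ _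
  have hs' : HasShape (fun l c => tops T' (π.symm l) c) a := fun l c => by
    have := hs (π.symm l) c
    rwa [h1, Equiv.apply_symm_apply] at this
  have hG := h.semistandard.admissible.of_sameColumns ha ht hc
  have hm : ∀ i j, i < j → 0 < tops T' (π.symm i) 0 → 0 < tops T' (π.symm j) 0 →
      π.symm i < π.symm j := fun i j hij hi hj =>
    perm_symm_mono h2 i j hij ((hs _ _).1 hi) ((hs _ _).1 hj)
  refine ⟨fillingOf _ _ (colUnion T'), isQuasiFilling_fillingOf ht hs' (h.fwd.comp ha hm) ?_ ?_ hG,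
    ?_, ?_⟩
  · intro i j hij hi hj
    exact increasing_of_index h.tops_zero _ _ (hm i j hij hi hj) hi hj
  · intro i
    have h4 := h.tops_zero (π.symm i)
    have h5 := hs (π.symm i) 0
    have h6 := h3 (π.symm i)
    rw [Equiv.apply_symm_apply, Fin.le_def] at h6
    omega
  · rw [tops_fillingOf hs' hG]; exact hc.symm
  · intro c; rw [colUnion_fillingOf hs' hG]

open Classical in
/-- The quasiLascoux polynomial as a generating function of quasi-skyline fillings. -/
theorem quasiLascoux_eq_sum_quasi {n : ℕ} (a : Fin n → ℕ) :
    quasiLascoux a = ∑ T : SetFilling a with IsQuasiFilling T, betaMonomial (excess T) (wt T) := by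
  rw [quasiLascoux]
  simp only [lascouxAtom]
  rw [Finset.sum_sigma']
  symm
  refine sum_eq_of_rel _ _ (fun T p => SameData T p.2) ?_ ?_ ?_ ?_ ?_
  · intro T hT
    obtain ⟨b, hb, T', hT', hd⟩ := (mem_filter.1 hT).2.exists_atom
    exact ⟨⟨b, T'⟩, by simpa using ⟨hb, hT'⟩, hd⟩
  · rintro ⟨b, T'⟩ hT'
    simp only [mem_sigma, Set.Finite.mem_toFinset, mem_filter, mem_univ, true_and] at hT'
    obtain ⟨T, hT, hd⟩ := hT'.2.exists_quasi hT'.1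
    exact ⟨T, by simpa using hT, hd⟩
  · intro T hT T₁ hT₁ p _ h h'
    exact (mem_filter.1 hT).2.ext (mem_filter.1 hT₁).2 (h.trans h'.symm)
  · rintro T - ⟨b, T'⟩ hT' ⟨b₁, T₁'⟩ hT₁' h h'
    simp only [mem_sigma, Set.Finite.mem_toFinset, mem_filter, mem_univ, true_and] at hT' hT₁'
    exact hT'.2.sigma_ext hT₁'.2 (h.symm.trans h')
  · rintro T hT ⟨b, T'⟩ hT' h
    simp only [mem_sigma, Set.Finite.mem_toFinset, mem_filter, mem_univ, true_and] at hT' hT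
    rw [h.wt_eq hT.semistandard hT'.2.semistandard, h.excess_eq hT.semistandard hT'.2.semistandard]

/-! ### Lascoux polynomials -/

theorem exists_hasShape {n : ℕ} {t : Fin n → ℕ → ℕ} (ht : IsArray t) {N : ℕ}
    (hN : ∀ i, t i N = 0) : ∃ b, HasShape t b := by
  have : ∀ i, ∃ m, ∀ c, 0 < t i c ↔ c < m := by
    intro i
    classical
    have hex : ∃ c, t i c = 0 := ⟨N, hN i⟩
    refine ⟨Nat.find hex, fun c => ⟨fun h => ?_, fun h => ?_⟩⟩
    · by_contra hle
      have h1 := ht.antitone i (not_lt.1 hle)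
      have h2 := Nat.find_spec hex
      omega
    · exact Nat.pos_of_ne_zero (Nat.find_min hex h)
  choose b hb using this
  exact ⟨b, hb⟩

/-- The anchors of a filling with basement, with rows indexed by basement entries. -/
def relabelled {n : ℕ} {a : Fin n → ℕ} (T : SetFilling a) (l : Fin n) (c : ℕ) : ℕ := tops T l.rev c

theorem IsLascouxFilling.relabelled_zero {n : ℕ} {a : Fin n → ℕ}
    {T : SetFilling (basementShape a)} (h : IsLascouxFilling T) (l : Fin n) :
    relabelled T l 0 = l + 1 := by
  simp [relabelled, tops, h.basement, top]

theorem sameColumns_relabelled {n : ℕ} {a : Fin n → ℕ} (T : SetFilling a) :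
    SameColumns (tops T) (relabelled T) := fun _ => ⟨Fin.revPerm, fun _ => rfl⟩

theorem IsLascouxFilling.isArray {n : ℕ} {a : Fin n → ℕ} {T : SetFilling (basementShape a)}
    (h : IsLascouxFilling T) : IsArray (relabelled T) :=
  h.semistandard.isArray.of_sameColumns (sameColumns_relabelled T) fun _ _ =>
    h.semistandard.isArray.anti _ _

theorem IsLascouxFilling.hasShape {n : ℕ} {a : Fin n → ℕ} {T : SetFilling (basementShape a)}
    (h : IsLascouxFilling T) : HasShape (relabelled T) fun l => a l + 1 := fun l c => by
  have := h.semistandard.hasShape l.rev c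
  rwa [basementShape, Fin.rev_rev] at this

theorem IsLascouxFilling.bwd {n : ℕ} {a : Fin n → ℕ} {T : SetFilling (basementShape a)}
    (h : IsLascouxFilling T) : Bwd (relabelled T) := by
  refine (bwd_iff_tripleCondition h.isArray h.hasShape fun i j hij => ?_).2 ?_
  · rw [h.relabelled_zero, h.relabelled_zero]
    rw [Fin.lt_def] at hij; omega
  · have := h.semistandard.tripleCondition
    have e : (fun i => relabelled T i.rev) = tops T := by
      funext i c
      rw [relabelled, Fin.rev_rev]
    rw [e]; exact this

theorem IsLascouxFilling.colUnion_zero {n : ℕ} {a : Fin n → ℕ} {T : SetFilling (basementShape a)}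
    (h : IsLascouxFilling T) : colUnion T 0 = univ := by
  ext k
  simp only [mem_colUnion, h.basement, mem_singleton, mem_univ, iff_true]
  exact ⟨k.rev, by simp⟩

/-- Beyond the basement column the data of the two fillings agree. -/
def SameDataShift {n : ℕ} {a b : Fin n → ℕ} (T : SetFilling a) (T' : SetFilling b) : Prop :=
  SameColumns (fun l c => relabelled T l (c + 1)) (tops T') ∧ ∀ c, colUnion T (c + 1) = colUnion T' c

/-- Without the basement, the anchors are rethreaded greedily from the left, starting from
first-column anchors at their row indices. The basement says that the old first column is bounded by
the row index, which puts the new shape into `lswap a`. -/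
theorem IsLascouxFilling.exists_atom {n : ℕ} {a : Fin n → ℕ} {T : SetFilling (basementShape a)}
    (h : IsLascouxFilling T) : ∃ b ∈ lswap a, ∃ T' : SetFilling b,
      IsAtomFilling T' ∧ SameDataShift T T' := by
  set z : Fin n → ℕ → ℕ := fun l c => relabelled T l (c + 1)
  have hz : IsArray z := ⟨fun i c => h.isArray.anti _ _, fun i j c => h.isArray.inj _ _ _⟩
  have hzs : HasShape z a := fun l c => by
    have := h.hasShape l (c + 1)
    simpa using this
  obtain ⟨π, hπ⟩ := exists_relocation hz (fun i => top_le _)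
  obtain ⟨t, ht, hf, hc, ht0⟩ := exists_fwd hz π
  have h0 : ∀ i, t i 0 = 0 ∨ t i 0 = i + 1 := fun i => by rw [ht0]; exact hπ i
  obtain ⟨b, hb⟩ := exists_hasShape ht (N := univ.sup a) fun i => by
    obtain ⟨ρ, hρ⟩ := hc (univ.sup a)
    rw [hρ]
    have h1 := hzs (ρ i) (univ.sup a)
    have h2 : a (ρ i) ≤ univ.sup a := Finset.le_sup (mem_univ _)
    omega
  have hG0 : Admissible (fun i c => tops T i (c + 1)) fun c => colUnion T (c + 1) :=
    ⟨fun i c => h.semistandard.admissible.le _ _, fun i c => h.semistandard.admissible.anchors _ _,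
      fun c => h.semistandard.admissible.box _⟩
  have hG : Admissible t fun c => colUnion T (c + 1) :=
    hG0.of_sameColumns ⟨fun i c => h.semistandard.isArray.anti _ _,
      fun i j c => h.semistandard.isArray.inj _ _ _⟩ ht
      (SameColumns.trans (fun c => ⟨Fin.revPerm, fun _ => rfl⟩) hc)
  refine ⟨b, mem_lswap_iff.2 ⟨?_, card_shape_eq hc.symm hzs hb⟩, fillingOf b t _,
    isAtomFilling_fillingOf ht hb hf h0 hG, ?_, ?_⟩
  · refine prefixLE_of_arrays hf h0 hz.anti hc.symm (fun i => ?_) hzs hb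
    exact (h.isArray.anti i 0).trans (h.relabelled_zero i).le
  · rw [tops_fillingOf hb hG]; exact hc
  · intro c; rw [colUnion_fillingOf hb hG]

/-- Conversely, the anchors are rethreaded greedily from the right into the shape `a`; `b ∈ lswap a`
bounds the first column by the row index, so the basement can be put in front. -/
theorem IsAtomFilling.exists_lascoux {n : ℕ} {a b : Fin n → ℕ} {T' : SetFilling b}
    (h : IsAtomFilling T') (hb : b ∈ lswap a) :
    ∃ T : SetFilling (basementShape a), IsLascouxFilling T ∧ SameDataShift T T' := by
  have hb' := mem_lswap_iff.1 hb
  obtain ⟨e, he, hbw, hc, hs, he0⟩ := exists_flagged_bwd h.semistandard.isArray h.tops_zero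
    h.semistandard.hasShape hb'.1 hb'.2
  let y : Fin n → ℕ → ℕ := fun l c => Nat.casesOn c ((l : ℕ) + 1) fun c => e l c
  have hy0 : ∀ l, y l 0 = l + 1 := fun _ => rfl
  have hy : IsArray y := by
    constructor
    · rintro i (_ | c)
      · exact he0 i
      · exact he.anti i c
    · rintro i j (_ | c) hpos heq
      · rw [hy0, hy0] at heq
        exact Fin.ext (by omega)
      · exact he.inj i j c hpos heq
  have hys : HasShape y fun l => a l + 1 := by
    rintro i (_ | c)
    · simp [y]
    · simpa [y] using hs i c
  have hyb : Bwd y := by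
    rintro i j (_ | c) hij hpos hlt
    · rw [hy0, hy0] at hlt
      rw [Fin.lt_def] at hij; omega
    · exact hbw i j c hij hpos hlt
  have htr := (bwd_iff_tripleCondition hy hys fun i j hij => by
    rw [hy0, hy0]; rw [Fin.lt_def] at hij; omega).1 hyb
  have hyr : SameColumns y fun i => y i.rev := fun _ => ⟨Fin.revPerm, fun _ => rfl⟩
  have hyra : IsArray fun i => y i.rev := hy.of_sameColumns hyr fun i c => hy.anti _ _
  have hG0 := h.semistandard.admissible.of_sameColumns h.semistandard.isArray he hc
  let G : ℕ → Finset (Fin n) := fun c => Nat.casesOn c univ fun c => colUnion T' c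
  have hG1 : Admissible y G := by
    refine ⟨?_, ?_, ?_⟩
    · rintro i (_ | c)
      · rw [hy0]; omega
      · exact hG0.le i c
    · rintro i (_ | c) k hk
      · exact mem_univ k
      · exact hG0.anchors i c k hk
    · rintro (_ | c) k hk
      · exact ⟨k, Or.inl rfl⟩
      · exact hG0.box c k hk
  have hG := hG1.of_sameColumns hy hyra hyr
  have hsh : HasShape (fun i => y i.rev) (basementShape a) := fun i c => hys i.rev c
  refine ⟨fillingOf _ _ G, ⟨isSemistandard_fillingOf hyra hsh htr hG, fun i => ?_⟩, ?_, ?_⟩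
  · ext k
    rw [mem_cell_fillingOf hsh, mem_singleton]
    have hk : InBox (fun i => y i.rev) k k.rev 0 := Or.inl (by simp [y])
    constructor
    · rintro ⟨-, h1⟩
      rw [h1.unique hyra hk, Fin.rev_rev]
    · rintro rfl
      refine ⟨mem_univ _, ?_⟩
      rwa [Fin.rev_rev] at hk
  · have e1 : (fun l c => relabelled (fillingOf (basementShape a) (fun i => y i.rev) G) l (c + 1)) =
        e := by
      funext l c
      rw [relabelled, tops_fillingOf hsh hG]
      simp [y]
    rw [e1]; exact hc.symm
  · intro c; rw [colUnion_fillingOf hsh hG]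

theorem IsLascouxFilling.ext {n : ℕ} {a b : Fin n → ℕ} {T T₁ : SetFilling (basementShape a)}
    {T' : SetFilling b} (h : IsLascouxFilling T) (h₁ : IsLascouxFilling T₁)
    (hd : SameDataShift T T') (hd₁ : SameDataShift T₁ T') : T = T₁ := by
  have hc : SameColumns (relabelled T) (relabelled T₁) := by
    rintro (_ | c)
    · exact ⟨1, fun i => by simp [h.relabelled_zero, h₁.relabelled_zero]⟩
    · exact (hd.1.trans hd₁.1.symm) c
  have hN : ∀ l, ∀ c, univ.sup a + 1 ≤ c → relabelled T l c = 0 ∧ relabelled T₁ l c = 0 := by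
    intro l c hle
    have h1 : a l ≤ univ.sup a := Finset.le_sup (mem_univ l)
    have h2 := h.hasShape l c
    have h3 := h₁.hasShape l c
    dsimp only at h2 h3
    omega
  have hr : relabelled T = relabelled T₁ := by
    funext l c
    rcases le_total c (univ.sup a + 1) with hle | hle
    · exact h.bwd.unique h.isArray h₁.isArray h₁.bwd (univ.sup a + 1)
        (fun i => by rw [(hN i _ le_rfl).1, (hN i _ le_rfl).2])
        (fun i c => (h.hasShape i c).trans (h₁.hasShape i c).symm) hc c hle l
    · rw [(hN l c hle).1, (hN l c hle).2]
  refine h.semistandard.ext h₁.semistandard ?_ ?_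
  · funext i c
    have := congrFun₂ hr i.rev c
    simpa [relabelled] using this
  · rintro (_ | c)
    · rw [h.colUnion_zero, h₁.colUnion_zero]
    · rw [hd.2, hd₁.2]

theorem SameDataShift.wt_eq {n : ℕ} {a b : Fin n → ℕ} {T : SetFilling (basementShape a)}
    {T' : SetFilling b} (h : IsSemistandard T) (h' : IsSemistandard T')
    (hd : SameDataShift T T') : basementWt T = wt T' := by
  funext k
  have h1 : ∀ i, basementShape a i ≤ (univ.sup a ⊔ univ.sup b) + 1 := fun i =>
    Nat.add_le_add_right ((Finset.le_sup (mem_univ i.rev)).trans le_sup_left) 1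
  have h2 : ∀ i, b i ≤ univ.sup a ⊔ univ.sup b := fun i =>
    (Finset.le_sup (mem_univ i)).trans le_sup_right
  rw [h'.wt_eq h2, basementWt,
    sum_boxes T (fun c s => if c ≠ 0 ∧ k ∈ s then 1 else 0) (by simp) h1, sum_range_succ']
  simp only [ne_eq, Nat.add_eq_zero_iff, one_ne_zero, and_false, not_false_eq_true, true_and,
    not_true_eq_false, false_and, if_false, sum_const_zero, add_zero]
  refine sum_congr rfl fun c _ => ?_
  rw [h.sum_mem, hd.2]

theorem SameDataShift.excess_eq {n : ℕ} {a b : Fin n → ℕ} {T : SetFilling (basementShape a)}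
    {T' : SetFilling b} (h : IsLascouxFilling T) (h' : IsSemistandard T')
    (hd : SameDataShift T T') : excess T = excess T' := by
  have h1 : ∀ i, basementShape a i ≤ (univ.sup a ⊔ univ.sup b) + 1 := fun i =>
    Nat.add_le_add_right ((Finset.le_sup (mem_univ i.rev)).trans le_sup_left) 1
  have h2 : ∀ i, b i ≤ univ.sup a ⊔ univ.sup b := fun i =>
    (Finset.le_sup (mem_univ i)).trans le_sup_right
  rw [h'.excess_eq h2, h.semistandard.excess_eq h1, sum_range_succ']
  have h0 : #(colUnion T 0) - #{i | 0 < tops T i 0} = 0 := by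
    have : ∀ i, 0 < tops T i 0 := fun i => (h.semistandard.hasShape i 0).2 (Nat.succ_pos _)
    simp [this, h.colUnion_zero]
  rw [h0, add_zero]
  refine sum_congr rfl fun c _ => ?_
  rw [hd.2, hd.1.card c (fun x => 0 < x),
    (sameColumns_relabelled T).card (c + 1) (fun x => 0 < x)]

open Classical in
theorem lascoux_eq_sum_lswap {n : ℕ} (a : Fin n → ℕ) :
    lascoux a = ∑ b ∈ (finite_lswap a).toFinset, lascouxAtom b := by
  rw [lascoux]
  simp only [lascouxAtom]
  rw [Finset.sum_sigma']
  refine sum_eq_of_rel _ _ (fun T p => SameDataShift T p.2) ?_ ?_ ?_ ?_ ?_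
  · intro T hT
    obtain ⟨b, hb, T', hT', hd⟩ := (mem_filter.1 hT).2.exists_atom
    exact ⟨⟨b, T'⟩, by simpa using ⟨hb, hT'⟩, hd⟩
  · rintro ⟨b, T'⟩ hT'
    simp only [mem_sigma, Set.Finite.mem_toFinset, mem_filter, mem_univ, true_and] at hT'
    obtain ⟨T, hT, hd⟩ := hT'.2.exists_lascoux hT'.1
    exact ⟨T, by simpa using hT, hd⟩
  · intro T hT T₁ hT₁ p _ h h'
    exact (mem_filter.1 hT).2.ext (mem_filter.1 hT₁).2 h h'
  · rintro T - ⟨b, T'⟩ hT' ⟨b₁, T₁'⟩ hT₁' h h'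
    simp only [mem_sigma, Set.Finite.mem_toFinset, mem_filter, mem_univ, true_and] at hT' hT₁'
    exact hT'.2.sigma_ext hT₁'.2 ⟨h.1.symm.trans h'.1, fun c => (h.2 c).symm.trans (h'.2 c)⟩
  · rintro T hT ⟨b, T'⟩ hT' h
    simp only [mem_sigma, Set.Finite.mem_toFinset, mem_filter, mem_univ, true_and] at hT' hT
    rw [h.wt_eq hT.semistandard hT'.2.semistandard, h.excess_eq hT hT'.2.semistandard]

theorem lascoux_eq_sum_Qlswap {n : ℕ} (a : Fin n → ℕ) :
    lascoux a = ∑ b ∈ (finite_Qlswap a).toFinset, quasiLascoux b := by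
  rw [lascoux_eq_sum_lswap, sum_lswap]
  rfl

/-! ### Quasi-Kohnert tableaux -/

/-- The array of rows of the labels, counted from `1`. -/
def rowArray {n : ℕ} {a : Fin n → ℕ} (f : (i : Fin n) → Fin (a i) → Fin n) (i : Fin n) (c : ℕ) : ℕ :=
  if h : c < a i then (f i ⟨c, h⟩ : ℕ) + 1 else 0

theorem rowArray_of_lt {n : ℕ} {a : Fin n → ℕ} {f : (i : Fin n) → Fin (a i) → Fin n} {i : Fin n}
    {c : ℕ} (h : c < a i) : rowArray f i c = f i ⟨c, h⟩ + 1 := by simp [rowArray, h]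

theorem rowArray_of_le {n : ℕ} {a : Fin n → ℕ} {f : (i : Fin n) → Fin (a i) → Fin n} {i : Fin n}
    {c : ℕ} (h : a i ≤ c) : rowArray f i c = 0 := by simp [rowArray, not_lt.2 h]

theorem hasShape_rowArray {n : ℕ} {a : Fin n → ℕ} (f : (i : Fin n) → Fin (a i) → Fin n) :
    HasShape (rowArray f) a := by
  intro i c
  rw [rowArray]
  split_ifs with h <;> simp [h]

theorem rowArray_le {n : ℕ} {a : Fin n → ℕ} (f : (i : Fin n) → Fin (a i) → Fin n) (i : Fin n)
    (c : ℕ) : rowArray f i c ≤ n := by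
  rw [rowArray]
  split_ifs with h
  · exact (f i ⟨c, h⟩).2
  · exact Nat.zero_le _

/-- Quasi-Kohnert tableaux in terms of arrays. -/
structure IsKohnertArray {n : ℕ} (z : Fin n → ℕ → ℕ) (a : Fin n → ℕ) : Prop where
  isArray : IsArray z
  bwd : Bwd z
  short : Short z a
  first_lt : ∀ i j, i < j → 0 < z i 0 → 0 < z j 0 → z i 0 < z j 0
  first_le : ∀ i, z i 0 ≤ i + 1

/-- Row `i` of the array follows the label `i` through the columns, so labels become rows and rows
become entries. The condition `above` turns into `Bwd`; the flag condition is needed only in the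
first column since labels descend. -/
theorem isQuasiKohnert_iff {n : ℕ} {a : Fin n → ℕ} (f : (i : Fin n) → Fin (a i) → Fin n) :
    IsQuasiKohnert f ↔ IsKohnertArray (rowArray f) a := by
  have hs := hasShape_rowArray f
  constructor
  · intro h
    refine ⟨⟨fun i c => ?_, fun i j c hpos he => ?_⟩, fun i j c hij hpos hlt => ?_,
      fun i j hij ha c hc => ?_, fun i j hij hi hj => ?_, fun i => ?_⟩
    · rcases lt_or_ge (c + 1) (a i) with hc | hc
      · rw [rowArray_of_lt hc, rowArray_of_lt (show c < a i by omega)]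
        have := h.descend i (show (⟨c, by omega⟩ : Fin (a i)) ≤ ⟨c + 1, hc⟩ by simp)
        rw [Fin.le_def] at this; omega
      · rw [rowArray_of_le hc]; exact Nat.zero_le _
    · have hi := (hs i c).1 hpos
      have hj := (hs j c).1 (he ▸ hpos)
      rw [rowArray_of_lt hi, rowArray_of_lt hj] at he
      exact h.cells i j c hi hj (Fin.ext (by omega))
    · have hj := (hs j c).1 hpos
      have hi := (hs i c).1 (by omega)
      rw [rowArray_of_lt hi, rowArray_of_lt hj] at hlt
      obtain ⟨h1, h2⟩ := h.above i j hij c hi hj (by rw [Fin.lt_def]; omega)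
      rw [rowArray_of_lt h1, rowArray_of_lt hj]
      rw [Fin.lt_def] at h2; omega
    · have := h.short i j hij ha c hc
      rw [rowArray_of_lt hc, rowArray_of_lt (show c + 1 < a j by omega)]
      rw [Fin.lt_def] at this; omega
    · have hi' := (hs i 0).1 hi
      have hj' := (hs j 0).1 hj
      have := h.first i j hij hi' hj'
      rw [rowArray_of_lt hi', rowArray_of_lt hj']
      rw [Fin.lt_def] at this; omega
    · rcases lt_or_ge 0 (a i) with hc | hc
      · rw [rowArray_of_lt hc]
        have := h.flagged i ⟨0, hc⟩
        rw [Fin.le_def] at this; omega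
      · rw [rowArray_of_le hc]; exact Nat.zero_le _
  · intro h
    refine ⟨fun i j c hi hj he => ?_, fun i c => ?_, fun i c c' hcc => ?_, fun i j hij c hi hj hlt => ?_,
      fun i j hij hi hj => ?_, fun i j hij ha c hc => ?_⟩
    · refine h.isArray.inj i j c ((hs i c).2 hi) ?_
      rw [rowArray_of_lt hi, rowArray_of_lt hj, he]
    · have h1 := h.first_le i
      have h2 := h.isArray.antitone i (Nat.zero_le c)
      rw [rowArray_of_lt c.2] at h2
      rw [Fin.le_def]
      simp only [Fin.eta] at h2
      omega
    · have := h.isArray.antitone i (show (c : ℕ) ≤ c' from hcc)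
      rw [rowArray_of_lt c.2, rowArray_of_lt c'.2] at this
      rw [Fin.le_def]
      simp only [Fin.eta] at this
      omega
    · have := h.bwd i j c hij ((hs j c).2 hj) (by
        rw [rowArray_of_lt hi, rowArray_of_lt hj]; rw [Fin.lt_def] at hlt; omega)
      have h1 : c + 1 < a i := (hs i (c + 1)).1 (by omega)
      rw [rowArray_of_lt h1, rowArray_of_lt hj] at this
      exact ⟨h1, by rw [Fin.lt_def]; omega⟩
    · have := h.first_lt i j hij ((hs i 0).2 hi) ((hs j 0).2 hj)
      rw [rowArray_of_lt hi, rowArray_of_lt hj] at this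
      rw [Fin.lt_def]; omega
    · have := h.short i j hij ha c hc
      rw [rowArray_of_lt hc, rowArray_of_lt (show c + 1 < a j by omega)] at this
      rw [Fin.lt_def]; omega

theorem exists_rowArray {n : ℕ} {z : Fin n → ℕ → ℕ} {a : Fin n → ℕ} (hs : HasShape z a)
    (hn : ∀ i c, z i c ≤ n) : ∃ f : (i : Fin n) → Fin (a i) → Fin n, rowArray f = z := by
  refine ⟨fun i c => ⟨z i c - 1, ?_⟩, ?_⟩
  · have h1 := hn i c
    have h2 := (hs i c).2 c.2
    omega
  · funext i c
    rcases lt_or_ge c (a i) with hc | hc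
    · rw [rowArray_of_lt hc]
      have := (hs i c).2 hc
      simp only
      omega
    · rw [rowArray_of_le hc]
      have := hs i c
      omega

/-! ### Fillings without free entries and quasi-Kohnert arrays -/

theorem card_le_one_of_excess {n : ℕ} {a : Fin n → ℕ} {T : SetFilling a} (h : excess T = 0)
    (i : Fin n) (c : ℕ) : (cell T i c).card ≤ 1 := by
  by_cases hc : c < a i
  · rw [excess, sum_eq_zero_iff] at h
    have h1 := sum_eq_zero_iff.1 (h i (mem_univ i)) ⟨c, hc⟩ (mem_univ _)
    simp only [cell, hc, dif_pos]
    omega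
  · simp [cell, hc]

theorem mem_colUnion_of_excess {n : ℕ} {a : Fin n → ℕ} {T : SetFilling a} (h : excess T = 0)
    {k : Fin n} {c : ℕ} : k ∈ colUnion T c ↔ ∃ i, tops T i c = k + 1 := by
  rw [mem_colUnion]
  refine exists_congr fun i => ⟨fun hk => ?_, fun hk => ?_⟩
  · have h1 : cell T i c = {k} := eq_singleton_iff_unique_mem.2
      ⟨hk, fun y hy => card_le_one.1 (card_le_one_of_excess h i c) y hy k hk⟩
    simp [tops, h1, top]
  · obtain ⟨x, hx, hx'⟩ := exists_mem_top (top_pos_iff.1 (show 0 < tops T i c by omega))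
    have : x = k := by simp only [tops] at hk; rw [Fin.ext_iff]; omega
    rwa [← this]

/-- The sets of labels of an array. -/
def labelSet {n : ℕ} (t : Fin n → ℕ → ℕ) (c : ℕ) : Finset (Fin n) := {k | ∃ i, t i c = k + 1}

theorem admissible_labelSet {n : ℕ} {t : Fin n → ℕ → ℕ} (hn : ∀ i c, t i c ≤ n) :
    Admissible t (labelSet t) :=
  ⟨hn, fun i c k hk => by simp only [labelSet, mem_filter, mem_univ, true_and]; exact ⟨i, hk⟩,
    fun c k hk => by
      obtain ⟨i, hi⟩ := (mem_filter.1 hk).2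
      exact ⟨i, Or.inl hi⟩⟩

theorem card_labelSet {n : ℕ} {t : Fin n → ℕ → ℕ} (ht : IsArray t) (hn : ∀ i c, t i c ≤ n) (c : ℕ) :
    #(labelSet t c) = #{i | 0 < t i c} := by
  symm
  refine card_bij (fun i hi => ⟨t i c - 1, ?_⟩) ?_ ?_ ?_
  · have h1 := hn i c
    have h2 := (mem_filter.1 hi).2
    omega
  · intro i hi
    have h2 := (mem_filter.1 hi).2
    simp only [labelSet, mem_filter, mem_univ, true_and]
    exact ⟨i, by omega⟩
  · intro i hi j hj he
    have h2 := (mem_filter.1 hi).2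
    have h3 := (mem_filter.1 hj).2
    simp only [Fin.mk.injEq] at he
    exact ht.inj i j c h2 (by omega)
  · intro k hk
    obtain ⟨i, hi⟩ := (mem_filter.1 hk).2
    exact ⟨i, by simp only [mem_filter, mem_univ, true_and]; omega, Fin.ext (by simp only; omega)⟩

/-- The rows are moved to the positions named by their first entries and then rethreaded greedily
from the left. By `shape_eq_of_short` the second step does not change the shape, so the result has a
shape that rearranges and dominates `a`. -/
theorem IsKohnertArray.exists_atom {n : ℕ} {z : Fin n → ℕ → ℕ} {a : Fin n → ℕ}
    (h : IsKohnertArray z a) (hs : HasShape z a) (hn : ∀ i c, z i c ≤ n) :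
    ∃ b ∈ dominatingRearrangements a, ∃ T : SetFilling b, IsAtomFilling T ∧ excess T = 0 ∧
      SameColumns z (tops T) := by
  obtain ⟨π, hπ⟩ := exists_relocation h.isArray (fun i => hn i 0)
  obtain ⟨t, ht, hf, hc, ht0⟩ := exists_fwd h.isArray π
  have h0 : ∀ i, t i 0 = 0 ∨ t i 0 = i + 1 := fun i => by rw [ht0]; exact hπ i
  obtain ⟨b', hb'⟩ := exists_hasShape ht (N := univ.sup a) fun i => by
    obtain ⟨ρ, hρ⟩ := hc (univ.sup a)
    rw [hρ]
    have h1 := hs (ρ i) (univ.sup a)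
    have h2 : a (ρ i) ≤ univ.sup a := Finset.le_sup (mem_univ _)
    omega
  have hm := relocation_mono h.first_lt hπ
  have hcπ := sameColumns_comp z π
  have hb : (fun l => a (π l)) = b' := shape_eq_of_short ht hf h0 hb'
    (h.isArray.of_sameColumns hcπ fun l c => h.isArray.anti _ _) (h.bwd.comp h.isArray hm) hπ
    (fun l c => hs _ _) (h.short.comp hs hm) (hc.symm.trans hcπ)
  subst hb
  have htn : ∀ i c, t i c ≤ n := fun i c => by
    obtain ⟨ρ, hρ⟩ := hc c
    rw [hρ]; exact hn _ _
  have hG := admissible_labelSet htn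
  have hT := isAtomFilling_fillingOf ht hb' hf h0 hG
  refine ⟨_, relocation_mem hs h.first_lt h.first_le hπ, fillingOf _ t (labelSet t), hT, ?_, ?_⟩
  · rw [hT.semistandard.excess_eq (N := univ.sup fun l => a (π l))
      (fun i => Finset.le_sup (f := fun l => a (π l)) (mem_univ i)), sum_eq_zero_iff]
    intro c _
    rw [colUnion_fillingOf hb' hG, tops_fillingOf hb' hG, card_labelSet ht htn, Nat.sub_self]
  · rw [tops_fillingOf hb' hG]; exact hc

/-- Strong induction on the row. The first entry of row `i` of `e` is `j + 1` for some `j ≤ i` with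
row `j` nonempty; if `j < i`, row `j` of `e` already holds it. -/
theorem flagged_eq {n : ℕ} {t e : Fin n → ℕ → ℕ} (he : IsArray e)
    (h0 : ∀ i, t i 0 = 0 ∨ t i 0 = i + 1) (hc : SameColumns t e)
    (hs : ∀ i, 0 < t i 0 ↔ 0 < e i 0) (hle : ∀ i, e i 0 ≤ i + 1) (i : Fin n) :
    e i 0 = t i 0 := by
  suffices h : ∀ m, ∀ i : Fin n, (i : ℕ) = m → e i 0 = t i 0 from h _ i rfl
  intro m
  induction m using Nat.strong_induction_on with
  | _ m ih =>
    intro i hi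
    rcases Nat.eq_zero_or_pos (e i 0) with hz | hpos
    · have := hs i
      omega
    obtain ⟨j, hj⟩ := (hc.exists_eq_iff 0 (e i 0)).2 ⟨i, rfl⟩
    have h1 := h0 j
    have h2 := hle i
    rcases lt_or_eq_of_le (show (j : ℕ) ≤ i by omega) with h3 | h3
    · have h4 := ih j (by omega) j rfl
      have h5 := he.inj i j 0 hpos (by omega)
      subst h5; omega
    · rw [← hj, Fin.ext h3]

theorem IsAtomFilling.exists_kohnertArray {n : ℕ} {a b : Fin n → ℕ} {T : SetFilling b}
    (h : IsAtomFilling T) (hb : b ∈ dominatingRearrangements a) :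
    ∃ z : Fin n → ℕ → ℕ, IsKohnertArray z a ∧ HasShape z a ∧ SameColumns z (tops T) := by
  have ht := h.semistandard.isArray
  have hs := h.semistandard.hasShape
  -- The shape `b` itself is used on both sides: the rethreading from the right stays in `b`, which
  -- is what `short_of_shape_eq` requires.
  obtain ⟨e, he, hbw, hc, hes, he0⟩ := exists_flagged_bwd (a := b) ht h.tops_zero hs
    (fun _ _ => le_rfl) (fun _ => rfl)
  have hsh := short_of_shape_eq h.fwd h.tops_zero hs he hbw he0 hes hc
  have hez : ∀ i, e i 0 = 0 ∨ e i 0 = i + 1 := fun i => by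
    rw [flagged_eq he h.tops_zero hc (fun i => (hs i 0).trans (hes i 0).symm) he0]
    exact h.tops_zero i
  obtain ⟨π, h1, h2, h3⟩ := mem_dominatingRearrangements_iff_exists_perm.1 hb
  have hm : ∀ i j, i < j → 0 < e (π.symm i) 0 → 0 < e (π.symm j) 0 →
      π.symm i < π.symm j := fun i j hij hi hj =>
    perm_symm_mono h2 i j hij ((hes _ _).1 hi) ((hes _ _).1 hj)
  have hcπ := sameColumns_comp e π.symm
  have hba : (fun l => b (π.symm l)) = a := by
    funext l; rw [h1, Equiv.apply_symm_apply]
  refine ⟨fun l c => e (π.symm l) c, ⟨he.of_sameColumns hcπ fun i c => he.anti _ _,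
    hbw.comp he hm, ?_, fun i j hij hi hj => ?_, fun i => ?_⟩, ?_, (hc.trans hcπ).symm⟩
  · have := hsh.comp hes hm
    rwa [hba] at this
  · exact increasing_of_index hez _ _ (hm i j hij hi hj) hi hj
  · have h4 := he0 (π.symm i)
    have h5 := hes (π.symm i) 0
    have h6 := h3 (π.symm i)
    rw [Equiv.apply_symm_apply, Fin.le_def] at h6
    omega
  · intro l c
    have := hes (π.symm l) c
    rwa [h1, Equiv.apply_symm_apply] at this

theorem IsKohnertArray.ext {n : ℕ} {z y : Fin n → ℕ → ℕ} {a : Fin n → ℕ}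
    (h : IsKohnertArray z a) (h' : IsKohnertArray y a) (hs : HasShape z a) (hs' : HasShape y a)
    (hc : SameColumns z y) : z = y := by
  have hN : ∀ l, ∀ c, univ.sup a ≤ c → z l c = 0 ∧ y l c = 0 := by
    intro l c hle
    have h1 : a l ≤ univ.sup a := Finset.le_sup (mem_univ l)
    have h2 := hs l c
    have h3 := hs' l c
    omega
  funext l c
  rcases le_total c (univ.sup a) with hle | hle
  · exact h.bwd.unique h.isArray h'.isArray h'.bwd (univ.sup a)
      (fun i => by rw [(hN i _ le_rfl).1, (hN i _ le_rfl).2])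
      (fun i c => (hs i c).trans (hs' i c).symm) hc c hle l
  · rw [(hN l c hle).1, (hN l c hle).2]

/-! ### The specialization at `β = 0` -/

theorem specializeZero_betaMonomial {n : ℕ} (k : ℕ) (w : Fin n → ℕ) :
    specializeZero (betaMonomial k w) =
      if k = 0 then MvPolynomial.monomial (Finsupp.equivFunOnFinite.symm w) 1 else 0 := by
  rw [specializeZero, betaMonomial, MvPolynomial.map_monomial]
  split_ifs with h
  · simp [h]
  · simp [h]

theorem prod_X_rows {n : ℕ} {a : Fin n → ℕ} (f : (i : Fin n) → Fin (a i) → Fin n) :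
    (∏ i, ∏ c, MvPolynomial.X (f i c) : MvPolynomial (Fin n) ℤ) = MvPolynomial.monomial
      (Finsupp.equivFunOnFinite.symm fun k => ∑ i, ∑ c, if f i c = k then 1 else 0) 1 := by
  have : (Finsupp.equivFunOnFinite.symm fun k => ∑ i, ∑ c, if f i c = k then 1 else 0) =
      ∑ i, ∑ c, Finsupp.single (f i c) 1 := by
    ext k
    simp [Finsupp.finsetSum_apply, Finsupp.single_apply]
  rw [this, MvPolynomial.monomial_sum_one]
  refine prod_congr rfl fun i _ => ?_
  rw [MvPolynomial.monomial_sum_one]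
  rfl

theorem sum_rows_eq_wt {n : ℕ} {a b : Fin n → ℕ} {f : (i : Fin n) → Fin (a i) → Fin n}
    (hf : IsQuasiKohnert f) {T : SetFilling b} (h : IsSemistandard T) (h0 : excess T = 0)
    (hc : SameColumns (rowArray f) (tops T)) (k : Fin n) :
    (∑ i, ∑ c, if f i c = k then 1 else 0) = wt T k := by
  have ha := ((isQuasiKohnert_iff f).1 hf).isArray
  have h1 : ∀ i, a i ≤ univ.sup a ⊔ univ.sup b := fun i =>
    (Finset.le_sup (mem_univ i)).trans le_sup_left
  have h2 : ∀ i, b i ≤ univ.sup a ⊔ univ.sup b := fun i =>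
    (Finset.le_sup (mem_univ i)).trans le_sup_right
  rw [h.wt_eq h2]
  have e1 : (∑ i, ∑ c, if f i c = k then 1 else 0) =
      ∑ c ∈ range (univ.sup a ⊔ univ.sup b), ∑ i, if rowArray f i c = k + 1 then 1 else 0 := by
    rw [sum_comm (s := range _)]
    refine sum_congr rfl fun i _ => ?_
    calc (∑ c, if f i c = k then 1 else 0)
        = ∑ c : Fin (a i), if rowArray f i c = k + 1 then 1 else 0 := by
          refine sum_congr rfl fun c _ => ?_
          rw [rowArray_of_lt c.2]
          simp [Fin.ext_iff]
      _ = ∑ c ∈ range (a i), if rowArray f i c = k + 1 then 1 else 0 :=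
          Fin.sum_univ_eq_sum_range (fun c => if rowArray f i c = k + 1 then 1 else 0) _
      _ = _ := by
        refine sum_subset (range_subset_range.2 (h1 i)) fun c _ hc => ?_
        simp only [mem_range, not_lt] at hc
        simp [rowArray_of_le hc]
  rw [e1]
  refine sum_congr rfl fun c _ => ?_
  split_ifs with hk
  · obtain ⟨i, hi⟩ := (hc.exists_eq_iff c (k + 1)).2 ((mem_colUnion_of_excess h0).1 hk)
    rw [Finset.sum_eq_single i]
    · simp [hi]
    · intro j _ hj
      rw [if_neg fun hj' => hj (ha.inj j i c (by omega) (by omega))]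
    · simp
  · refine sum_eq_zero fun i _ => if_neg fun hi => hk ?_
    exact (mem_colUnion_of_excess h0).2 ((hc.exists_eq_iff c (k + 1)).1 ⟨i, hi⟩)

theorem SameData.of_excess {n : ℕ} {a b : Fin n → ℕ} {T : SetFilling a} {T' : SetFilling b}
    (h : excess T = 0) (h' : excess T' = 0) (hc : SameColumns (tops T) (tops T')) :
    SameData T T' := by
  refine ⟨hc, fun c => ?_⟩
  ext k
  rw [mem_colUnion_of_excess h, mem_colUnion_of_excess h', hc.exists_eq_iff]

open Classical in
theorem specializeZero_quasiLascoux {n : ℕ} (a : Fin n → ℕ) :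
    specializeZero (quasiLascoux a) = quasikey a := by
  rw [quasiLascoux, map_sum]
  simp only [lascouxAtom, map_sum, specializeZero_betaMonomial, ← sum_filter, filter_filter]
  rw [Finset.sum_sigma', quasikey]
  symm
  refine sum_eq_of_rel _ _ (fun f p => SameColumns (rowArray f) (tops p.2)) ?_ ?_ ?_ ?_ ?_
  · intro f hf
    obtain ⟨b, hb, T, hT, h0, hc⟩ := ((isQuasiKohnert_iff f).1 (mem_filter.1 hf).2).exists_atom
      (hasShape_rowArray f) (rowArray_le f)
    exact ⟨⟨b, T⟩, by simpa using ⟨hb, hT, h0⟩, hc⟩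
  · rintro ⟨b, T⟩ hT
    simp only [mem_sigma, Set.Finite.mem_toFinset, mem_filter, mem_univ, true_and] at hT
    obtain ⟨z, hz, hs, hc⟩ := hT.2.1.exists_kohnertArray hT.1
    obtain ⟨f, rfl⟩ := exists_rowArray hs fun i c => by
      obtain ⟨π, hπ⟩ := hc.symm c
      rw [hπ]; exact top_le _
    exact ⟨f, by simpa using (isQuasiKohnert_iff f).2 hz, hc⟩
  · intro f hf f' hf' p _ h h'
    have := ((isQuasiKohnert_iff f).1 (mem_filter.1 hf).2).ext
      ((isQuasiKohnert_iff f').1 (mem_filter.1 hf').2) (hasShape_rowArray f) (hasShape_rowArray f')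
      (h.trans h'.symm)
    funext i c
    have := congrFun₂ this i c
    rw [rowArray_of_lt c.2, rowArray_of_lt c.2] at this
    exact Fin.ext (by simpa using this)
  · rintro f - ⟨b, T⟩ hT ⟨b₁, T₁⟩ hT₁ h h'
    simp only [mem_sigma, Set.Finite.mem_toFinset, mem_filter, mem_univ, true_and] at hT hT₁
    exact hT.2.1.sigma_ext hT₁.2.1 (SameData.of_excess hT.2.2 hT₁.2.2 (h.symm.trans h'))
  · rintro f hf ⟨b, T⟩ hT h
    simp only [mem_sigma, Set.Finite.mem_toFinset, mem_filter, mem_univ, true_and] at hT hf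
    rw [prod_X_rows]
    refine congrArg (fun w => MvPolynomial.monomial (Finsupp.equivFunOnFinite.symm w) (1 : ℤ))
      (funext fun k => ?_)
    exact sum_rows_eq_wt hf hT.2.1.semistandard hT.2.2 h k

/-! ### Glides -/

/-- The sum of the values of `f` at the first `e` positions. -/
def sumBelow {n : ℕ} (f : Fin n → ℕ) (e : ℕ) : ℕ := ∑ k ∈ univ.filter fun k : Fin n => (k : ℕ) < e, f k

theorem sumBelow_zero {n : ℕ} (f : Fin n → ℕ) : sumBelow f 0 = 0 := by simp [sumBelow]

theorem sumBelow_succ {n : ℕ} (f : Fin n → ℕ) (k : Fin n) :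
    sumBelow f (k + 1) = sumBelow f k + f k := by
  have : ({i | (i : ℕ) < k + 1} : Finset (Fin n)) = insert k ({i | (i : ℕ) < k} : Finset (Fin n)) := by
    ext i
    simp only [mem_filter, mem_univ, true_and, mem_insert, Fin.ext_iff]
    omega
  rw [sumBelow, this, sum_insert (by simp), add_comm, sumBelow]

theorem sumBelow_add_block {n : ℕ} (f : Fin n → ℕ) {s t : ℕ} (h : s ≤ t) :
    sumBelow f s + ∑ k ∈ block n s t, f k = sumBelow f t := by
  rw [sumBelow, sumBelow, block, ← sum_union]
  · refine sum_congr (ext fun i => ?_) fun _ _ => rfl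
    simp only [mem_union, mem_filter, mem_univ, true_and]
    omega
  · refine disjoint_left.2 fun i => ?_
    simp only [mem_filter, mem_univ, true_and]
    omega

theorem sumBelow_mono {n : ℕ} (f : Fin n → ℕ) {s t : ℕ} (h : s ≤ t) : sumBelow f s ≤ sumBelow f t := by
  rw [← sumBelow_add_block f h]; exact Nat.le_add_right _ _

theorem sumBelow_eq_iff {n : ℕ} (f : Fin n → ℕ) {s t : ℕ} (h : s ≤ t) :
    sumBelow f s = sumBelow f t ↔ ∀ k : Fin n, s ≤ k → (k : ℕ) < t → f k = 0 := by
  rw [← sumBelow_add_block f h, left_eq_add, sum_eq_zero_iff]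
  simp [block]

theorem sumBelow_congr {n : ℕ} {f g : Fin n → ℕ} {e : ℕ} (h : ∀ k : Fin n, (k : ℕ) < e → f k = g k) :
    sumBelow f e = sumBelow g e :=
  sum_congr rfl fun k hk => h k (mem_filter.1 hk).2

theorem sumBelow_lt {n : ℕ} {f : Fin n → ℕ} {s t : ℕ} (k : Fin n) (h1 : s ≤ k) (h2 : (k : ℕ) < t)
    (h3 : f k ≠ 0) : sumBelow f s < sumBelow f t :=
  lt_of_le_of_ne (sumBelow_mono f (by omega)) fun h =>
    h3 ((sumBelow_eq_iff f (by omega)).1 h k h1 h2)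

theorem sumBelow_update {n : ℕ} (f : Fin n → ℕ) (i : Fin n) (x : ℕ) (e : ℕ) :
    sumBelow (Function.update f i x) e + (if (i : ℕ) < e then f i else 0) =
      sumBelow f e + if (i : ℕ) < e then x else 0 := by
  split_ifs with h
  · rw [sumBelow, sumBelow, sum_update_of_mem (mem_filter.2 ⟨mem_univ i, h⟩),
      ← add_sum_erase _ f (show i ∈ ({k | (k : ℕ) < e} : Finset (Fin n)) by simpa using h),
      sdiff_singleton_eq_erase]
    ring
  · rw [add_zero, add_zero]
    refine sumBelow_congr fun k hk => Function.update_of_ne ?_ _ _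
    rintro rfl; exact h hk

/-- The parts of a weak komposition, with red parts diminished by one. -/
def net {n : ℕ} (b : Fin n → ℕ) (R : Finset (Fin n)) (k : Fin n) : ℕ := b k - if k ∈ R then 1 else 0

/-- The leftmost nonzero part from position `e` on, if any, is black. -/
def BlackFrom {n : ℕ} (b : Fin n → ℕ) (R : Finset (Fin n)) (e : ℕ) : Prop :=
  ∀ k : Fin n, e ≤ k → b k ≠ 0 → (∀ k' : Fin n, e ≤ k' → k' < k → b k' = 0) → k ∉ R

theorem exists_first {n : ℕ} {b : Fin n → ℕ} {e : ℕ} {k : Fin n} (h : e ≤ k) (hk : b k ≠ 0) :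
    ∃ k₀ : Fin n, e ≤ k₀ ∧ k₀ ≤ k ∧ b k₀ ≠ 0 ∧ ∀ k' : Fin n, e ≤ k' → k' < k₀ → b k' = 0 := by
  obtain ⟨k₀, h1, h2⟩ := exists_min_image ({k | e ≤ (k : ℕ) ∧ b k ≠ 0} : Finset (Fin n)) id
    ⟨k, by simpa using ⟨h, hk⟩⟩
  simp only [mem_filter, mem_univ, true_and, id_eq] at h1 h2
  refine ⟨k₀, h1.1, h2 k ⟨h, hk⟩, h1.2, fun k' hk' hlt => ?_⟩
  by_contra hne
  exact absurd (h2 k' ⟨hk', hne⟩) (not_le.2 hlt)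

/-- A black nonzero part contributes to the net sum. If the net sum does not grow, the first nonzero
part, and with it every part, is missing. -/
theorem BlackFrom.eq_zero {n : ℕ} {b : Fin n → ℕ} {R : Finset (Fin n)} {e t : ℕ}
    (h : BlackFrom b R e) (het : sumBelow (net b R) e = sumBelow (net b R) t) {k : Fin n}
    (hk : e ≤ k) (hkt : (k : ℕ) < t) : b k = 0 := by
  by_contra hne
  obtain ⟨k₀, h1, h2, h3, h4⟩ := exists_first hk hne
  rw [Fin.le_def] at h2
  refine absurd het (ne_of_lt (sumBelow_lt k₀ h1 (by omega) ?_))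
  simp [net, h k₀ h1 h3 h4, h3]

theorem net_add {n : ℕ} {b : Fin n → ℕ} {R : Finset (Fin n)} (h : ∀ k ∈ R, 0 < b k)
    (s : Finset (Fin n)) : ∑ k ∈ s, net b R k + (R ∩ s).card = ∑ k ∈ s, b k := by
  have h1 : (R ∩ s).card = ∑ k ∈ s, if k ∈ R then 1 else 0 := by
    rw [inter_comm, ← filter_mem_eq_inter, card_filter]
  rw [h1, ← sum_add_distrib]
  refine sum_congr rfl fun k _ => ?_
  have := h k
  by_cases hk : k ∈ R
  · have := h k hk
    simp only [net, hk, if_true]; omega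
  · simp [net, hk]

/-- Glides in terms of partial sums. -/
structure IsGlideSum {n : ℕ} (a b : Fin n → ℕ) (R : Finset (Fin n)) : Prop where
  pos : ∀ k ∈ R, 0 < b k
  total : sumBelow (net b R) n = sumBelow a n
  cut : ∀ p ≤ n, ∃ e ≤ p, sumBelow (net b R) e = sumBelow a p ∧ BlackFrom b R e

theorem sumBelow_eq_nonzero {n : ℕ} (a : Fin n → ℕ) (p q : ℕ)
    (h : ∀ j, ((nonzeroPositions a).orderEmbOfFin rfl j : ℕ) < p ↔ (j : ℕ) < q) :
    sumBelow a p = sumBelow (fun j => a ((nonzeroPositions a).orderEmbOfFin rfl j)) q := by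
  rw [sumBelow, sumBelow]
  symm
  refine sum_of_injOn ((nonzeroPositions a).orderEmbOfFin rfl)
    (fun _ _ _ _ h => ((nonzeroPositions a).orderEmbOfFin rfl).injective h) ?_ ?_ fun _ _ => rfl
  · intro j hj
    simpa [h] using hj
  · intro k hk hk'
    by_contra hne
    have h1 : k ∈ Set.range ((nonzeroPositions a).orderEmbOfFin rfl) := by
      rw [range_orderEmbOfFin]; simpa [nonzeroPositions] using hne
    obtain ⟨j, rfl⟩ := h1
    refine hk' ⟨j, ?_, rfl⟩
    simpa [h] using hk

/-- The cut for `p` is the end of the last block belonging to a nonzero position before `p`. Every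
block has a positive net sum, hence a nonzero part, so blackness within a block is the same as
blackness of the whole tail; after the last block the tail is zero. -/
theorem IsGlide.isGlideSum {n : ℕ} {a b : Fin n → ℕ} {R : Finset (Fin n)} (h : IsGlide a b R) :
    IsGlideSum a b R := by
  obtain ⟨hpos, e, he, he0, hb, hlast⟩ := h
  set P := (nonzeroPositions a).orderEmbOfFin rfl with hP
  have hmem : ∀ j, a (P j) ≠ 0 := fun j => by
    exact (mem_filter.1 (orderEmbOfFin_mem (nonzeroPositions a) rfl j)).2
  have hblock : ∀ j : Fin (nonzeroPositions a).card,
      ∑ k ∈ block n (e j.castSucc) (e j.succ), net b R k = a (P j) := fun j => by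
    have h1 := (hb j).1
    have h2 := net_add hpos (block n (e j.castSucc) (e j.succ))
    omega
  have hsum : ∀ j : Fin ((nonzeroPositions a).card + 1),
      sumBelow (net b R) (e j) = sumBelow (fun j => a (P j)) j := by
    intro j
    induction j using Fin.induction with
    | zero => simp [he0, sumBelow_zero]
    | succ j ih =>
      rw [← sumBelow_add_block _ (he (Fin.castSucc_lt_succ (i := j))).le, ih, hblock, Fin.val_succ,
        sumBelow_succ, Fin.val_castSucc]
  have hblack : ∀ j, BlackFrom b R (e j) := by
    intro j
    induction j using Fin.lastCases with
    | last => exact fun k hk hk' => absurd (hlast k hk) hk'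
    | cast j =>
      intro k hk hk' hmin
      refine (hb j).2.2 k ?_ hk' fun k' hk1 hlt => hmin k' ?_ hlt
      · simp only [block, mem_filter, mem_univ, true_and]
        refine ⟨hk, ?_⟩
        by_contra hge
        refine hmem j ?_
        rw [← hblock j]
        refine sum_eq_zero fun k' hk1 => ?_
        simp only [block, mem_filter, mem_univ, true_and] at hk1
        simp [net, hmin k' hk1.1 (by rw [Fin.lt_def]; omega)]
      · simp only [block, mem_filter, mem_univ, true_and] at hk1
        exact hk1.1
  have hcount : ∀ p, ∃ q : Fin ((nonzeroPositions a).card + 1), ∀ j, (P j : ℕ) < p ↔ (j : ℕ) < q := by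
    intro p
    refine ⟨⟨#{j | (P j : ℕ) < p}, Nat.lt_succ_of_le ((card_filter_le _ _).trans (by simp))⟩, ?_⟩
    intro j
    have hmono : ∀ i i', i ≤ i' → (P i : ℕ) ≤ P i' := fun i i' h => by
      have := P.monotone h
      exact this
    constructor
    · intro hj
      have : #(Iic j) ≤ #{j | (P j : ℕ) < p} := card_le_card fun i hi => by
        have := hmono i j (mem_Iic.1 hi)
        simp only [mem_filter, mem_univ, true_and]; omega
      rw [Fin.card_Iic] at this
      exact this
    · intro hj
      by_contra hge
      have : #{j | (P j : ℕ) < p} ≤ #(Iio j) := card_le_card fun i hi => by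
        simp only [mem_filter, mem_univ, true_and] at hi
        rw [mem_Iio]
        by_contra hle
        have := hmono j i (not_lt.1 hle)
        omega
      rw [Fin.card_Iio] at this
      exact absurd hj (not_lt.2 this)
  have hle : ∀ j, e j ≤ n := by
    intro j
    induction j using Fin.cases with
    | zero => omega
    | succ j => have := (hb j).2.1; have := (P j).2; omega
  refine ⟨hpos, ?_, fun p _ => ?_⟩
  · obtain ⟨q, hq⟩ := hcount n
    have h1 : (q : ℕ) = (nonzeroPositions a).card := by
      by_contra hne
      have := (hq ⟨q, by omega⟩).1 (Fin.is_lt _)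
      simp at this
    rw [sumBelow_eq_nonzero a n q hq, h1]
    have h2 := hsum (Fin.last _)
    rw [Fin.val_last] at h2
    rw [← h2]
    exact ((sumBelow_eq_iff _ (hle _)).2 fun k hk _ => by simp [net, hlast k hk]).symm
  · obtain ⟨q, hq⟩ := hcount p
    refine ⟨e q, ?_, (hsum q).trans (sumBelow_eq_nonzero a p q hq).symm, hblack q⟩
    induction q using Fin.cases with
    | zero => omega
    | succ j =>
      have h1 := (hq j).2 (by simp)
      have h2 := (hb j).2.1
      omega

/-- The block ends are the cuts just behind the nonzero positions of `a`; they increase strictly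
because the net sums up to them do. -/
theorem IsGlideSum.isGlide {n : ℕ} {a b : Fin n → ℕ} {R : Finset (Fin n)} (h : IsGlideSum a b R) :
    IsGlide a b R := by
  set P := (nonzeroPositions a).orderEmbOfFin rfl with hP
  have hmem : ∀ j, a (P j) ≠ 0 := fun j => by
    exact (mem_filter.1 (orderEmbOfFin_mem (nonzeroPositions a) rfl j)).2
  have hex : ∀ j : Fin ((nonzeroPositions a).card + 1), ∃ e,
      sumBelow (net b R) e = sumBelow (fun j => a (P j)) j ∧ BlackFrom b R e ∧
        (j = 0 → e = 0) ∧ ∀ i, j = Fin.succ i → e ≤ P i + 1 := by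
    intro j
    induction j using Fin.cases with
    | zero =>
      obtain ⟨e, he, h1, h2⟩ := h.cut 0 (Nat.zero_le _)
      obtain rfl : e = 0 := by omega
      exact ⟨0, by simp [sumBelow_zero], h2, fun _ => rfl, fun i hi => by simp⟩
    | succ j =>
      obtain ⟨e, he, h1, h2⟩ := h.cut (P j + 1) (P j).2
      refine ⟨e, ?_, h2, fun h0 => absurd h0 (Fin.succ_ne_zero j), fun i hi => ?_⟩
      · rw [h1]
        refine sumBelow_eq_nonzero a _ _ fun i => ?_
        have h3 : P i ≤ P j ↔ i ≤ j := P.le_iff_le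
        rw [Fin.le_def, Fin.le_def] at h3
        rw [Fin.val_succ, Nat.lt_succ_iff, Nat.lt_succ_iff]
        exact h3
      · obtain rfl := Fin.succ_injective _ hi
        exact he
  choose e h1 h2 h3 h4 using hex
  have hmono : StrictMono e := by
    refine Fin.strictMono_iff_lt_succ.2 fun j => ?_
    by_contra hle
    have h5 := sumBelow_mono (net b R) (not_lt.1 hle)
    rw [h1, h1, Fin.val_succ, sumBelow_succ, Fin.val_castSucc] at h5
    have := hmem j
    omega
  refine ⟨h.pos, e, hmono, h3 0 rfl, fun j => ⟨?_, h4 _ j rfl, fun k hk hk' hmin => ?_⟩, fun k hk => ?_⟩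
  · have h5 := net_add h.pos (block n (e j.castSucc) (e j.succ))
    have h6 := sumBelow_add_block (net b R) (hmono (Fin.castSucc_lt_succ (i := j))).le
    rw [h1, h1, Fin.val_succ, sumBelow_succ, Fin.val_castSucc] at h6
    change a (P j) + _ = _
    omega
  · simp only [block, mem_filter, mem_univ, true_and] at hk hmin
    refine h2 j.castSucc k hk.1 hk' fun k' hk1 hlt => hmin k' ⟨hk1, ?_⟩ hlt
    rw [Fin.lt_def] at hlt; omega
  · refine (h2 (Fin.last _)).eq_zero (t := n) ?_ hk k.2
    rw [h1, h.total, Fin.val_last]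
    refine (sumBelow_eq_nonzero a _ _ fun j => ?_).symm
    simp

theorem isGlide_iff {n : ℕ} {a b : Fin n → ℕ} {R : Finset (Fin n)} :
    IsGlide a b R ↔ IsGlideSum a b R := ⟨IsGlide.isGlideSum, IsGlideSum.isGlide⟩

/-! ### Recursion for glide polynomials -/

open Classical in
/-- The glides of `w` that agree with `w`, without red parts, before position `m`. -/
def glidesFrom {n : ℕ} (m : ℕ) (w : Fin n → ℕ) : Finset ((Fin n → ℕ) × Finset (Fin n)) :=
  {p ∈ (finite_glides w).toFinset | ∀ k : Fin n, (k : ℕ) < m → p.1 k = w k ∧ k ∉ p.2}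

theorem mem_glidesFrom {n : ℕ} {m : ℕ} {w b : Fin n → ℕ} {R : Finset (Fin n)} :
    (b, R) ∈ glidesFrom m w ↔
      IsGlideSum w b R ∧ ∀ k : Fin n, (k : ℕ) < m → b k = w k ∧ k ∉ R := by
  simp [glidesFrom, isGlide_iff]

/-- The generating function of the glides of `w` that agree with `w` before position `m`. -/
def glideFrom {n : ℕ} (m : ℕ) (w : Fin n → ℕ) : PolyBeta n :=
  ∑ p ∈ glidesFrom m w, betaMonomial p.2.card p.1

theorem glideFrom_zero {n : ℕ} (w : Fin n → ℕ) : glideFrom 0 w = glide w := by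
  rw [glideFrom, glide]
  refine sum_congr (ext fun p => ?_) fun _ _ => rfl
  simp [glidesFrom]

theorem glideFrom_self {n : ℕ} (w : Fin n → ℕ) : glideFrom n w = betaMonomial 0 w := by
  have : glidesFrom n w = {(w, ∅)} := by
    ext ⟨b, R⟩
    rw [mem_glidesFrom, mem_singleton, Prod.mk.injEq]
    constructor
    · rintro ⟨-, h⟩
      exact ⟨funext fun k => (h k k.2).1, eq_empty_iff_forall_notMem.2 fun k => (h k k.2).2⟩
    · rintro ⟨rfl, rfl⟩
      have hn : net b ∅ = b := by funext k; simp [net]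
      refine ⟨⟨by simp, by rw [hn], fun p _ => ⟨p, le_rfl, by rw [hn], fun _ _ _ _ => by simp⟩⟩, ?_⟩
      simp
  rw [glideFrom, this, sum_singleton, card_empty]

theorem sumBelow_net_of_agree {n : ℕ} {m : ℕ} {w b : Fin n → ℕ} {R : Finset (Fin n)}
    (h : ∀ k : Fin n, (k : ℕ) < m → b k = w k ∧ k ∉ R) {e : ℕ} (he : e ≤ m) :
    sumBelow (net b R) e = sumBelow w e :=
  sumBelow_congr fun k hk => by
    have := h k (by omega)
    simp [net, this.1, this.2]

theorem BlackFrom.of_le {n : ℕ} {b : Fin n → ℕ} {R : Finset (Fin n)} {e t : ℕ}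
    (h : BlackFrom b R e) (het : e ≤ t) (hn : sumBelow (net b R) e = sumBelow (net b R) t) :
    BlackFrom b R t := by
  intro k hk hk' hmin
  refine h k (by omega) hk' fun k' hk1 hlt => ?_
  by_cases hkt : (k' : ℕ) < t
  · exact h.eq_zero hn hk1 hkt
  · exact hmin k' (by omega) hlt

theorem IsGlideSum.blackFrom {n : ℕ} {m : ℕ} {w b : Fin n → ℕ} {R : Finset (Fin n)}
    (hg : IsGlideSum w b R) (h : ∀ k : Fin n, (k : ℕ) < m → b k = w k ∧ k ∉ R) (hm : m ≤ n) :
    BlackFrom b R m := by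
  obtain ⟨e, he, h1, h2⟩ := hg.cut m hm
  exact h2.of_le he (by rw [h1, sumBelow_net_of_agree h le_rfl])

theorem IsGlideSum.notMem {n : ℕ} {m : Fin n} {w b : Fin n → ℕ} {R : Finset (Fin n)}
    (hg : IsGlideSum w b R) (h : ∀ k : Fin n, (k : ℕ) < m → b k = w k ∧ k ∉ R) : m ∉ R := fun hR =>
  hg.blackFrom h m.2.le m le_rfl (hg.pos m hR).ne' (fun k' h1 h2 => by
    rw [Fin.lt_def] at h2; omega) hR

theorem glideFrom_eq_succ_of_forced {n : ℕ} {m : Fin n} {w : Fin n → ℕ}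
    (h : ∀ b R, IsGlideSum w b R → (∀ k : Fin n, (k : ℕ) < m → b k = w k ∧ k ∉ R) → b m = w m) :
    glideFrom m w = glideFrom (m + 1) w := by
  rw [glideFrom, glideFrom]
  refine sum_congr (ext ?_) fun _ _ => rfl
  rintro ⟨b, R⟩
  rw [mem_glidesFrom, mem_glidesFrom]
  refine and_congr_right fun hg => ⟨fun hb k hk => ?_, fun hb k hk => hb k (by omega)⟩
  rcases Nat.lt_succ_iff_lt_or_eq.1 hk with hk | hk
  · exact hb k hk
  · obtain rfl : k = m := Fin.ext hk
    exact ⟨h b R hg hb, hg.notMem hb⟩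

/-- The cut for `m + 1` must lie at `m + 1`, since the net sum of `b` up to `m` is still too small;
so `b m` is forced. -/
theorem glideFrom_of_ne_zero {n : ℕ} {m : Fin n} {w : Fin n → ℕ} (hw : w m ≠ 0) :
    glideFrom m w = glideFrom (m + 1) w := by
  refine glideFrom_eq_succ_of_forced fun b R hg hb => ?_
  obtain ⟨e, he, h1, -⟩ := hg.cut (m + 1) m.2
  rw [sumBelow_succ, ← sumBelow_net_of_agree hb le_rfl] at h1
  obtain rfl : e = m + 1 := by
    by_contra hne
    have := sumBelow_mono (net b R) (show e ≤ m by omega)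
    omega
  rw [sumBelow_succ] at h1
  have := hg.notMem hb
  simp only [net, this, if_false] at h1
  omega

/-- The full net sum is reached before position `m`, which leaves nothing for `b m`. -/
theorem glideFrom_of_eq_zero {n : ℕ} {m : Fin n} {w : Fin n → ℕ} (hw : ∀ k, m ≤ k → w k = 0) :
    glideFrom m w = glideFrom (m + 1) w := by
  refine glideFrom_eq_succ_of_forced fun b R hg hb => ?_
  have h1 : sumBelow w m = sumBelow w n := (sumBelow_eq_iff w m.2.le).2 fun k hk _ => hw k hk
  rw [← hg.total, ← sumBelow_net_of_agree hb le_rfl, sumBelow_eq_iff _ m.2.le] at h1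
  have h2 := h1 m le_rfl m.2
  have := hg.notMem hb
  simp only [net, this, if_false] at h2
  rw [hw m le_rfl]
  omega

/-! ### Splitting off a part at a vacant position -/

/-- Move `s` units from position `v` to position `m`, with `ε` additional units left at `v`. -/
def shiftPart {n : ℕ} (w : Fin n → ℕ) (m v : Fin n) (s ε : ℕ) : Fin n → ℕ :=
  Function.update (Function.update w m s) v (w v - s + ε)

theorem shiftPart_of_ne {n : ℕ} {w : Fin n → ℕ} {m v : Fin n} {s ε : ℕ} {k : Fin n} (h1 : k ≠ m)
    (h2 : k ≠ v) : shiftPart w m v s ε k = w k := by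
  rw [shiftPart, Function.update_of_ne h2, Function.update_of_ne h1]

theorem shiftPart_left {n : ℕ} {w : Fin n → ℕ} {m v : Fin n} {s ε : ℕ} (h : m < v) :
    shiftPart w m v s ε m = s := by
  rw [shiftPart, Function.update_of_ne h.ne, Function.update_self]

theorem shiftPart_right {n : ℕ} {w : Fin n → ℕ} {m v : Fin n} {s ε : ℕ} :
    shiftPart w m v s ε v = w v - s + ε := by
  rw [shiftPart, Function.update_self]

theorem sumBelow_shiftPart {n : ℕ} {w : Fin n → ℕ} {m v : Fin n} {s ε : ℕ} (h : m < v)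
    (hw : w m = 0) (hs : s ≤ w v) (p : ℕ) : sumBelow (shiftPart w m v s ε) p =
      sumBelow w p + if (v : ℕ) < p then ε else if (m : ℕ) < p then s else 0 := by
  have h1 := sumBelow_update (Function.update w m s) v (w v - s + ε) p
  have h2 := sumBelow_update w m s p
  rw [Function.update_of_ne h.ne'] at h1
  rw [hw] at h2
  rw [shiftPart]
  rw [Fin.lt_def] at h
  split_ifs at * <;> omega

/-- `k` is the first nonzero position of `b` from position `e` on. -/
def IsFirst {n : ℕ} (b : Fin n → ℕ) (e : ℕ) (k : Fin n) : Prop :=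
  e ≤ k ∧ b k ≠ 0 ∧ ∀ k' : Fin n, e ≤ k' → k' < k → b k' = 0

theorem IsFirst.unique {n : ℕ} {b : Fin n → ℕ} {e : ℕ} {k k' : Fin n} (h : IsFirst b e k)
    (h' : IsFirst b e k') : k = k' := by
  refine le_antisymm (not_lt.1 fun hlt => ?_) (not_lt.1 fun hlt => ?_)
  · exact h'.2.1 (h.2.2 k' h'.1 hlt)
  · exact h.2.1 (h'.2.2 k h.1 hlt)

theorem sumBelow_net_erase {n : ℕ} {b : Fin n → ℕ} {R : Finset (Fin n)} {k : Fin n} (hk : k ∈ R)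
    (hb : b k ≠ 0) (e : ℕ) :
    sumBelow (net b (R.erase k)) e = sumBelow (net b R) e + if (k : ℕ) < e then 1 else 0 := by
  have h1 : net b (R.erase k) = Function.update (net b R) k (net b R k + 1) := by
    funext x
    by_cases hx : x = k
    · subst hx
      rw [Function.update_self]
      simp only [net, hk, notMem_erase, if_true, if_false]
      omega
    · rw [Function.update_of_ne hx]
      simp [net, mem_erase, hx]
  have h2 := sumBelow_update (net b R) k (net b R k + 1) e
  rw [h1]
  split_ifs at * <;> omega

theorem BlackFrom.mono {n : ℕ} {b : Fin n → ℕ} {R R' : Finset (Fin n)} (h : R' ⊆ R) {e : ℕ}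
    (hb : BlackFrom b R e) : BlackFrom b R' e :=
  fun k hk hk' hmin hR => hb k hk hk' hmin (h hR)

section Shift

variable {n : ℕ} {m v : Fin n} {w b : Fin n → ℕ} {R : Finset (Fin n)}

theorem sumBelow_eq_of_gap (h0 : ∀ k, m ≤ k → k < v → w k = 0) {p : ℕ} (h1 : (m : ℕ) ≤ p)
    (h2 : p ≤ v) : sumBelow w p = sumBelow w m :=
  ((sumBelow_eq_iff w h1).2 fun k hk hk' => h0 k hk (by rw [Fin.lt_def]; omega)).symm

theorem add_le_sumBelow (hv : m < v) (h0 : ∀ k, m ≤ k → k < v → w k = 0) {p : ℕ}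
    (h : (v : ℕ) < p) : sumBelow w m + w v ≤ sumBelow w p := by
  rw [Fin.lt_def] at hv
  rw [← sumBelow_eq_of_gap h0 hv.le le_rfl, ← sumBelow_succ]
  exact sumBelow_mono w h

theorem lt_cut (hv : m < v)
    (h0 : ∀ k, m ≤ k → k < v → w k = 0) (hwv : w v ≠ 0)
    (hb : ∀ k : Fin n, (k : ℕ) < m → b k = w k ∧ k ∉ R) {p e : ℕ} (hp : (v : ℕ) < p)
    (he : sumBelow (net b R) e = sumBelow w p) : (m : ℕ) < e := by
  by_contra hle
  have h1 := add_le_sumBelow hv h0 hp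
  have h2 := sumBelow_mono (net b R) (not_lt.1 hle)
  rw [sumBelow_net_of_agree hb le_rfl] at h2
  omega

theorem IsGlideSum.sumBelow_succ (hg : IsGlideSum w b R)
    (hb : ∀ k : Fin n, (k : ℕ) < m → b k = w k ∧ k ∉ R) :
    sumBelow (net b R) (m + 1) = sumBelow w m + b m := by
  rw [QuasiLascoux.sumBelow_succ, sumBelow_net_of_agree hb le_rfl]
  simp [net, hg.notMem hb]

theorem IsGlideSum.le_part (hg : IsGlideSum w b R) (hv : m < v)
    (h0 : ∀ k, m ≤ k → k < v → w k = 0) (hwv : w v ≠ 0)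
    (hb : ∀ k : Fin n, (k : ℕ) < m → b k = w k ∧ k ∉ R) : b m ≤ w v := by
  obtain ⟨e, -, h1, -⟩ := hg.cut (v + 1) v.2
  have h2 := sumBelow_mono (net b R) (lt_cut hv h0 hwv hb (Nat.lt_succ_self _) h1)
  rw [h1, Nat.succ_eq_add_one, hg.sumBelow_succ hb, QuasiLascoux.sumBelow_succ w v,
    sumBelow_eq_of_gap h0 (le_of_lt hv) le_rfl] at h2
  omega

/-- Covers both uses: `R' = R` with `ε = 0`, and `R'` without one red part beyond `m` with `ε = 1`.
Cuts for `p ≤ m` and for `p` beyond `v` are kept; for `p` in between the cut is placed right after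
the part `b m`. -/
theorem IsGlideSum.shift {R' : Finset (Fin n)} {ε : ℕ} (hg : IsGlideSum w b R) (hv : m < v)
    (h0 : ∀ k, m ≤ k → k < v → w k = 0) (hwv : w v ≠ 0)
    (hb : ∀ k : Fin n, (k : ℕ) < m → b k = w k ∧ k ∉ R) (hR : R' ⊆ R)
    (h1 : ∀ e ≤ (m : ℕ) + 1, sumBelow (net b R') e = sumBelow (net b R) e)
    (h2 : ∀ e, (m : ℕ) < e → BlackFrom b R e →
      sumBelow (net b R') e = sumBelow (net b R) e + ε)
    (h3 : sumBelow (net b R') n = sumBelow (net b R) n + ε) (h4 : BlackFrom b R' (m + 1)) :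
    IsGlideSum (shiftPart w m v (b m) ε) b R' := by
  have hs := hg.le_part hv h0 hwv hb
  have hA := sumBelow_shiftPart (ε := ε) hv (h0 m le_rfl hv) hs
  refine ⟨fun k hk => hg.pos k (hR hk), ?_, fun p hp => ?_⟩
  · rw [hA, if_pos v.2, h3, hg.total]
  · rw [hA]
    rcases le_or_gt p m with hpm | hpm
    · obtain ⟨e, he, h5, h6⟩ := hg.cut p hp
      refine ⟨e, he, ?_, h6.mono hR⟩
      rw [Fin.lt_def] at hv
      rw [if_neg (by omega), if_neg (by omega), h1 e (by omega), h5, add_zero]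
    rcases le_or_gt p v with hpv | hpv
    · refine ⟨m + 1, hpm, ?_, h4⟩
      rw [if_neg (by omega), if_pos hpm, h1 _ le_rfl, hg.sumBelow_succ hb,
        sumBelow_eq_of_gap h0 hpm.le hpv]
    · obtain ⟨e, he, h5, h6⟩ := hg.cut p hp
      refine ⟨e, he, ?_, h6.mono hR⟩
      rw [if_pos hpv, h2 e (lt_cut hv h0 hwv hb hpv h5) h6, h5]

/-- The inverse of `IsGlideSum.shift`. For `p` strictly after `m` and up to `v`, the cut is `m`, in
front of the black part `s`. -/
theorem IsGlideSum.unshift {R' : Finset (Fin n)} {s ε : ℕ}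
    (hg : IsGlideSum (shiftPart w m v s ε) b R') (hv : m < v)
    (h0 : ∀ k, m ≤ k → k < v → w k = 0) (hs0 : s ≠ 0) (hs : s ≤ w v)
    (hb : ∀ k : Fin n, (k : ℕ) < m + 1 → b k = shiftPart w m v s ε k ∧ k ∉ R')
    (hpos : ∀ k ∈ R, 0 < b k) (hR : ∀ k ≤ m, k ∈ R ↔ k ∈ R')
    (h2 : ∀ e, sumBelow (net b R') (m + 1) + ε ≤ sumBelow (net b R') e → (m : ℕ) < e →
      BlackFrom b R' e → sumBelow (net b R) e + ε = sumBelow (net b R') e ∧ BlackFrom b R e)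
    (h3 : sumBelow (net b R') n = sumBelow (net b R) n + ε) :
    IsGlideSum w b R := by
  have hA := sumBelow_shiftPart (ε := ε) hv (h0 m le_rfl hv) hs
  have hbm : b m = s := by rw [(hb m (Nat.lt_succ_self _)).1, shiftPart_left hv]
  have h1 : ∀ e ≤ (m : ℕ) + 1, sumBelow (net b R) e = sumBelow (net b R') e := fun e he =>
    sumBelow_congr fun k hk => by
      have := hR k (by rw [Fin.le_def]; omega)
      simp only [net, this]
  have hvv : (m : ℕ) < v := hv
  have hN : sumBelow (net b R') (m + 1) = sumBelow w m + s := by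
    rw [sumBelow_net_of_agree hb le_rfl, hA, if_neg (by omega), if_pos (Nat.lt_succ_self _),
      sumBelow_eq_of_gap h0 (Nat.le_succ _) hv]
  have hmR : m ∉ R := by rw [hR m le_rfl]; exact (hb m (Nat.lt_succ_self _)).2
  refine ⟨hpos, ?_, fun p hp => ?_⟩
  · have := hg.total
    rw [hA, if_pos v.2] at this
    omega
  · rcases le_or_gt p m with hpm | hpm
    · obtain ⟨e, he, h5, h6⟩ := hg.cut p hp
      refine ⟨e, he, ?_, fun k hk hk' hmin => ?_⟩
      · rw [hA, if_neg (by omega), if_neg (by omega), add_zero] at h5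
        rw [h1 e (by omega), h5]
      · have hkm : k ≤ m := not_lt.1 fun hlt => hs0 (by rw [← hbm]; exact hmin m (by omega) hlt)
        rw [hR k hkm]
        exact h6 k hk hk' hmin
    rcases le_or_gt p v with hpv | hpv
    · refine ⟨m, hpm.le, ?_, fun k hk hk' hmin => ?_⟩
      · rw [sumBelow_eq_of_gap h0 hpm.le hpv, h1 m (Nat.le_succ _),
          sumBelow_net_of_agree hb (Nat.le_succ _), hA, if_neg (by omega), if_neg (by omega), add_zero]
      · have hkm : k ≤ m := not_lt.1 fun hlt => hs0 (by rw [← hbm]; exact hmin m le_rfl hlt)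
        obtain rfl : k = m := le_antisymm hkm hk
        exact hmR
    · obtain ⟨e, he, h5, h6⟩ := hg.cut p hp
      rw [hA, if_pos hpv] at h5
      have h7 := add_le_sumBelow hv h0 hpv
      have hme : (m : ℕ) < e := by
        by_contra hle
        have h8 := sumBelow_mono (net b R') (not_lt.1 hle)
        rw [sumBelow_net_of_agree hb (Nat.le_succ _), hA, if_neg (by omega), if_neg (by omega)] at h8
        omega
      obtain ⟨h8, h9⟩ := h2 e (by omega) hme h6
      exact ⟨e, he, by omega, h9⟩

end Shift

/-- How a glide arises from a glide of a shifted composition: a first part beyond `m` that has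
become black is coloured red. -/
def Recolours {n : ℕ} (m : Fin n) (p : (Fin n → ℕ) × Finset (Fin n))
    (q : Σ _ : ℕ × ℕ, (Fin n → ℕ) × Finset (Fin n)) : Prop :=
  p.1 = q.2.1 ∧ ((q.1.2 = 0 ∧ p.2 = q.2.2 ∧ BlackFrom p.1 p.2 (m + 1)) ∨
    (q.1.2 = 1 ∧ ∃ k, IsFirst p.1 (m + 1) k ∧ k ∈ p.2 ∧ q.2.2 = p.2.erase k))

theorem mul_betaMonomial {n : ℕ} (k l : ℕ) (w : Fin n → ℕ) :
    (Polynomial.X ^ k : ℤ[X]) • betaMonomial l w = betaMonomial (k + l) w := by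
  rw [betaMonomial, betaMonomial, MvPolynomial.smul_monomial, smul_eq_mul, pow_add]

theorem agree_shiftPart {n : ℕ} {m v : Fin n} {w b : Fin n → ℕ} (hv : m < v) {ε : ℕ}
    (hb : ∀ k : Fin n, (k : ℕ) < m → b k = w k) (k : Fin n) (hk : (k : ℕ) < m + 1) :
    b k = shiftPart w m v (b m) ε k := by
  rcases Nat.lt_succ_iff_lt_or_eq.1 hk with hk | hk
  · rw [Fin.lt_def] at hv
    rw [shiftPart_of_ne (by rw [Ne, Fin.ext_iff]; omega) (by rw [Ne, Fin.ext_iff]; omega), hb k hk]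
  · obtain rfl : k = m := Fin.ext hk
    rw [shiftPart_left hv]

/-- Put `s = b m`. If `s ≠ 0`, it is the beginning of the block of `v`. If the next nonzero part is
black, `b` is also a glide of the composition in which `s` is split off from `w v`. If it is red,
colouring it black raises the net sum by one; this unit is `ε = 1` at `v`, and the lost red part is
the factor `β`. -/
theorem glideFrom_eq_add {n : ℕ} {m v : Fin n} {w : Fin n → ℕ} (hv : m < v)
    (h0 : ∀ k, m ≤ k → k < v → w k = 0) (hwv : w v ≠ 0) :
    glideFrom m w = glideFrom (m + 1) w + ∑ s ∈ Icc 1 (w v), ∑ ε ∈ range 2,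
      (Polynomial.X ^ ε : ℤ[X]) • glideFrom (m + 1) (shiftPart w m v s ε) := by
  classical
  rw [glideFrom, ← sum_filter_add_sum_filter_not _ (fun p => p.1 m = 0)]
  congr 1
  · rw [glideFrom]
    refine sum_congr (ext ?_) fun _ _ => rfl
    rintro ⟨b, R⟩
    rw [mem_filter, mem_glidesFrom, mem_glidesFrom, and_assoc]
    refine and_congr_right fun hg => ⟨fun hb k hk => ?_, fun hb => ⟨fun k hk => hb k (by omega), ?_⟩⟩
    · rcases Nat.lt_succ_iff_lt_or_eq.1 hk with hk | hk
      · exact hb.1 k hk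
      · obtain rfl : k = m := Fin.ext hk
        exact ⟨hb.2.trans (h0 k le_rfl hv).symm, hg.notMem hb.1⟩
    · exact (hb m (Nat.lt_succ_self _)).1.trans (h0 m le_rfl hv)
  · simp only [glideFrom, smul_sum, mul_betaMonomial]
    rw [← sum_product', sum_sigma']
    refine sum_eq_of_rel _ _ (Recolours m) ?_ ?_ ?_ ?_ ?_
    · rintro ⟨b, R⟩ hp
      rw [mem_filter, mem_glidesFrom] at hp
      obtain ⟨⟨hg, hb⟩, hbm⟩ := hp
      have hs := hg.le_part hv h0 hwv hb
      dsimp only at hbm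
      by_cases hB : BlackFrom b R (m + 1)
      · refine ⟨⟨(b m, 0), (b, R)⟩, ?_, rfl, Or.inl ⟨rfl, rfl, hB⟩⟩
        rw [mem_sigma, mem_glidesFrom, mem_product, mem_Icc, mem_range]
        refine ⟨⟨⟨by dsimp only; omega, hs⟩, by norm_num⟩, hg.shift hv h0 hwv hb subset_rfl
          (fun _ _ => rfl) (fun _ _ _ => rfl) rfl hB, fun k hk =>
          ⟨agree_shiftPart hv (fun k hk => (hb k hk).1) k hk, ?_⟩⟩
        rcases Nat.lt_succ_iff_lt_or_eq.1 hk with hk | hk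
        · exact (hb k hk).2
        · obtain rfl : k = m := Fin.ext hk
          exact hg.notMem hb
      · rw [BlackFrom] at hB
        push Not at hB
        obtain ⟨k₀, hk1, hk2, hk3, hk4⟩ := hB
        refine ⟨⟨(b m, 1), (b, R.erase k₀)⟩, ?_, rfl, Or.inr ⟨rfl, k₀, ⟨hk1, hk2, hk3⟩, hk4, rfl⟩⟩
        rw [mem_sigma, mem_glidesFrom, mem_product, mem_Icc, mem_range]
        refine ⟨⟨⟨by dsimp only; omega, hs⟩, by norm_num⟩, hg.shift hv h0 hwv hb (erase_subset _ _)
          (fun e he => ?_) (fun e he hBe => ?_) ?_ ?_, fun k hk =>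
          ⟨agree_shiftPart hv (fun k hk => (hb k hk).1) k hk, fun hkR => ?_⟩⟩
        · rw [sumBelow_net_erase hk4 hk2, if_neg (by omega), add_zero]
        · rw [sumBelow_net_erase hk4 hk2, if_pos]
          by_contra hle
          exact hBe k₀ (by omega) hk2 (fun k' hk' hlt => hk3 k' (by omega) hlt) hk4
        · rw [sumBelow_net_erase hk4 hk2, if_pos k₀.2]
        · intro k hk hk' hmin
          rw [IsFirst.unique ⟨hk, hk', hmin⟩ ⟨hk1, hk2, hk3⟩]
          exact notMem_erase _ _
        · have hkR := mem_of_mem_erase hkR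
          rcases Nat.lt_succ_iff_lt_or_eq.1 hk with hk | hk
          · exact (hb k hk).2 hkR
          · obtain rfl : k = m := Fin.ext hk
            exact hg.notMem hb hkR
    · rintro ⟨⟨s, ε⟩, b, R'⟩ hq
      rw [mem_sigma, mem_glidesFrom, mem_product, mem_Icc, mem_range] at hq
      obtain ⟨⟨⟨hs0, hs⟩, hε⟩, hg, hb⟩ := hq
      dsimp only at hs0 hs hε hg hb
      have hbm : b m = s := by rw [(hb m (Nat.lt_succ_self _)).1, shiftPart_left hv]
      have hB := hg.blackFrom (m := m + 1) hb m.2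
      have hbw : ∀ k : Fin n, (k : ℕ) < m → b k = w k := fun k hk => by
        have hvv : (m : ℕ) < v := hv
        rw [(hb k (by omega)).1, shiftPart_of_ne (by rw [Ne, Fin.ext_iff]; omega)
          (by rw [Ne, Fin.ext_iff]; omega)]
      obtain rfl | rfl : ε = 0 ∨ ε = 1 := by omega
      · refine ⟨(b, R'), ?_, rfl, Or.inl ⟨rfl, rfl, hB⟩⟩
        rw [mem_filter, mem_glidesFrom]
        refine ⟨⟨hg.unshift hv h0 (by omega) hs hb hg.pos (fun _ _ => Iff.rfl)
          (fun e _ _ h => ⟨rfl, h⟩) rfl, fun k hk => ⟨hbw k hk, (hb k (by omega)).2⟩⟩, ?_⟩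
        dsimp only; omega
      -- For `ε = 1` the part left at `v` is positive, so some part beyond `m` exists that can be
      -- coloured red.
      · have hex : ∃ k, IsFirst b (m + 1) k := by
          by_contra hne
          have hz : ∀ k : Fin n, (m : ℕ) + 1 ≤ k → b k = 0 := fun k hk => by
            by_contra hk'
            obtain ⟨k₀, h1, h2, h3, h4⟩ := exists_first hk hk'
            exact hne ⟨k₀, h1, h3, h4⟩
          have h1 : sumBelow (net b R') (m + 1) = sumBelow (net b R') n :=
            (sumBelow_eq_iff _ m.2).2 fun k hk _ => by simp [net, hz k hk]
          have hvv : (m : ℕ) < v := hv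
          rw [hg.total, sumBelow_net_of_agree hb le_rfl, sumBelow_shiftPart hv (h0 m le_rfl hv) hs,
            sumBelow_shiftPart hv (h0 m le_rfl hv) hs, if_neg (by omega),
            if_pos (Nat.lt_succ_self _), if_pos v.2, sumBelow_eq_of_gap h0 (Nat.le_succ _) hv] at h1
          have := add_le_sumBelow hv h0 v.2
          omega
        obtain ⟨k₀, hk1, hk2, hk3⟩ := hex
        have hkR : k₀ ∉ R' := hB k₀ hk1 hk2 hk3
        have hmem : k₀ ∈ insert k₀ R' := mem_insert_self _ _
        have her : (insert k₀ R').erase k₀ = R' := erase_insert hkR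
        have hnet := sumBelow_net_erase hmem hk2
        rw [her] at hnet
        have hle : ∀ k : Fin n, (k : ℕ) ≤ m → k ≠ k₀ := fun k hk he => by subst he; omega
        refine ⟨(b, insert k₀ R'), ?_, rfl, Or.inr ⟨rfl, k₀, ⟨hk1, hk2, hk3⟩, hmem, her.symm⟩⟩
        rw [mem_filter, mem_glidesFrom]
        refine ⟨⟨hg.unshift hv h0 (by omega) hs hb (fun k hk => ?_) (fun k hk => ?_)
          (fun e he hme hBe => ?_) ?_, fun k hk => ⟨hbw k hk, ?_⟩⟩, ?_⟩
        · rcases mem_insert.1 hk with rfl | hk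
          · omega
          · exact hg.pos k hk
        · rw [mem_insert, or_iff_right (hle k hk)]
        · have hke : (k₀ : ℕ) < e := by
            by_contra hke
            have h1 : sumBelow (net b R') (m + 1) = sumBelow (net b R') e :=
              (sumBelow_eq_iff _ hme).2 fun k hk hk' => by
                simp [net, hk3 k hk (by rw [Fin.lt_def]; omega)]
            omega
          refine ⟨by rw [hnet, if_pos hke], fun k hk hk' hmin hmem => ?_⟩
          rcases mem_insert.1 hmem with rfl | hmem
          · omega
          · exact hBe k hk hk' hmin hmem
        · rw [hnet, if_pos k₀.2]
        · rw [mem_insert, not_or]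
          exact ⟨hle k hk.le, (hb k (by omega)).2⟩
        · dsimp only; omega
    · rintro ⟨b, R⟩ - ⟨b₁, R₁⟩ - ⟨⟨s, ε⟩, b', R'⟩ - ⟨rfl, h⟩ ⟨rfl, h'⟩
      dsimp only at h h'
      rcases h with ⟨h1, rfl, -⟩ | ⟨h1, k, h2, h3, rfl⟩
      · rcases h' with ⟨-, rfl, -⟩ | ⟨h1', -⟩
        · rfl
        · omega
      · rcases h' with ⟨h1', -⟩ | ⟨-, k', h2', h3', h4⟩
        · omega
        · obtain rfl := h2.unique h2'
          rw [← insert_erase h3, ← insert_erase h3', h4]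
    · rintro ⟨b, R⟩ hp ⟨⟨s, ε⟩, b', R'⟩ hq ⟨⟨s₁, ε₁⟩, b₁, R₁⟩ hq₁ ⟨rfl, h⟩ ⟨he, h'⟩
      dsimp only at he h h'
      subst he
      rw [mem_sigma, mem_glidesFrom] at hq hq₁
      have e1 := (hq.2.2 m (Nat.lt_succ_self _)).1
      have e2 := (hq₁.2.2 m (Nat.lt_succ_self _)).1
      rw [shiftPart_left hv] at e1 e2
      dsimp only at e1 e2
      rw [e1] at e2
      subst e2
      rcases h with ⟨rfl, rfl, hB⟩ | ⟨rfl, k, h2, h3, rfl⟩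
      · rcases h' with ⟨rfl, rfl, -⟩ | ⟨rfl, k', h2', h3', h4⟩
        · rfl
        · exact absurd h3' (hB k' h2'.1 h2'.2.1 h2'.2.2)
      · rcases h' with ⟨rfl, rfl, hB⟩ | ⟨rfl, k', h2', h3', rfl⟩
        · exact absurd h3 (hB k h2.1 h2.2.1 h2.2.2)
        · obtain rfl := h2.unique h2'
          rfl
    · rintro ⟨b, R⟩ - ⟨⟨s, ε⟩, b', R'⟩ - ⟨rfl, h⟩
      dsimp only at h ⊢
      rcases h with ⟨rfl, rfl, -⟩ | ⟨rfl, k, -, h3, rfl⟩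
      · rw [zero_add]
      · rw [add_comm, card_erase_add_one h3]

/-! ### Relabelling fillings -/

theorem coe_le_max_iff_exists {n : ℕ} {s : Finset (Fin n)} {x : Fin n} :
    (x : WithBot (Fin n)) ≤ s.max ↔ ∃ y ∈ s, x ≤ y := by
  constructor
  · intro h
    rcases s.eq_empty_or_nonempty with rfl | hs
    · simp at h
    · obtain ⟨y, hy⟩ := max_of_nonempty hs
      rw [hy, WithBot.coe_le_coe] at h
      exact ⟨y, mem_of_max hy, h⟩
  · rintro ⟨y, hy, hxy⟩
    exact (WithBot.coe_le_coe.2 hxy).trans (le_max hy)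

theorem max_le_max_iff_forall {n : ℕ} {s s' : Finset (Fin n)} :
    s.max ≤ s'.max ↔ ∀ x ∈ s, ∃ y ∈ s', x ≤ y := by
  constructor
  · exact fun h x hx => coe_le_max_iff_exists.1 ((le_max hx).trans h)
  · exact fun h => Finset.max_le fun x hx => coe_le_max_iff_exists.2 (h x hx)

theorem coe_lt_max_iff_exists {n : ℕ} {s : Finset (Fin n)} {x : Fin n} :
    (x : WithBot (Fin n)) < s.max ↔ ∃ y ∈ s, x < y := by
  have : (x : WithBot (Fin n)) = ({x} : Finset (Fin n)).max := by simp
  rw [this, ← not_le, max_le_max_iff_forall]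
  simp

theorem image_max_le_iff {n : ℕ} {s s' : Finset (Fin n)} {φ ψ : Fin n → Fin n}
    (h : ∀ x ∈ s, ∀ y ∈ s', x ≤ y ↔ φ x ≤ ψ y) :
    (s.image φ).max ≤ (s'.image ψ).max ↔ s.max ≤ s'.max := by
  rw [max_le_max_iff_forall, max_le_max_iff_forall, forall_mem_image]
  refine forall₂_congr fun x hx => ?_
  rw [exists_mem_image]
  exact exists_congr fun y => and_congr_right fun hy => (h x hx y hy).symm

theorem mem_colUnion_of_mem {n : ℕ} {a : Fin n → ℕ} {T : SetFilling a} {i : Fin n} {c : ℕ}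
    {k : Fin n} (h : k ∈ cell T i c) : k ∈ colUnion T c := mem_colUnion.2 ⟨i, h⟩

theorem IsSemistandard.cell_nonempty {n : ℕ} {a : Fin n → ℕ} {T : SetFilling a}
    (h : IsSemistandard T) {i : Fin n} {c : ℕ} (hc : c < a i) : (cell T i c).Nonempty := by
  have := h.nonempty i ⟨c, hc⟩
  rwa [← cell_eq T] at this

/-- Semistandardness depends only on the relative order of entries in a column and of entries in
adjacent columns. -/
theorem IsSemistandard.relabel {n : ℕ} {a : Fin n → ℕ} {T T' : SetFilling a}
    (h : IsSemistandard T') (φ : ℕ → Fin n → Fin n)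
    (hT : ∀ i c, cell T i c = (cell T' i c).image (φ c))
    (hcol : ∀ c, ∀ x ∈ colUnion T' c, ∀ y ∈ colUnion T' c, x ≤ y ↔ φ c x ≤ φ c y)
    (hrow : ∀ c, ∀ x ∈ colUnion T' (c + 1), ∀ y ∈ colUnion T' c, x ≤ y ↔ φ (c + 1) x ≤ φ c y) :
    IsSemistandard T := by
  have hC : ∀ i j c, anchor T i c ≤ anchor T j c ↔ anchor T' i c ≤ anchor T' j c := fun i j c => by
    simp only [anchor, hT]
    exact image_max_le_iff fun x hx y hy =>
      hcol c x (mem_colUnion_of_mem hx) y (mem_colUnion_of_mem hy)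
  have hR : ∀ i j c, anchor T i (c + 1) ≤ anchor T j c ↔ anchor T' i (c + 1) ≤ anchor T' j c :=
    fun i j c => by
      simp only [anchor, hT]
      exact image_max_le_iff fun x hx y hy =>
        hrow c x (mem_colUnion_of_mem hx) y (mem_colUnion_of_mem hy)
  refine ⟨fun i c => ?_, fun i j c k hi hj => ?_, fun i c x hx y hy => ?_, fun i j hij ha c hc => ?_,
    fun i j hij ha c hc => ?_, fun i c k hk hlt j hj hy => ?_⟩
  · rw [← cell_eq T, hT]
    exact (h.cell_nonempty c.2).image _
  · rw [hT, mem_image] at hi hj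
    obtain ⟨x, hx, rfl⟩ := hi
    obtain ⟨y, hy, hxy⟩ := hj
    have hx' := mem_colUnion_of_mem hx
    have hy' := mem_colUnion_of_mem hy
    obtain rfl : x = y := le_antisymm ((hcol c x hx' y hy').2 hxy.ge) ((hcol c y hy' x hx').2 hxy.le)
    exact h.column i j c x hx hy
  · rw [hT, mem_image] at hx hy
    obtain ⟨x, hx, rfl⟩ := hx
    obtain ⟨y, hy, rfl⟩ := hy
    exact (hrow c y (mem_colUnion_of_mem hy) x (mem_colUnion_of_mem hx)).1 (h.row i c x hx y hy)
  · have := h.tripleA i j hij ha c hc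
    rw [IsInversionTriple, ← not_le, ← not_le] at this ⊢
    rwa [hC, hR, hR]
  · have := h.tripleB i j hij ha c hc
    rw [IsInversionTriple, ← not_le, ← not_le] at this ⊢
    rwa [hC, hR, hR]
  · rw [hC]
    rw [hT, mem_image] at hk
    obtain ⟨k, hk, rfl⟩ := hk
    have hk' := mem_colUnion_of_mem hk
    have hlt' : ∀ i, (φ c k : WithBot (Fin n)) < anchor T i c → (k : WithBot (Fin n)) < anchor T' i c := by
      intro i hi
      rw [anchor, coe_lt_max_iff_exists] at hi ⊢
      obtain ⟨y, hy, hlt⟩ := hi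
      rw [hT, mem_image] at hy
      obtain ⟨y, hy, rfl⟩ := hy
      refine ⟨y, hy, ?_⟩
      rwa [← not_le, ← hcol c y (mem_colUnion_of_mem hy) k hk', not_le] at hlt
    refine h.free i c k hk (hlt' i hlt) j (hlt' j hj) fun y hyj => ?_
    rw [hrow c y (mem_colUnion_of_mem hyj) k hk']
    exact hy _ (by rw [hT]; exact mem_image_of_mem _ hyj)

theorem isSemistandard_relabel_iff {n : ℕ} {a : Fin n → ℕ} {T T' : SetFilling a}
    (φ : ℕ → Equiv.Perm (Fin n)) (hT : ∀ i c, cell T i c = (cell T' i c).image (φ c))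
    (hcol : ∀ c, ∀ x ∈ colUnion T' c, ∀ y ∈ colUnion T' c, x ≤ y ↔ φ c x ≤ φ c y)
    (hrow : ∀ c, ∀ x ∈ colUnion T' (c + 1), ∀ y ∈ colUnion T' c, x ≤ y ↔ φ (c + 1) x ≤ φ c y) :
    IsSemistandard T ↔ IsSemistandard T' := by
  have hmem : ∀ c, ∀ x ∈ colUnion T c, (φ c).symm x ∈ colUnion T' c := by
    intro c x hx
    obtain ⟨i, hi⟩ := mem_colUnion.1 hx
    rw [hT, mem_image] at hi
    obtain ⟨y, hy, rfl⟩ := hi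
    rw [Equiv.symm_apply_apply]
    exact mem_colUnion_of_mem hy
  refine ⟨fun h => h.relabel (fun c => (φ c).symm) (fun i c => ?_) (fun c x hx y hy => ?_)
    (fun c x hx y hy => ?_), fun h => h.relabel (fun c => φ c) hT hcol hrow⟩
  · rw [hT, image_image]
    simp
  · have := hcol c _ (hmem c x hx) _ (hmem c y hy)
    rw [Equiv.apply_symm_apply, Equiv.apply_symm_apply] at this
    exact this.symm
  · have := hrow c _ (hmem _ x hx) _ (hmem _ y hy)
    rw [Equiv.apply_symm_apply, Equiv.apply_symm_apply] at this
    exact this.symm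

/-- Inserting a free entry `m` into a box with an entry `v`, where no entry lies between. -/
theorem isSemistandard_insert_iff {n : ℕ} {a : Fin n → ℕ} {T U : SetFilling a} {m v i₀ : Fin n}
    {c₀ : ℕ} (hT : ∀ i c k, k ∈ cell T i c ↔ k ∈ cell U i c ∨ (k = m ∧ c = c₀ ∧ i = i₀))
    (hv : v ∈ cell U i₀ c₀) (hmv : m < v) (h1 : ∀ k ∈ colUnion U c₀, m ≤ k → v ≤ k)
    (h2 : ∀ k ∈ colUnion U (c₀ + 1), k ≤ v → k ≤ m) : IsSemistandard T ↔ IsSemistandard U := by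
  have hsub : ∀ {i c k}, k ∈ cell U i c → k ∈ cell T i c := fun hk => (hT _ _ _).2 (Or.inl hk)
  have hanchor : ∀ i c, anchor T i c = anchor U i c := by
    intro i c
    refine le_antisymm (max_le_max_iff_forall.2 fun x hx => ?_)
      (max_le_max_iff_forall.2 fun x hx => ⟨x, hsub hx, le_rfl⟩)
    rcases (hT i c x).1 hx with hx | ⟨rfl, rfl, rfl⟩
    · exact ⟨x, hx, le_rfl⟩
    · exact ⟨v, hv, hmv.le⟩
  constructor
  · intro h
    refine ⟨fun i c => ?_, fun i j c k hi hj => h.column i j c k (hsub hi) (hsub hj),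
      fun i c x hx y hy => h.row i c x (hsub hx) y (hsub hy), fun i j hij ha c hc => ?_,
      fun i j hij ha c hc => ?_, fun i c k hk hlt j hj hy => ?_⟩
    · obtain ⟨k, hk⟩ := h.cell_nonempty c.2
      rw [← cell_eq U]
      rcases (hT i c k).1 hk with hk | ⟨rfl, hc, rfl⟩
      · exact ⟨k, hk⟩
      · exact ⟨v, hc ▸ hv⟩
    · simp only [← hanchor]; exact h.tripleA i j hij ha c hc
    · simp only [← hanchor]; exact h.tripleB i j hij ha c hc
    · simp only [← hanchor] at hlt hj ⊢
      refine h.free i c k (hsub hk) hlt j hj fun y hy' => ?_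
      rcases (hT j (c + 1) y).1 hy' with hy' | ⟨rfl, rfl, rfl⟩
      · exact hy y hy'
      · exact hmv.le.trans (hy v hv)
  · intro h
    refine ⟨fun i c => ?_, fun i j c k hi hj => ?_, fun i c x hx y hy => ?_,
      fun i j hij ha c hc => ?_, fun i j hij ha c hc => ?_, fun i c k hk hlt j hj hy => ?_⟩
    · obtain ⟨k, hk⟩ := h.cell_nonempty c.2
      rw [← cell_eq T]
      exact ⟨k, hsub hk⟩
    · have hm : ∀ i, m ∉ cell U i c₀ := fun i hi =>
        absurd (h1 m (mem_colUnion_of_mem hi) le_rfl) (not_le.2 hmv)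
      rcases (hT i c k).1 hi with hi | ⟨rfl, rfl, rfl⟩
      · rcases (hT j c k).1 hj with hj | ⟨rfl, rfl, rfl⟩
        · exact h.column i j c k hi hj
        · exact absurd hi (hm i)
      · rcases (hT j c k).1 hj with hj | ⟨-, -, rfl⟩
        · exact absurd hj (hm j)
        · rfl
    · rcases (hT i c x).1 hx with hx | ⟨rfl, rfl, rfl⟩
      · rcases (hT i (c + 1) y).1 hy with hy | ⟨rfl, rfl, rfl⟩
        · exact h.row i c x hx y hy
        · exact hmv.le.trans (h.row i c x hx v hv)
      · rcases (hT i (c + 1) y).1 hy with hy | ⟨-, hc, -⟩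
        · exact h2 y (mem_colUnion_of_mem hy) (h.row i c v hv y hy)
        · omega
    · simp only [hanchor]; exact h.tripleA i j hij ha c hc
    · simp only [hanchor]; exact h.tripleB i j hij ha c hc
    · simp only [hanchor] at hlt hj ⊢
      rcases (hT i c k).1 hk with hk | ⟨rfl, rfl, rfl⟩
      · exact h.free i c k hk hlt j hj fun y hy' => hy y (hsub hy')
      · rw [anchor, coe_lt_max_iff_exists] at hj
        obtain ⟨z, hz, hkz⟩ := hj
        have hvz := h1 z (mem_colUnion_of_mem hz) hkz.le
        -- The least-anchor condition for the new entry `m` is that of `v` if `v` is free, since no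
        -- entry lies between them. If `v` is the anchor of its box, every anchor above `m` is at
        -- least `v`.
        by_cases hvi : (v : WithBot (Fin n)) < anchor U i c
        · by_cases hij : i = j
          · rw [hij]
          refine h.free i c v hv hvi j ?_ fun y hy' => (hy y (hsub hy')).trans hmv.le
          rw [anchor, coe_lt_max_iff_exists]
          refine ⟨z, hz, lt_of_le_of_ne hvz ?_⟩
          rintro rfl
          exact hij (h.column i j c _ hv hz)
        · rw [not_lt] at hvi
          refine hvi.trans ?_
          rw [anchor, coe_le_max_iff_exists]
          exact ⟨z, hz, hvz⟩

/-! ### Moving entries to a smaller value -/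

/-- `T` arises from `T'` by turning the entries `v` from column `c₀` on into `m`, with `v` kept
in column `c₀` as well if `e = 1`. -/
def IsMove {n : ℕ} {a : Fin n → ℕ} (m v : Fin n) (c₀ e : ℕ) (T' T : SetFilling a) : Prop :=
  ∀ i c k, k ∈ cell T i c ↔ (k ≠ m ∧ k ≠ v ∧ k ∈ cell T' i c) ∨
    (k = m ∧ c₀ ≤ c ∧ v ∈ cell T' i c) ∨ (k = v ∧ c < c₀ + e ∧ v ∈ cell T' i c)

/-- The least entry of `T` that is at least `m` is `v`, and `m < v`. -/
structure IsNext {n : ℕ} {a : Fin n → ℕ} (T : SetFilling a) (m v : Fin n) : Prop where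
  lt : m < v
  mem : ∃ i c, v ∈ cell T i c
  gap : ∀ i c k, k ∈ cell T i c → m ≤ k → v ≤ k

theorem IsNext.unique {n : ℕ} {a : Fin n → ℕ} {T : SetFilling a} {m v v' : Fin n}
    (h : IsNext T m v) (h' : IsNext T m v') : v = v' := by
  obtain ⟨i, c, hv⟩ := h.mem
  obtain ⟨i', c', hv'⟩ := h'.mem
  exact le_antisymm (h.gap _ _ _ hv' h'.lt.le) (h'.gap _ _ _ hv h.lt.le)

theorem IsNext.notMem {n : ℕ} {a : Fin n → ℕ} {T : SetFilling a} {m v : Fin n}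
    (h : IsNext T m v) (i : Fin n) (c : ℕ) : m ∉ cell T i c := fun hm =>
  absurd (h.gap i c m hm le_rfl) (not_le.2 h.lt)

open Classical in
/-- The filling obtained by moving the next entry from column `c₀` on. -/
def moveFilling {n : ℕ} {a : Fin n → ℕ} (T : SetFilling a) (m : Fin n) (x : ℕ × ℕ) : SetFilling a :=
  ofCell a fun i c => {k | (k ≠ m ∧ ¬ IsNext T m k ∧ k ∈ cell T i c) ∨
    (k = m ∧ x.1 ≤ c ∧ ∃ v, IsNext T m v ∧ v ∈ cell T i c) ∨
    (IsNext T m k ∧ c < x.1 + x.2 ∧ k ∈ cell T i c)}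

theorem isMove_moveFilling {n : ℕ} {a : Fin n → ℕ} {T : SetFilling a} {m v : Fin n} (x : ℕ × ℕ)
    (h : IsNext T m v) : IsMove m v x.1 x.2 T (moveFilling T m x) := by
  have hn : ∀ k, IsNext T m k ↔ k = v := fun k => ⟨fun hk => hk.unique h, fun hk => hk ▸ h⟩
  intro i c k
  rw [moveFilling, cell_ofCell]
  · simp only [hn, mem_filter, mem_univ, true_and, exists_eq_left]
    refine or_congr Iff.rfl (or_congr Iff.rfl (and_congr_right ?_))
    rintro rfl
    rfl
  · intro hc
    simp [cell, not_lt.2 hc]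

theorem IsMove.eq {n : ℕ} {a : Fin n → ℕ} {m v : Fin n} {c₀ e : ℕ} {T' T S : SetFilling a}
    (h : IsMove m v c₀ e T' T) (h' : IsMove m v c₀ e T' S) : T = S :=
  cell_injective fun i c => ext fun k => (h i c k).trans (h' i c k).symm

section Move

variable {n : ℕ} {a : Fin n → ℕ} {m v : Fin n} {c₀ e : ℕ} {T' T : SetFilling a}

theorem IsMove.mem_left (h : IsMove m v c₀ e T' T) (hv : IsNext T' m v) {i : Fin n} {c : ℕ} :
    m ∈ cell T i c ↔ c₀ ≤ c ∧ v ∈ cell T' i c := by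
  rw [h]
  simp [hv.lt.ne]

theorem IsMove.mem_right (h : IsMove m v c₀ e T' T) (hv : IsNext T' m v) {i : Fin n} {c : ℕ} :
    v ∈ cell T i c ↔ c < c₀ + e ∧ v ∈ cell T' i c := by
  rw [h]
  simp [hv.lt.ne']

theorem IsMove.mem_of_ne (h : IsMove m v c₀ e T' T) {i : Fin n} {c : ℕ} {k : Fin n} (h1 : k ≠ m)
    (h2 : k ≠ v) : k ∈ cell T i c ↔ k ∈ cell T' i c := by
  rw [h]
  simp [h1, h2]

theorem IsMove.mem_iff (h : IsMove m v c₀ e T' T) (hv : IsNext T' m v) {i : Fin n} {c : ℕ}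
    {k : Fin n} : k ∈ cell T' i c ↔
      (k ≠ m ∧ k ∈ cell T i c) ∨ (k = v ∧ m ∈ cell T i c) := by
  by_cases hkm : k = m
  · subst hkm
    simp [hv.notMem, hv.lt.ne]
  by_cases hkv : k = v
  · subst hkv
    rw [h.mem_left hv, h.mem_right hv]
    simp only [hkm, ne_eq, not_false_eq_true, true_and]
    have : c < c₀ + e ∨ c₀ ≤ c := by omega
    tauto
  · simp [hkm, hkv, h.mem_of_ne hkm hkv]

theorem IsMove.exists_le (h : IsMove m v c₀ e T' T) (hv : IsNext T' m v) {i : Fin n} {c : ℕ}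
    {k : Fin n} (hk : k ∈ cell T i c) : ∃ y ∈ cell T' i c, k ≤ y := by
  by_cases hkm : k = m
  · rw [hkm, h.mem_left hv] at hk
    exact ⟨v, hk.2, hkm ▸ hv.lt.le⟩
  · exact ⟨k, (h.mem_iff hv).2 (Or.inl ⟨hkm, hk⟩), le_rfl⟩

theorem IsMove.anchor_le (h : IsMove m v c₀ e T' T) (hv : IsNext T' m v) (i : Fin n) (c : ℕ) :
    anchor T i c ≤ anchor T' i c :=
  max_le_max_iff_forall.2 fun _ hx => h.exists_le hv hx

/-- The inverse of a move replaces `m` by `v`. This is weakly increasing on the entries of `T`, none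
of which lies strictly between `m` and `v`. -/
theorem IsMove.anchor_mono (h : IsMove m v c₀ e T' T) (hv : IsNext T' m v) {i j : Fin n} {c d : ℕ}
    (hij : anchor T i c ≤ anchor T j d) : anchor T' i c ≤ anchor T' j d := by
  refine max_le_max_iff_forall.2 fun x hx => ?_
  obtain ⟨z, hz, hxz⟩ : ∃ z ∈ cell T i c, x = if z = m then v else z := by
    rcases (h.mem_iff hv).1 hx with ⟨h1, h2⟩ | ⟨h1, h2⟩
    · exact ⟨x, h2, by rw [if_neg h1]⟩
    · exact ⟨m, h2, by rw [if_pos rfl, h1]⟩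
  obtain ⟨y, hy, hzy⟩ := max_le_max_iff_forall.1 hij z hz
  rw [hxz]
  by_cases hym : y = m
  · subst hym
    refine ⟨v, ((h.mem_left hv).1 hy).2, ?_⟩
    split_ifs
    · exact le_rfl
    · exact hzy.trans hv.lt.le
  · have hy' : y ∈ cell T' j d := (h.mem_iff hv).2 (Or.inl ⟨hym, hy⟩)
    refine ⟨y, hy', ?_⟩
    split_ifs with hzm
    · exact hv.gap j d y hy' (hzm ▸ hzy)
    · exact hzy

/-- No entry of `T'` lies in `[m, v)`, and once `v` is lowered in a column it is lowered in all
columns to the right. So no comparison within a column, or of an entry with the column on its left,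
changes. -/
theorem IsMove.isSemistandard_iff_zero (h : IsMove m v c₀ 0 T' T) (hmv : m < v)
    (hgap : ∀ i c k, k ∈ cell T' i c → m ≤ k → v ≤ k) :
    IsSemistandard T ↔ IsSemistandard T' := by
  have hgap' : ∀ c, ∀ k ∈ colUnion T' c, k < m ∨ v ≤ k := fun c k hk => by
    obtain ⟨i, hi⟩ := mem_colUnion.1 hk
    exact (lt_or_ge k m).imp_right (hgap i c k hi)
  have hφ : ∀ c, ∀ k ∈ colUnion T' c, (if c₀ ≤ c then Equiv.swap m v else 1) k =
      if c₀ ≤ c ∧ k = v then m else k := by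
    intro c k hk
    have hkm : k ≠ m := by
      rintro rfl
      rcases hgap' c _ hk with h1 | h1
      · exact lt_irrefl _ h1
      · exact absurd hmv (not_lt.2 h1)
    by_cases hc : c₀ ≤ c
    · by_cases hkv : k = v
      · simp [hc, hkv]
      · simp [hc, hkv, Equiv.swap_apply_of_ne_of_ne hkm hkv]
    · simp [hc]
  refine isSemistandard_relabel_iff (fun c => if c₀ ≤ c then Equiv.swap m v else 1)
    (fun i c => ?_) (fun c x hx y hy => ?_) (fun c x hx y hy => ?_)
  · ext k
    rw [h, mem_image]
    constructor
    · rintro (⟨h1, h2, h3⟩ | ⟨rfl, h2, h3⟩ | ⟨rfl, h2, h3⟩)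
      · exact ⟨k, h3, by rw [hφ c k (mem_colUnion_of_mem h3), if_neg (fun hh => h2 hh.2)]⟩
      · exact ⟨v, h3, by rw [hφ c v (mem_colUnion_of_mem h3), if_pos ⟨h2, rfl⟩]⟩
      · exact ⟨k, h3, by rw [hφ c k (mem_colUnion_of_mem h3), if_neg (fun hh => by omega)]⟩
    · rintro ⟨x, hx, rfl⟩
      rw [hφ c x (mem_colUnion_of_mem hx)]
      have hxm : x ≠ m := by
        rintro rfl
        exact absurd hmv (not_lt.2 (hgap i c _ hx le_rfl))
      by_cases hxv : x = v
      · subst hxv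
        by_cases hc : c₀ ≤ c
        · simp [hc, hx]
        · simp [hc, hx, not_le.1 hc]
      · simp [hxv, hx, hxm]
  · rw [hφ c x hx, hφ c y hy]
    have h1 := hgap' c x hx
    have h2 := hgap' c y hy
    simp only [Fin.lt_def, Fin.le_def, Fin.ext_iff] at *
    split_ifs <;> omega
  · rw [hφ _ x hx, hφ _ y hy]
    have h1 := hgap' _ x hx
    have h2 := hgap' _ y hy
    simp only [Fin.lt_def, Fin.le_def, Fin.ext_iff] at *
    split_ifs <;> omega

theorem IsMove.isSemistandard_iff (h : IsMove m v c₀ e T' T) (hv : IsNext T' m v) (he : e ≤ 1)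
    (h1 : e = 1 → ∃ i₀, v ∈ cell T' i₀ c₀ ∧ ∀ i, v ∈ cell T' i c₀ → i = i₀) :
    IsSemistandard T ↔ IsSemistandard T' := by
  obtain rfl | rfl : e = 0 ∨ e = 1 := by omega
  · exact h.isSemistandard_iff_zero hv.lt hv.gap
  · obtain ⟨i₀, hi₀, huniq⟩ := h1 rfl
    -- A move that keeps `v` in column `c₀` is the plain move from column `c₀ + 1` on, followed by
    -- the insertion of `m` beside `v` as a free entry.
    have hU := isMove_moveFilling (c₀ + 1, 0) hv
    rw [← hU.isSemistandard_iff_zero hv.lt hv.gap]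
    refine isSemistandard_insert_iff (m := m) (v := v) (i₀ := i₀) (c₀ := c₀) (fun i c k => ?_) ?_
      hv.lt (fun k hk hmk => ?_) (fun k hk hkv => ?_)
    · by_cases hkm : k = m
      · subst hkm
        rw [h.mem_left hv, hU.mem_left hv]
        constructor
        · rintro ⟨h2, h3⟩
          rcases h2.eq_or_lt with rfl | h2
          · exact Or.inr ⟨rfl, rfl, huniq i h3⟩
          · exact Or.inl ⟨h2, h3⟩
        · rintro (⟨h2, h3⟩ | ⟨-, rfl, rfl⟩)
          · exact ⟨by dsimp only at h2; omega, h3⟩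
          · exact ⟨le_rfl, hi₀⟩
      · rw [h, hU]
        simp [hkm]
    · rw [hU.mem_right hv]
      exact ⟨by simp, hi₀⟩
    · obtain ⟨i, hi⟩ := mem_colUnion.1 hk
      have hkm : k ≠ m := by
        rintro rfl
        rw [hU.mem_left hv] at hi
        dsimp only at hi; omega
      obtain ⟨y, hy, -⟩ := hU.exists_le hv hi
      exact hv.gap i c₀ k ((hU.mem_iff hv).2 (Or.inl ⟨hkm, hi⟩)) hmk
    · obtain ⟨i, hi⟩ := mem_colUnion.1 hk
      by_cases hkm : k = m
      · exact hkm.le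
      have hkv' : k ≠ v := by
        rintro rfl
        rw [hU.mem_right hv] at hi
        dsimp only at hi; omega
      rw [hU.mem_of_ne hkm hkv'] at hi
      by_contra hlt
      exact hkv' (le_antisymm hkv (hv.gap i _ k hi (not_le.1 hlt).le))

end Move

/-! ### The quasiYamanouchi condition at single values -/

/-- The quasiYamanouchi condition for the value `k`. -/
def YamanouchiAt {n : ℕ} {a : Fin n → ℕ} (T : SetFilling a) (k : Fin n) : Prop :=
  ∀ i c, k ∈ cell T i c → (∀ i' c', k ∈ cell T i' c' → c ≤ c') →
    (c = 0 ∧ i = k ∧ anchor T i c = k) ∨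
    ∃ k' : Fin n, (k' : ℕ) = k + 1 ∧ ∃ i' c', c ≤ c' ∧ k' ∈ cell T i' c' ∧ (i', c') ≠ (i, c)

/-- Quasi-skyline fillings with the quasiYamanouchi condition for the values from `m` on. -/
structure IsYamanouchiFrom {n : ℕ} {a : Fin n → ℕ} (m : ℕ) (T : SetFilling a) : Prop where
  quasi : IsQuasiFilling T
  yamanouchi : ∀ k : Fin n, m ≤ k → YamanouchiAt T k

theorem isYamanouchiFrom_zero {n : ℕ} {a : Fin n → ℕ} {T : SetFilling a} :
    IsYamanouchiFrom 0 T ↔ IsQuasiYamanouchi T :=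
  ⟨fun h => ⟨h.quasi, fun k => h.yamanouchi k (Nat.zero_le _)⟩,
    fun h => ⟨h.quasi, fun k _ => h.yamanouchi k⟩⟩

theorem isYamanouchiFrom_self {n : ℕ} {a : Fin n → ℕ} {T : SetFilling a} :
    IsYamanouchiFrom n T ↔ IsQuasiFilling T :=
  ⟨fun h => h.quasi, fun h => ⟨h, fun k hk => by omega⟩⟩

theorem isYamanouchiFrom_iff {n : ℕ} {a : Fin n → ℕ} {T : SetFilling a} {m : Fin n} :
    IsYamanouchiFrom m T ↔ IsYamanouchiFrom (m + 1) T ∧ YamanouchiAt T m := by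
  refine ⟨fun h => ⟨⟨h.quasi, fun k hk => h.yamanouchi k (by omega)⟩, h.yamanouchi m le_rfl⟩,
    fun h => ⟨h.1.quasi, fun k hk => ?_⟩⟩
  rcases hk.eq_or_lt with hk | hk
  · obtain rfl : m = k := Fin.ext hk
    exact h.2
  · exact h.1.yamanouchi k hk

theorem anchor_eq_of_forall {n : ℕ} {a : Fin n → ℕ} {T : SetFilling a} {i k : Fin n} {c : ℕ}
    (hk : k ∈ cell T i c) (h : ∀ y ∈ cell T i c, y ≤ k) : anchor T i c = k :=
  le_antisymm (Finset.max_le fun y hy => WithBot.coe_le_coe.2 (h y hy)) (le_max hk)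

theorem le_of_anchor_le {n : ℕ} {a : Fin n → ℕ} {T : SetFilling a} {i k x : Fin n} {c : ℕ}
    (h : anchor T i c ≤ (x : WithBot (Fin n))) (hk : k ∈ cell T i c) : k ≤ x :=
  WithBot.coe_le_coe.1 ((le_max hk).trans h)

theorem IsQuasiFilling.mem_zero_le {n : ℕ} {a : Fin n → ℕ} {T : SetFilling a}
    (h : IsQuasiFilling T) {i k : Fin n} (hk : k ∈ cell T i 0) : k ≤ i :=
  le_of_anchor_le (h.first_le i (lt_of_mem_cell hk)) hk

theorem IsSemistandard.anchor_inj {n : ℕ} {a : Fin n → ℕ} {T : SetFilling a}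
    (h : IsSemistandard T) {i j : Fin n} {c : ℕ} (hi : c < a i)
    (he : anchor T i c = anchor T j c) : i = j := by
  obtain ⟨x, hx⟩ := max_of_nonempty (h.cell_nonempty hi)
  refine h.column i j c x (mem_of_max hx) (mem_of_max (he.symm.trans hx))

/-! ### Moves and the quasiYamanouchi condition -/

section Move

variable {n : ℕ} {a : Fin n → ℕ} {m v : Fin n} {c₀ e : ℕ} {T' T : SetFilling a}

/-- The condition fails at `m` after the move: the leftmost `m` is in column `c₀`; an `m + 1` weakly
to its right could only be the copy of `v` kept in the same box; and if `c₀ = 0`, the row of the box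
is at least `v`, hence not `m`. -/
theorem IsMove.isYamanouchiFrom (h : IsMove m v c₀ e T' T) (hv : IsNext T' m v) (he : e ≤ 1)
    {i₀ : Fin n} (hi₀ : v ∈ cell T' i₀ c₀) (hT' : IsYamanouchiFrom m T') :
    IsYamanouchiFrom (m + 1) T ∧ m ∈ cell T i₀ c₀ ∧ ¬ YamanouchiAt T m := by
  have hs' := hT'.quasi.semistandard
  have hs : IsSemistandard T := (h.isSemistandard_iff hv he fun _ =>
    ⟨i₀, hi₀, fun i hi => hs'.column _ _ _ _ hi hi₀⟩).2 hs'
  have hm : m ∈ cell T i₀ c₀ := (h.mem_left hv).2 ⟨le_rfl, hi₀⟩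
  have hmv := hv.lt
  refine ⟨⟨⟨hs, fun i hi => (h.anchor_le hv i 0).trans (hT'.quasi.first_le i hi),
    fun i j hij hi hj => ?_⟩, fun k hk => ?_⟩, hm, fun hY => ?_⟩
  · refine lt_of_not_ge fun hle => ?_
    exact absurd (h.anchor_mono hv hle) (not_le.2 (hT'.quasi.first_lt i j hij hi hj))
  · have hkm : m < k := hk
    intro i c hki hmin
    have hki' : k ∈ cell T' i c := (h.mem_iff hv).2 (Or.inl ⟨hkm.ne', hki⟩)
    have hvk := hv.gap i c k hki' hkm.le
    have hmin' : ∀ i' c', k ∈ cell T' i' c' → c ≤ c' := by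
      intro i' c' hk'
      by_cases hkv : k = v
      · subst hkv
        rw [h.mem_right hv] at hki
        by_cases hc' : c' < c₀ + e
        · exact hmin i' c' ((h.mem_right hv).2 ⟨hc', hk'⟩)
        · omega
      · exact hmin i' c' ((h.mem_of_ne hkm.ne' hkv).2 hk')
    rcases hT'.yamanouchi k hkm.le i c hki' hmin' with ⟨h1, h2, h3⟩ | ⟨k', h1, i', c', h2, h3, h4⟩
    · refine Or.inl ⟨h1, h2, anchor_eq_of_forall hki fun y hy => ?_⟩
      exact le_of_anchor_le ((h.anchor_le hv i c).trans h3.le) hy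
    · have hkk : k < k' := by rw [Fin.lt_def]; omega
      exact Or.inr ⟨k', h1, i', c', h2,
        (h.mem_of_ne (hkm.trans hkk).ne' (hvk.trans_lt hkk).ne').2 h3, h4⟩
  · rcases hY i₀ c₀ hm fun i' c' hm' => ((h.mem_left hv).1 hm').1 with
      ⟨rfl, rfl, -⟩ | ⟨k', h1, i', c', h2, h3, h4⟩
    · exact absurd (hT'.quasi.mem_zero_le hi₀) (not_le.2 hmv)
    · have hmk : m < k' := by rw [Fin.lt_def]; omega
      have hk' : k' ∈ cell T' i' c' := (h.mem_iff hv).2 (Or.inl ⟨hmk.ne', h3⟩)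
      have hvk := hv.gap i' c' k' hk' hmk.le
      obtain rfl : k' = v := le_antisymm (by rw [Fin.le_def]; rw [Fin.lt_def] at hmv; omega) hvk
      rw [h.mem_right hv] at h3
      obtain rfl : c' = c₀ := by omega
      exact h4 (by rw [hs'.column _ _ _ _ h3.2 hi₀])

open Classical in
/-- Replace all entries `m` by `u`. -/
def mergeFilling (T : SetFilling a) (m u : Fin n) : SetFilling a :=
  fun i c => (T i c).image fun k => if k = m then u else k

theorem mem_mergeFilling {u k i : Fin n} {c : ℕ} (hmu : m ≠ u) :
    k ∈ cell (mergeFilling T m u) i c ↔ (k ≠ m ∧ k ∈ cell T i c) ∨ (k = u ∧ m ∈ cell T i c) := by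
  by_cases hc : c < a i
  · simp only [cell, hc, dif_pos, mergeFilling, mem_image]
    constructor
    · rintro ⟨x, hx, rfl⟩
      split_ifs with hxm
      · exact Or.inr ⟨rfl, hxm ▸ hx⟩
      · exact Or.inl ⟨hxm, hx⟩
    · rintro (⟨h1, h2⟩ | ⟨rfl, h2⟩)
      · exact ⟨k, h2, by simp [h1]⟩
      · exact ⟨m, h2, by simp⟩
  · simp [cell, hc]

/-- All entries `m` are raised to the least `u > m` at which the result can satisfy the condition.
Minimality of `u` and the failure at `m` imply that `u` does not occur weakly right of column `c₀`,
except possibly in the box of the leftmost `m`; hence raising can be undone by a move, with `e`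
recording that exception. -/
theorem IsYamanouchiFrom.exists_move (hT : IsYamanouchiFrom (m + 1) T) (hY : ¬ YamanouchiAt T m) :
    ∃ (T' : SetFilling a) (v : Fin n) (c₀ e : ℕ) (i₀ : Fin n), IsYamanouchiFrom m T' ∧
      IsNext T' m v ∧ v ∈ cell T' i₀ c₀ ∧ e < 2 ∧ IsMove m v c₀ e T' T := by
  have hs := hT.quasi.semistandard
  rw [YamanouchiAt] at hY
  push Not at hY
  obtain ⟨r, c₀, hm, hmin, hrow, hnext⟩ := hY
  -- The candidates: `u` occurs already, or the box is the first box of row `u` with anchor `m`, or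
  -- `u + 1` occurs weakly to the right in another box.
  let S : Fin n → Prop := fun u => m < u ∧ ((∃ i c, u ∈ cell T i c) ∨
    (c₀ = 0 ∧ r = u ∧ anchor T r c₀ = m) ∨
    ∃ k' : Fin n, (k' : ℕ) = u + 1 ∧ ∃ i' c', c₀ ≤ c' ∧ k' ∈ cell T i' c' ∧ (i', c') ≠ (r, c₀))
  -- Without a candidate no entry exceeds `m`, so row `r` holds `m` everywhere up to column `c₀`.
  -- Thus `c₀ = 0` and `m` is the anchor; failure of the condition at `m` gives `r ≠ m`, and then
  -- `r` itself is a candidate.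
  have hex : ∃ u, S u := by
    by_contra hne
    have hle : ∀ i c k, k ∈ cell T i c → k ≤ m := fun i c k hk => not_lt.1 fun hlt =>
      hne ⟨k, hlt, Or.inl ⟨i, c, hk⟩⟩
    have hcell : ∀ c ≤ c₀, m ∈ cell T r c := by
      intro c hc
      induction hc using Nat.decreasingInduction with
      | of_succ c _ ih =>
        obtain ⟨x, hx⟩ := hs.cell_nonempty (lt_of_le_of_lt (Nat.le_succ c) (lt_of_mem_cell ih))
        rwa [le_antisymm (hs.row r c x hx m ih) (hle r c x hx)]
      | self => exact hm
    have h0 : c₀ = 0 := Nat.le_zero.1 (hmin r 0 (hcell 0 (Nat.zero_le _)))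
    have hanc : anchor T r c₀ = m := anchor_eq_of_forall hm fun y hy => hle r c₀ y hy
    subst h0
    have hmr : m < r := lt_of_le_of_ne (hT.quasi.mem_zero_le hm) fun he => hrow rfl he.symm hanc
    exact hne ⟨r, hmr, Or.inr (Or.inl ⟨rfl, rfl, hanc⟩)⟩
  obtain ⟨u, hu, humin⟩ : ∃ u, S u ∧ ∀ x, S x → u ≤ x := by
    classical
    obtain ⟨u, h1, h2⟩ := exists_min_image (univ.filter S) id (by simpa [Finset.Nonempty] using hex)
    exact ⟨u, (mem_filter.1 h1).2, fun x hx => h2 x (by simpa using hx)⟩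
  have hmu := hu.1
  have hgapT : ∀ i c k, k ∈ cell T i c → m < k → u ≤ k := fun i c k hk hlt =>
    humin k ⟨hlt, Or.inl ⟨i, c, hk⟩⟩
  -- An entry `u` there in another box would satisfy the condition at `m` if `u = m + 1`, and would
  -- make `u - 1` a smaller candidate otherwise.
  have hright : ∀ i c, u ∈ cell T i c → c₀ ≤ c → (i, c) = (r, c₀) := by
    intro i c hui hc
    by_contra hne
    by_cases hum : (u : ℕ) = m + 1
    · exact hne (hnext u hum i c hc hui)
    · rw [Fin.lt_def] at hmu
      have h1 := humin ⟨u - 1, by omega⟩ ⟨by rw [Fin.lt_def]; dsimp only; omega,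
        Or.inr (Or.inr ⟨u, by dsimp only; omega, i, c, hc, hui, hne⟩)⟩
      rw [Fin.le_def] at h1
      dsimp only at h1
      omega
  have hmem := fun (k i : Fin n) (c : ℕ) => mem_mergeFilling (T := T) (k := k) (i := i) (c := c) hmu.ne
  set T' := mergeFilling T m u with hT'
  have hnextT : IsNext T' m u := by
    refine ⟨hmu, ⟨r, c₀, (hmem _ _ _).2 (Or.inr ⟨rfl, hm⟩)⟩, fun i c k hk hmk => ?_⟩
    rcases (hmem _ _ _).1 hk with ⟨h1, h2⟩ | ⟨rfl, -⟩
    · exact hgapT i c k h2 (lt_of_le_of_ne hmk (Ne.symm h1))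
    · exact le_rfl
  have humem : ∀ i c, u ∈ cell T' i c ↔ u ∈ cell T i c ∨ m ∈ cell T i c := fun i c => by
    rw [hmem]
    simp [hmu.ne']
  classical
  obtain ⟨e, he, heiff⟩ : ∃ e < 2, e = 1 ↔ u ∈ cell T r c₀ := by
    by_cases hur : u ∈ cell T r c₀
    · exact ⟨1, by norm_num, by simpa using hur⟩
    · exact ⟨0, by norm_num, by simpa using hur⟩
  have hmove : IsMove m u c₀ e T' T := by
    intro i c k
    by_cases hkm : k = m
    · subst hkm
      rw [humem]
      constructor
      · exact fun h => Or.inr (Or.inl ⟨rfl, hmin i c h, Or.inr h⟩)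
      · rintro (⟨h, -⟩ | ⟨-, h1, h2 | h2⟩ | ⟨h, -⟩)
        · exact absurd rfl h
        · have := hright i c h2 h1
          rw [Prod.mk.injEq] at this
          rw [this.1, this.2]; exact hm
        · exact h2
        · exact absurd h hmu.ne
    by_cases hku : k = u
    · subst hku
      rw [humem]
      constructor
      · intro h
        refine Or.inr (Or.inr ⟨rfl, ?_, Or.inl h⟩)
        by_contra hc
        have := hright i c h (by omega)
        rw [Prod.mk.injEq] at this
        obtain ⟨rfl, rfl⟩ := this
        have := heiff.2 h
        omega
      · rintro (⟨-, h, -⟩ | ⟨h, -⟩ | ⟨-, h1, h2 | h2⟩)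
        · exact absurd rfl h
        · exact absurd h hkm
        · exact h2
        · have h3 := hmin i c h2
          obtain rfl : c = c₀ := by omega
          rw [hs.column i r c m h2 hm]
          exact heiff.1 (by omega)
    · rw [hmem]
      simp [hkm, hku]
  have hs' : IsSemistandard T' := (hmove.isSemistandard_iff hnextT (by omega) fun h1 =>
    ⟨r, (humem _ _).2 (Or.inr hm), fun i hi => by
      rcases (humem _ _).1 hi with hi | hi
      · exact hs.column i r c₀ u hi (heiff.1 h1)
      · exact hs.column i r c₀ m hi hm⟩).1 hs
  have hquasi : IsQuasiFilling T' := by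
    refine ⟨hs', fun i hi => Finset.max_le fun k hk => WithBot.coe_le_coe.2 ?_,
      fun i j hij hi hj => ?_⟩
    · rcases (hmem _ _ _).1 hk with ⟨-, h2⟩ | ⟨rfl, h2⟩
      · exact hT.quasi.mem_zero_le h2
      · have h0 : c₀ = 0 := Nat.le_zero.1 (hmin i 0 h2)
        subst h0
        obtain rfl := hs.column i r 0 m h2 hm
        by_cases hanc : anchor T i 0 = m
        · refine humin i ⟨lt_of_le_of_ne (hT.quasi.mem_zero_le hm) fun he => hrow rfl he.symm hanc,
            Or.inr (Or.inl ⟨rfl, rfl, hanc⟩)⟩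
        · have : ∃ y ∈ cell T i 0, m < y := by
            by_contra! hne
            exact hanc (anchor_eq_of_forall h2 hne)
          obtain ⟨y, hy, hmy⟩ := this
          exact (hgapT i 0 y hy hmy).trans (hT.quasi.mem_zero_le hy)
    · refine lt_of_le_of_ne (hmove.anchor_mono hnextT (hT.quasi.first_lt i j hij hi hj).le) fun he => ?_
      exact hij.ne (hs'.anchor_inj hi he)
  refine ⟨T', u, c₀, e, r, ⟨hquasi, fun k hk i c hki hleft => ?_⟩, hnextT,
    (humem _ _).2 (Or.inr hm), he, hmove⟩
  have huk : u ≤ k := hnextT.gap i c k hki hk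
  have hkey : k ∈ cell T i c → (∀ i' c', k ∈ cell T i' c' → c ≤ c') → m < k →
      (c = 0 ∧ i = k ∧ anchor T' i c = k) ∨
      ∃ k' : Fin n, (k' : ℕ) = k + 1 ∧ ∃ i' c', c ≤ c' ∧ k' ∈ cell T' i' c' ∧ (i', c') ≠ (i, c) := by
    intro hki hleft hmk
    rcases hT.yamanouchi k hmk i c hki hleft with ⟨h1, h2, h3⟩ | ⟨k', h1, i', c', h2, h3, h4⟩
    · refine Or.inl ⟨h1, h2, anchor_eq_of_forall ((hmem _ _ _).2 (Or.inl ⟨hmk.ne', hki⟩))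
        fun y hy => ?_⟩
      rcases (hmem _ _ _).1 hy with ⟨-, hy⟩ | ⟨rfl, -⟩
      · exact le_of_anchor_le h3.le hy
      · exact huk
    · refine Or.inr ⟨k', h1, i', c', h2, (hmem _ _ _).2 (Or.inl ⟨?_, h3⟩), h4⟩
      rintro rfl
      rw [Fin.lt_def] at hmk; omega
  rcases huk.eq_or_lt with rfl | huk
  · have hleft' : ∀ i' c', u ∈ cell T i' c' → c ≤ c' := fun i' c' h =>
      hleft i' c' ((humem _ _).2 (Or.inl h))
    rcases (humem _ _).1 hki with hki | hki
    · exact hkey hki hleft' hmu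
    · have hc : c₀ ≤ c := hmin i c hki
      by_cases hu₀ : ∃ i' c', u ∈ cell T i' c'
      · obtain ⟨i', c', hu'⟩ := hu₀
        have h1 := hleft' i' c' hu'
        have h2 := hright i' c' hu' (hc.trans h1)
        rw [Prod.mk.injEq] at h2
        obtain ⟨rfl, rfl⟩ := h2
        obtain rfl : c = c' := le_antisymm h1 hc
        obtain rfl := hs.column i i' c m hki hm
        exact hkey hu' hleft' hmu
      · obtain rfl : c = c₀ := le_antisymm (hleft r c₀ ((humem _ _).2 (Or.inr hm))) hc
        obtain rfl := hs.column i r c m hki hm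
        rcases hu.2 with h1 | ⟨h1, h2, h3⟩ | ⟨k', h1, i', c', h2, h3, h4⟩
        · exact absurd h1 hu₀
        · refine Or.inl ⟨h1, h2, anchor_eq_of_forall ((humem _ _).2 (Or.inr hm)) fun y hy => ?_⟩
          rcases (hmem _ _ _).1 hy with ⟨-, hy⟩ | ⟨rfl, -⟩
          · exact (le_of_anchor_le h3.le hy).trans hmu.le
          · exact le_rfl
        · refine Or.inr ⟨k', h1, i', c', h2, (hmem _ _ _).2 (Or.inl ⟨?_, h3⟩), h4⟩
          rintro rfl
          rw [Fin.lt_def] at hmu; omega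
  · have hmk := hmu.trans huk
    have hiff : ∀ i' c', k ∈ cell T' i' c' ↔ k ∈ cell T i' c' := fun i' c' => by
      rw [hmem]
      simp [hmk.ne', huk.ne']
    exact hkey ((hiff _ _).1 hki) (fun i' c' h => hleft i' c' ((hiff _ _).2 h)) hmk

/-- If `v₁ < v₂`, no `v₁` is left in `T`, so `v₁` starts in column `c₁` of `T₁`. The condition there
gives either row `v₁`, which is too low to hold `v₂` in the first column, or an entry `v₁ + 1 = v₂`
weakly to the right in another box, where `T` can no longer have `v₂`. -/
theorem IsMove.not_lt {T₁ T₂ : SetFilling a} {v₁ v₂ i₁ i₂ : Fin n} {c₁ c₂ e₁ e₂ : ℕ}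
    (h₁ : IsMove m v₁ c₁ e₁ T₁ T) (h₂ : IsMove m v₂ c₂ e₂ T₂ T) (hv₁ : IsNext T₁ m v₁)
    (hv₂ : IsNext T₂ m v₂) (hi₁ : v₁ ∈ cell T₁ i₁ c₁) (hi₂ : v₂ ∈ cell T₂ i₂ c₂) (he₂ : e₂ < 2)
    (hT₁ : IsYamanouchiFrom m T₁) (hT₂ : IsYamanouchiFrom m T₂) (hc : c₁ = c₂) (hi : i₁ = i₂) :
    ¬ v₁ < v₂ := by
  subst hc hi
  intro hlt
  have hgap : ∀ i c k, k ∈ cell T i c → m < k → v₂ ≤ k := fun i c k hk hmk =>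
    hv₂.gap i c k ((h₂.mem_iff hv₂).2 (Or.inl ⟨hmk.ne', hk⟩)) hmk.le
  have hno : ∀ i c, v₁ ∉ cell T i c := fun i c hk =>
    absurd (hgap i c v₁ hk hv₁.lt) (_root_.not_le.2 hlt)
  have hleft : ∀ i c, v₁ ∈ cell T₁ i c → c₁ ≤ c := by
    intro i c hk
    by_contra hc
    exact hno i c ((h₁.mem_right hv₁).2 ⟨by omega, hk⟩)
  rcases hT₁.yamanouchi v₁ (le_of_lt hv₁.lt) i₁ c₁ hi₁ hleft with
    ⟨rfl, rfl, -⟩ | ⟨k', h1, i', c', h2, h3, h4⟩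
  · exact absurd (hT₂.quasi.mem_zero_le hi₂) (_root_.not_le.2 hlt)
  · have hvk : v₁ < k' := by rw [Fin.lt_def]; omega
    have hmk := hv₁.lt.trans hvk
    have hk' := (h₁.mem_of_ne hmk.ne' hvk.ne').2 h3
    obtain rfl : k' = v₂ := le_antisymm (by rw [Fin.le_def]; rw [Fin.lt_def] at hlt; omega)
      (hgap _ _ _ hk' hmk)
    rw [h₂.mem_right hv₂] at hk'
    obtain rfl : c' = c₁ := by omega
    exact h4 (by rw [hT₂.quasi.semistandard.column _ _ _ _ hk'.2 hi₂])

theorem IsMove.unique {T₁ T₂ : SetFilling a} {v₁ v₂ i₁ i₂ : Fin n} {c₁ c₂ e₁ e₂ : ℕ}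
    (h₁ : IsMove m v₁ c₁ e₁ T₁ T) (h₂ : IsMove m v₂ c₂ e₂ T₂ T) (hv₁ : IsNext T₁ m v₁)
    (hv₂ : IsNext T₂ m v₂) (hi₁ : v₁ ∈ cell T₁ i₁ c₁) (hi₂ : v₂ ∈ cell T₂ i₂ c₂) (he₁ : e₁ < 2)
    (he₂ : e₂ < 2) (hT₁ : IsYamanouchiFrom m T₁) (hT₂ : IsYamanouchiFrom m T₂) :
    T₁ = T₂ ∧ c₁ = c₂ ∧ e₁ = e₂ := by
  obtain ⟨hT, hm₁, -⟩ := h₁.isYamanouchiFrom hv₁ (by omega) hi₁ hT₁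
  obtain ⟨-, hm₂, -⟩ := h₂.isYamanouchiFrom hv₂ (by omega) hi₂ hT₂
  obtain rfl : c₁ = c₂ := le_antisymm ((h₁.mem_left hv₁).1 hm₂).1 ((h₂.mem_left hv₂).1 hm₁).1
  obtain rfl := hT.quasi.semistandard.column _ _ _ _ hm₁ hm₂
  obtain rfl : v₁ = v₂ := le_antisymm
    (_root_.not_lt.1 (h₂.not_lt h₁ hv₂ hv₁ hi₂ hi₁ he₁ hT₂ hT₁ rfl rfl))
    (_root_.not_lt.1 (h₁.not_lt h₂ hv₁ hv₂ hi₁ hi₂ he₂ hT₁ hT₂ rfl rfl))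
  have hT : T₁ = T₂ := cell_injective fun i c => ext fun k =>
    (h₁.mem_iff hv₁).trans (h₂.mem_iff hv₂).symm
  subst hT
  refine ⟨rfl, rfl, ?_⟩
  have h3 := (h₁.mem_right hv₁ (i := i₁) (c := c₁)).symm.trans (h₂.mem_right hv₂)
  simp only [hi₁, and_true] at h3
  omega

end Move

/-! ### The glide expansion -/

theorem IsSemistandard.excess_add {n : ℕ} {a : Fin n → ℕ} {T : SetFilling a}
    (h : IsSemistandard T) : excess T + ∑ i, a i = ∑ k, wt T k := by
  have h1 : ∑ k, wt T k = ∑ i, ∑ c, (T i c).card := by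
    simp only [wt]
    rw [sum_comm]
    refine sum_congr rfl fun i _ => ?_
    rw [sum_comm]
    refine sum_congr rfl fun c _ => ?_
    simp
  rw [h1, excess, ← sum_add_distrib]
  refine sum_congr rfl fun i _ => ?_
  calc ∑ c, ((T i c).card - 1) + a i = ∑ c, (((T i c).card - 1) + 1) := by
        rw [sum_add_distrib]; simp
    _ = _ := sum_congr rfl fun c _ => Nat.sub_add_cancel (h.nonempty i c).card_pos

theorem sum_eq_sumBelow {n : ℕ} (f : Fin n → ℕ) : ∑ k, f k = sumBelow f n := by
  rw [sumBelow, filter_true_of_mem fun k _ => k.2]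

/-- Translates a sum over the starting column of a move into a sum over the number `s` of entries
moved. -/
theorem sum_card_filter_le {M : Type*} [AddCommMonoid M] (V : Finset ℕ) (f : ℕ → M) :
    ∑ c ∈ V, f #{d ∈ V | c ≤ d} = ∑ s ∈ Icc 1 #V, f s := by
  induction V using Finset.induction_on_min with
  | empty => simp
  | insert c V hc ih =>
    have hcV : c ∉ V := fun h => lt_irrefl _ (hc c h)
    rw [sum_insert hcV, card_insert_of_notMem hcV, Finset.sum_Icc_succ_top (by omega), add_comm,
      ← ih]
    congr 1
    · refine sum_congr rfl fun x hx => ?_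
      rw [filter_insert, if_neg (not_le.2 (hc x hx))]
    · rw [filter_insert, if_pos le_rfl, filter_true_of_mem fun x hx => (hc x hx).le,
        card_insert_of_notMem hcV]

/-! ### Weight and excess of a move -/

/-- The columns that contain `v`. -/
def columnsWith {n : ℕ} {a : Fin n → ℕ} (T : SetFilling a) (v : Fin n) : Finset ℕ :=
  {c ∈ range (univ.sup a) | v ∈ colUnion T c}

theorem mem_columnsWith {n : ℕ} {a : Fin n → ℕ} {T : SetFilling a} {v : Fin n} {c : ℕ} :
    c ∈ columnsWith T v ↔ ∃ i, v ∈ cell T i c := by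
  rw [columnsWith, mem_filter, mem_colUnion, mem_range]
  exact ⟨fun h => h.2, fun ⟨i, hi⟩ =>
    ⟨(lt_of_mem_cell hi).trans_le (Finset.le_sup (mem_univ i)), i, hi⟩⟩

theorem IsSemistandard.wt_eq_card {n : ℕ} {a : Fin n → ℕ} {T : SetFilling a}
    (h : IsSemistandard T) (k : Fin n) : wt T k = #(columnsWith T k) := by
  rw [h.wt_eq fun i => Finset.le_sup (mem_univ i), columnsWith, card_filter]

section Move

variable {n : ℕ} {a : Fin n → ℕ} {m v : Fin n} {c₀ e : ℕ} {T' T : SetFilling a}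

theorem IsMove.wt_eq (h : IsMove m v c₀ e T' T) (hv : IsNext T' m v) (he : e < 2) {i₀ : Fin n}
    (hi₀ : v ∈ cell T' i₀ c₀) (hs : IsSemistandard T) (hs' : IsSemistandard T') :
    wt T = shiftPart (wt T') m v #{c ∈ columnsWith T' v | c₀ ≤ c} e := by
  have hc₀ : c₀ ∈ columnsWith T' v := mem_columnsWith.2 ⟨i₀, hi₀⟩
  funext k
  rw [hs.wt_eq_card]
  by_cases hkm : k = m
  · subst hkm
    rw [shiftPart_left hv.lt]
    congr 1
    ext c
    rw [mem_filter, mem_columnsWith, mem_columnsWith]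
    simp only [h.mem_left hv, exists_and_left]
    tauto
  by_cases hkv : k = v
  · subst hkv
    have h1 : columnsWith T k = {c ∈ columnsWith T' k | c < c₀ + e} := by
      ext c
      rw [mem_filter, mem_columnsWith, mem_columnsWith]
      simp only [h.mem_right hv, exists_and_left]
      tauto
    have h2 := card_filter_add_card_filter_not (s := columnsWith T' k) (fun c => c₀ ≤ c)
    rw [shiftPart_right, hs'.wt_eq_card, h1]
    simp only [_root_.not_le] at h2
    have h3 : #{c ∈ columnsWith T' k | c < c₀ + e} = #{c ∈ columnsWith T' k | c < c₀} + e := by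
      obtain rfl | rfl : e = 0 ∨ e = 1 := by omega
      · simp
      · have : ({c ∈ columnsWith T' k | c < c₀ + 1} : Finset ℕ) =
            insert c₀ {c ∈ columnsWith T' k | c < c₀} := by
          ext c
          simp only [mem_filter, mem_insert]
          constructor
          · rintro ⟨h4, h5⟩
            rcases Nat.lt_succ_iff_lt_or_eq.1 h5 with h5 | h5
            · exact Or.inr ⟨h4, h5⟩
            · exact Or.inl h5
          · rintro (rfl | ⟨h4, h5⟩)
            · exact ⟨hc₀, Nat.lt_succ_self _⟩
            · exact ⟨h4, by omega⟩
        rw [this, card_insert_of_notMem (by simp)]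
    omega
  · rw [shiftPart_of_ne hkm hkv, hs'.wt_eq_card]
    congr 1
    ext c
    rw [mem_columnsWith, mem_columnsWith]
    simp only [h.mem_of_ne hkm hkv]

theorem IsNext.wt_eq_zero (hv : IsNext T m v) (hs : IsSemistandard T) (k : Fin n) (h1 : m ≤ k)
    (h2 : k < v) : wt T k = 0 := by
  rw [hs.wt_eq_card, card_eq_zero]
  refine eq_empty_iff_forall_notMem.2 fun c hc => ?_
  obtain ⟨i, hi⟩ := mem_columnsWith.1 hc
  exact absurd (hv.gap i c k hi h1) (_root_.not_le.2 h2)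

theorem IsMove.excess_eq (h : IsMove m v c₀ e T' T) (hv : IsNext T' m v) (he : e < 2) {i₀ : Fin n}
    (hi₀ : v ∈ cell T' i₀ c₀) (hs : IsSemistandard T) (hs' : IsSemistandard T') :
    excess T = excess T' + e := by
  have h1 := hs.excess_add
  have h2 := hs'.excess_add
  rw [sum_eq_sumBelow (wt T), h.wt_eq hv he hi₀ hs hs', sumBelow_shiftPart hv.lt
    (hv.wt_eq_zero hs' m le_rfl hv.lt), if_pos v.2, ← sum_eq_sumBelow, ← h2] at h1
  · omega
  · rw [hs'.wt_eq_card]; exact card_filter_le _ _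

end Move

/-! ### Summation over moves -/

open Classical in
/-- The pairs `(c₀, e)` that parametrize the moves of the next entry of `T`. -/
def moveIndices {n : ℕ} {a : Fin n → ℕ} (T : SetFilling a) (m : Fin n) : Finset (ℕ × ℕ) :=
  {x ∈ range (univ.sup a) ×ˢ range 2 | ∃ v, IsNext T m v ∧ x.1 ∈ columnsWith T v}

theorem mem_moveIndices {n : ℕ} {a : Fin n → ℕ} {T : SetFilling a} {m : Fin n} {x : ℕ × ℕ} :
    x ∈ moveIndices T m ↔ x.2 < 2 ∧ ∃ v, IsNext T m v ∧ ∃ i, v ∈ cell T i x.1 := by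
  classical
  rw [moveIndices, mem_filter, mem_product, mem_range, mem_range]
  simp only [mem_columnsWith]
  constructor
  · rintro ⟨⟨-, h1⟩, h2⟩; exact ⟨h1, h2⟩
  · rintro ⟨h1, v, hv, i, hi⟩
    exact ⟨⟨(lt_of_mem_cell hi).trans_le (Finset.le_sup (mem_univ i)), h1⟩, v, hv, i, hi⟩

/-- The contribution of a filling, in which the values from `m` on glide. -/
def glideTerm {n : ℕ} {a : Fin n → ℕ} (m : ℕ) (T : SetFilling a) : PolyBeta n :=
  (Polynomial.X ^ excess T : ℤ[X]) • glideFrom m (wt T)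

/-- The glide recursion at position `m`, read on fillings: `v` is the next value of `T`, `s` is the
number of columns from `c₀` on that contain `v`, and `ε = e`, which is also the change of the
excess. -/
theorem glideTerm_eq_add {n : ℕ} {a : Fin n → ℕ} {T : SetFilling a} {m : Fin n}
    (hT : IsYamanouchiFrom m T) : glideTerm m T = glideTerm (m + 1) T +
      ∑ x ∈ moveIndices T m, glideTerm (m + 1) (moveFilling T m x) := by
  have hs := hT.quasi.semistandard
  by_cases hex : ∃ v, IsNext T m v
  · obtain ⟨v, hv⟩ := hex
    have hidx : moveIndices T m = columnsWith T v ×ˢ range 2 := by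
      ext x
      rw [mem_moveIndices, mem_product, mem_columnsWith, mem_range]
      constructor
      · rintro ⟨h1, v', hv', hi⟩
        rw [hv.unique hv']
        exact ⟨hi, h1⟩
      · rintro ⟨hi, h1⟩
        exact ⟨h1, v, hv, hi⟩
    have hwv : wt T v ≠ 0 := by
      obtain ⟨i, c, hi⟩ := hv.mem
      rw [hs.wt_eq_card]
      exact card_ne_zero_of_mem (mem_columnsWith.2 ⟨i, hi⟩)
    rw [glideTerm, glideFrom_eq_add hv.lt (hv.wt_eq_zero hs) hwv, smul_add, hs.wt_eq_card v,
      ← sum_card_filter_le, hidx, sum_product, smul_sum]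
    refine congrArg₂ _ rfl (sum_congr rfl fun c hc => ?_)
    rw [smul_sum]
    refine sum_congr rfl fun e he => ?_
    obtain ⟨i, hi⟩ := mem_columnsWith.1 hc
    have he := mem_range.1 he
    have hmv := isMove_moveFilling (c, e) hv
    have hsT := (hmv.isYamanouchiFrom hv (by dsimp only; omega) hi hT).1.quasi.semistandard
    rw [glideTerm, hmv.excess_eq hv he hi hsT hs, hmv.wt_eq hv he hi hsT hs, smul_smul, pow_add]
  · have hempty : moveIndices T m = ∅ := eq_empty_iff_forall_notMem.2 fun x hx => by
      obtain ⟨-, v, hv, -⟩ := mem_moveIndices.1 hx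
      exact hex ⟨v, hv⟩
    rw [hempty, sum_empty, add_zero, glideTerm, glideTerm]
    congr 1
    -- If there is no next value, either `m` itself occurs or no value from `m` on does; in both
    -- cases the part at `m` is forced.
    by_cases hm : wt T m = 0
    · refine glideFrom_of_eq_zero fun k hk => ?_
      by_contra hne
      have hmem : ∀ k, wt T k ≠ 0 → ∃ i c, k ∈ cell T i c := fun k hk => by
        rw [hs.wt_eq_card] at hk
        obtain ⟨c, hc⟩ := card_ne_zero.1 hk
        obtain ⟨i, hi⟩ := mem_columnsWith.1 hc
        exact ⟨i, c, hi⟩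
      obtain ⟨v, h1, h2⟩ := exists_min_image ({k | m ≤ k ∧ wt T k ≠ 0} : Finset (Fin n)) id
        ⟨k, by simpa using ⟨hk, hne⟩⟩
      simp only [mem_filter, mem_univ, true_and, id_eq] at h1 h2
      refine hex ⟨v, lt_of_le_of_ne h1.1 ?_, hmem v h1.2, fun i c k hk hmk => h2 k ⟨hmk, ?_⟩⟩
      · rintro rfl
        exact h1.2 hm
      · rw [hs.wt_eq_card]
        exact card_ne_zero_of_mem (mem_columnsWith.2 ⟨i, hk⟩)
    · exact glideFrom_of_ne_zero hm

open Classical in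
-- A filling in the left sum that satisfies the condition at `m` occurs on the right too. Each of
-- the others is a move of exactly one filling of the right sum, and so is accounted for by
-- `glideTerm_eq_add`.
theorem sum_glideTerm_succ {n : ℕ} {a : Fin n → ℕ} (m : Fin n) :
    ∑ T : SetFilling a with IsYamanouchiFrom (m + 1) T, glideTerm (m + 1) T =
      ∑ T : SetFilling a with IsYamanouchiFrom m T, glideTerm m T := by
  have h1 : ∑ T : SetFilling a with IsYamanouchiFrom m T, glideTerm m T =
      ∑ T : SetFilling a with IsYamanouchiFrom m T, (glideTerm (m + 1) T +
        ∑ x ∈ moveIndices T m, glideTerm (m + 1) (moveFilling T m x)) :=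
    sum_congr rfl fun T hT => glideTerm_eq_add (mem_filter.1 hT).2
  rw [h1, sum_add_distrib, ← sum_filter_add_sum_filter_not _ (fun T => YamanouchiAt T m), filter_filter,
    filter_filter]
  congr 1
  · refine sum_congr (ext fun T => ?_) fun _ _ => rfl
    rw [mem_filter, mem_filter, ← isYamanouchiFrom_iff]
  · rw [sum_sigma']
    symm
    have hmv : ∀ p ∈ (univ.filter fun T : SetFilling a => IsYamanouchiFrom m T).sigma
        (fun T => moveIndices T m), ∃ v i, IsYamanouchiFrom m p.1 ∧ IsNext p.1 m v ∧
          v ∈ cell p.1 i p.2.1 ∧ p.2.2 < 2 ∧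
            IsMove m v p.2.1 p.2.2 p.1 (moveFilling p.1 m p.2) := by
      rintro ⟨T, x⟩ hp
      rw [mem_sigma, mem_filter, mem_moveIndices] at hp
      obtain ⟨⟨-, hT⟩, h2, v, hv, i, hi⟩ := hp
      exact ⟨v, i, hT, hv, hi, h2, isMove_moveFilling x hv⟩
    refine sum_bij (fun p _ => moveFilling p.1 m p.2) ?_ ?_ ?_ fun _ _ => rfl
    · intro p hp
      obtain ⟨v, i, hT, hv, hi, he, h⟩ := hmv p hp
      obtain ⟨h3, -, h4⟩ := h.isYamanouchiFrom hv (by omega) hi hT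
      exact mem_filter.2 ⟨mem_univ _, h3, h4⟩
    · intro p hp q hq hpq
      obtain ⟨v, i, hT, hv, hi, he, h⟩ := hmv p hp
      obtain ⟨v', i', hT', hv', hi', he', h'⟩ := hmv q hq
      rw [← hpq] at h'
      obtain ⟨T, c, e⟩ := p
      obtain ⟨T₁, c₁, e₁⟩ := q
      obtain ⟨h1, h2, h3⟩ := h.unique h' hv hv' hi hi' he he' hT hT'
      dsimp only at h1 h2 h3
      subst h1 h2 h3
      rfl
    · intro T hT
      obtain ⟨-, hT, hY⟩ := mem_filter.1 hT
      obtain ⟨T', v, c₀, e, i₀, h1, h2, h3, h4, h5⟩ := hT.exists_move hY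
      refine ⟨⟨T', (c₀, e)⟩, mem_sigma.2 ⟨mem_filter.2 ⟨mem_univ _, h1⟩,
        mem_moveIndices.2 ⟨h4, v, h2, i₀, h3⟩⟩, ?_⟩
      exact (isMove_moveFilling (c₀, e) h2).eq h5

open Classical in
/-- The glide expansion of the quasiLascoux polynomials. -/
theorem quasiLascoux_eq_sum_glide {n : ℕ} (a : Fin n → ℕ) :
    quasiLascoux a = ∑ S : SetFilling a with IsQuasiYamanouchi S,
      (Polynomial.X ^ excess S : ℤ[X]) • glide (wt S) := by
  have h1 : ∀ m ≤ n, ∑ T : SetFilling a with IsYamanouchiFrom m T, glideTerm m T =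
      ∑ T : SetFilling a with IsYamanouchiFrom 0 T, glideTerm 0 T := by
    intro m hm
    induction m with
    | zero => rfl
    | succ m ih => rw [← ih (by omega)]; exact sum_glideTerm_succ ⟨m, hm⟩
  rw [quasiLascoux_eq_sum_quasi]
  calc ∑ T : SetFilling a with IsQuasiFilling T, betaMonomial (excess T) (wt T)
      = ∑ T : SetFilling a with IsYamanouchiFrom n T, glideTerm n T := by
        simp only [isYamanouchiFrom_self, glideTerm, glideFrom_self, mul_betaMonomial, add_zero]
    _ = ∑ T : SetFilling a with IsYamanouchiFrom 0 T, glideTerm 0 T := h1 n le_rfl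
    _ = _ := by simp only [isYamanouchiFrom_zero, glideTerm, glideFrom_zero]

/-! ### Unitriangularity -/

theorem coeff_betaMonomial {n : ℕ} (k : ℕ) (w : Fin n → ℕ) (m : Fin n →₀ ℕ) :
    MvPolynomial.coeff m (betaMonomial k w) = if w = m then Polynomial.X ^ k else 0 := by
  classical
  rw [betaMonomial, MvPolynomial.coeff_monomial]
  refine if_congr ?_ rfl rfl
  rw [Equiv.symm_apply_eq]
  rfl

theorem monomial_eq_smul {n : ℕ} (m : Fin n →₀ ℕ) (p : ℤ[X]) :
    MvPolynomial.monomial m p = p • betaMonomial 0 (m : Fin n → ℕ) := by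
  have h : Finsupp.equivFunOnFinite.symm (m : Fin n → ℕ) = m :=
    Finsupp.equivFunOnFinite.symm_apply_apply m
  rw [betaMonomial, h, MvPolynomial.smul_monomial, pow_zero, smul_eq_mul, mul_one]

/-- The sum of the partial sums. -/
def height {n : ℕ} (a : Fin n → ℕ) : ℕ := ∑ i, ∑ j ∈ Iic i, a j

theorem Dominates.height_le {n : ℕ} {a b : Fin n → ℕ} (h : Dominates b a) : height a ≤ height b :=
  sum_le_sum fun i _ => h i

theorem Dominates.height_lt {n : ℕ} {a b : Fin n → ℕ} (h : Dominates b a) (hne : b ≠ a) :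
    height a < height b := by
  refine lt_of_le_of_ne h.height_le fun he => hne ?_
  have := (sum_eq_sum_iff_of_le fun i _ => h i).1 he
  exact h.antisymm fun i => (this i (mem_univ i)).ge

/-- The coefficients of a polynomial whose exponents dominate `a` and do not exceed its entries,
with leading term `x ^ a`. -/
structure HasLeadingTerm {n : ℕ} (f : PolyBeta n) (a : Fin n → ℕ) : Prop where
  coeff_self : MvPolynomial.coeff (Finsupp.equivFunOnFinite.symm a) f = 1
  dominates : ∀ m, MvPolynomial.coeff m f ≠ 0 → Dominates m a
  le : ∀ m, MvPolynomial.coeff m f ≠ 0 → ∀ k, m k ≤ univ.sup a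

theorem exists_minimal_of_ne_zero {n : ℕ} {l : (Fin n → ℕ) →₀ ℤ[X]} (hl : l ≠ 0) :
    ∃ a ∈ l.support, ∀ b ∈ l.support, height a ≤ height b :=
  exists_min_image _ _ (Finsupp.support_nonempty_iff.2 hl)

/-- If `x ^ a` occurs in `f b` with `b ≠ a`, then `a` dominates `b`, so `b` has smaller height and
is not in the support. -/
theorem coeff_linearCombination_of_minimal {n : ℕ} {f : (Fin n → ℕ) → PolyBeta n}
    (hf : ∀ a, HasLeadingTerm (f a) a) {l : (Fin n → ℕ) →₀ ℤ[X]} {a : Fin n → ℕ}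
    (hmin : ∀ b ∈ l.support, height a ≤ height b) :
    MvPolynomial.coeff (Finsupp.equivFunOnFinite.symm a) (Finsupp.linearCombination ℤ[X] f l) = l a := by
  rw [Finsupp.linearCombination_apply, Finsupp.sum, MvPolynomial.coeff_sum, Finset.sum_eq_single a]
  · rw [MvPolynomial.coeff_smul, (hf a).coeff_self, smul_eq_mul, mul_one]
  · intro b hb hba
    rw [MvPolynomial.coeff_smul]
    by_contra hne
    have h1 := (hf b).dominates _ (right_ne_zero_of_smul hne)
    exact absurd (hmin b hb) (not_le.2 (h1.height_lt (Ne.symm hba)))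
  · intro ha
    rw [Finsupp.notMem_support_iff.1 ha, zero_smul, MvPolynomial.coeff_zero]

theorem linearIndependent_of_hasLeadingTerm {n : ℕ} {f : (Fin n → ℕ) → PolyBeta n}
    (hf : ∀ a, HasLeadingTerm (f a) a) : LinearIndependent ℤ[X] f := by
  rw [linearIndependent_iff]
  intro l hl
  by_contra hne
  obtain ⟨a, ha, hmin⟩ := exists_minimal_of_ne_zero hne
  have := coeff_linearCombination_of_minimal hf hmin
  rw [hl, MvPolynomial.coeff_zero] at this
  exact Finsupp.mem_support_iff.1 ha this.symm

theorem height_le_of_le {n : ℕ} {w : Fin n → ℕ} {N : ℕ} (h : ∀ k, w k ≤ N) :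
    height w ≤ n * (n * N) := by
  calc height w ≤ ∑ _i : Fin n, ∑ _j : Fin n, N :=
        sum_le_sum fun i _ => (sum_le_sum_of_subset (subset_univ _)).trans (sum_le_sum fun j _ => h j)
    _ = n * (n * N) := by simp

/-- All terms of `f w` other than the leading one have larger height and respect the same bound `N`
on the exponents. Heights under this bound are at most `n * (n * N)`, so the induction is on the
room `d` that is left. -/
theorem betaMonomial_mem_span {n : ℕ} {f : (Fin n → ℕ) → PolyBeta n}
    (hf : ∀ a, HasLeadingTerm (f a) a) (N : ℕ) : ∀ d : ℕ, ∀ w : Fin n → ℕ, (∀ k, w k ≤ N) →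
      n * (n * N) ≤ height w + d → betaMonomial 0 w ∈ Submodule.span ℤ[X] (Set.range f) := by
  intro d
  induction d with
  | zero | succ d ih =>
    intro w hw hd
    have hsum := MvPolynomial.as_sum (f w)
    have hmem : Finsupp.equivFunOnFinite.symm w ∈ (f w).support := by
      rw [MvPolynomial.mem_support_iff, (hf w).coeff_self]; exact one_ne_zero
    rw [← add_sum_erase _ _ hmem, (hf w).coeff_self] at hsum
    have hbm : betaMonomial 0 w = f w - ∑ m ∈ (f w).support.erase (Finsupp.equivFunOnFinite.symm w),
        MvPolynomial.monomial m (MvPolynomial.coeff m (f w)) := by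
      rw [eq_sub_iff_add_eq, betaMonomial, pow_zero]
      exact hsum.symm
    rw [hbm]
    refine Submodule.sub_mem _ (Submodule.subset_span ⟨w, rfl⟩) (Submodule.sum_mem _ fun m hm => ?_)
    rw [mem_erase, MvPolynomial.mem_support_iff] at hm
    have hle : ∀ k, m k ≤ N := fun k =>
      ((hf w).le m hm.2 k).trans (Finset.sup_le fun i _ => hw i)
    have hlt := ((hf w).dominates m hm.2).height_lt fun he => hm.1 (by
      rw [← he]; exact (Finsupp.equivFunOnFinite.symm_apply_apply m).symm)
    rw [monomial_eq_smul]
    refine Submodule.smul_mem _ _ ?_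
    -- The first alternative is the induction step; for `d = 0` a further term would exceed the
    -- maximal height.
    first
      | exact ih m hle (by omega)
      | exact absurd (height_le_of_le hle) (by omega)

theorem span_eq_top_of_hasLeadingTerm {n : ℕ} {f : (Fin n → ℕ) → PolyBeta n}
    (hf : ∀ a, HasLeadingTerm (f a) a) : Submodule.span ℤ[X] (Set.range f) = ⊤ := by
  refine eq_top_iff.2 fun g _ => ?_
  rw [MvPolynomial.as_sum g]
  refine Submodule.sum_mem _ fun m _ => ?_
  rw [monomial_eq_smul]
  exact Submodule.smul_mem _ _ (betaMonomial_mem_span hf (univ.sup m) _ m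
    (fun k => Finset.le_sup (mem_univ k)) (Nat.le_add_left _ _))

/-! ### The leading term of a quasiLascoux polynomial -/

theorem IsQuasiFilling.mem_le {n : ℕ} {a : Fin n → ℕ} {T : SetFilling a} (h : IsQuasiFilling T)
    {i k : Fin n} {c : ℕ} (hk : k ∈ cell T i c) : k ≤ i := by
  have h1 := lt_top_of_mem hk
  have h2 := h.semistandard.isArray.antitone i (Nat.zero_le c)
  have h3 := h.tops_le i
  rw [Fin.le_def]
  simp only [tops] at h2 h3
  omega

/-- Every box in the rows up to `i` contains an entry that is at most `i`. -/
theorem IsQuasiFilling.dominates {n : ℕ} {a : Fin n → ℕ} {T : SetFilling a}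
    (h : IsQuasiFilling T) : Dominates (wt T) a := by
  intro i
  have h1 : ∑ k ∈ Iic i, wt T k = ∑ j, ∑ c, #{k ∈ Iic i | k ∈ T j c} := by
    simp only [wt]
    rw [sum_comm]
    refine sum_congr rfl fun j _ => ?_
    rw [sum_comm]
    refine sum_congr rfl fun c _ => ?_
    rw [card_filter]
  rw [h1]
  refine le_trans (sum_le_sum fun j hj => ?_) (sum_le_sum_of_subset (subset_univ (Iic i)))
  calc a j = ∑ _c : Fin (a j), 1 := by simp
    _ ≤ _ := sum_le_sum fun c _ => ?_
  obtain ⟨k, hk⟩ := h.semistandard.nonempty j c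
  refine card_pos.2 ⟨k, mem_filter.2 ⟨mem_Iic.2 ?_, hk⟩⟩
  rw [← cell_eq T] at hk
  exact (h.mem_le hk).trans (mem_Iic.1 hj)

theorem IsSemistandard.wt_le {n : ℕ} {a : Fin n → ℕ} {T : SetFilling a} (h : IsSemistandard T)
    (k : Fin n) : wt T k ≤ univ.sup a := by
  rw [h.wt_eq_card]
  exact (card_filter_le _ _).trans (card_range _).le

/-- The filling in which each row holds its own index. -/
def rowFilling {n : ℕ} (a : Fin n → ℕ) : SetFilling a := fun i _ => {i}

theorem cell_rowFilling {n : ℕ} {a : Fin n → ℕ} {i : Fin n} {c : ℕ} (h : c < a i) :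
    cell (rowFilling a) i c = {i} := by simp [cell, h, rowFilling]

theorem mem_cell_rowFilling {n : ℕ} {a : Fin n → ℕ} {i k : Fin n} {c : ℕ}
    (h : k ∈ cell (rowFilling a) i c) : k = i := by
  rw [cell_rowFilling (lt_of_mem_cell h)] at h
  exact mem_singleton.1 h

theorem anchor_rowFilling {n : ℕ} {a : Fin n → ℕ} {i : Fin n} {c : ℕ} (h : c < a i) :
    anchor (rowFilling a) i c = i := by rw [anchor, cell_rowFilling h, max_singleton]

theorem isQuasiFilling_rowFilling {n : ℕ} (a : Fin n → ℕ) : IsQuasiFilling (rowFilling a) := by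
  refine ⟨⟨fun i c => singleton_nonempty i, fun i j c k hi hj => ?_, fun i c x hx y hy => ?_,
    fun i j hij ha c hc => ?_, fun i j hij ha c hc => ?_, fun i c k hk hlt => ?_⟩, fun i hi => ?_,
    fun i j hij hi hj => ?_⟩
  · exact (mem_cell_rowFilling hi).symm.trans (mem_cell_rowFilling hj)
  · rw [mem_cell_rowFilling hx, mem_cell_rowFilling hy]
  · rw [anchor_rowFilling hc, anchor_rowFilling (by omega), anchor_rowFilling (by omega)]
    exact Or.inr ⟨le_rfl, WithBot.coe_lt_coe.2 hij⟩
  · rw [anchor_rowFilling (by omega), anchor_rowFilling (by omega), anchor_rowFilling hc]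
    exact Or.inl ⟨WithBot.coe_lt_coe.2 hij, le_rfl⟩
  · rw [mem_cell_rowFilling hk, anchor_rowFilling (lt_of_mem_cell hk)] at hlt
    exact absurd hlt (lt_irrefl _)
  · rw [anchor_rowFilling hi]
  · rw [anchor_rowFilling hi, anchor_rowFilling hj]
    exact WithBot.coe_lt_coe.2 hij

theorem wt_rowFilling {n : ℕ} (a : Fin n → ℕ) : wt (rowFilling a) = a := by
  funext k
  simp [wt, rowFilling]

theorem excess_rowFilling {n : ℕ} (a : Fin n → ℕ) : excess (rowFilling a) = 0 := by
  simp [excess, rowFilling]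

theorem sum_mul_wt {n : ℕ} {a : Fin n → ℕ} (T : SetFilling a) :
    ∑ k : Fin n, (k : ℕ) * wt T k = ∑ i, ∑ c, ∑ k ∈ T i c, (k : ℕ) := by
  simp only [wt, mul_sum]
  rw [sum_comm]
  refine sum_congr rfl fun i _ => ?_
  rw [sum_comm]
  refine sum_congr rfl fun c _ => ?_
  simp

/-- Weight `a` leaves no free entries. The sum of all entries is then that of `rowFilling a`, while
each single entry is at most its row index; so equality holds in every box. -/
theorem IsQuasiFilling.eq_rowFilling {n : ℕ} {a : Fin n → ℕ} {T : SetFilling a}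
    (h : IsQuasiFilling T) (hw : wt T = a) : T = rowFilling a := by
  have hex : excess T = 0 := by
    have := h.semistandard.excess_add
    rw [hw] at this
    omega
  have hcard : ∀ i c, #(T i c) = 1 := fun i c => by
    have h1 := card_le_one_of_excess hex i c
    rw [cell_eq T] at h1
    have h2 := (h.semistandard.nonempty i c).card_pos
    omega
  have hle : ∀ i c, ∑ k ∈ T i c, (k : ℕ) ≤ ∑ k ∈ rowFilling a i c, (k : ℕ) := by
    intro i c
    obtain ⟨k, hk⟩ := card_eq_one.1 (hcard i c)
    have h1 : k ∈ cell T i c := by rw [cell_eq T, hk]; exact mem_singleton_self k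
    rw [hk, rowFilling, sum_singleton, sum_singleton]
    exact h.mem_le h1
  have hsum := (sum_mul_wt T).symm.trans (by rw [hw, ← sum_mul_wt (rowFilling a), wt_rowFilling] :
    ∑ k : Fin n, (k : ℕ) * wt T k = ∑ i, ∑ c, ∑ k ∈ rowFilling a i c, (k : ℕ))
  rw [sum_eq_sum_iff_of_le fun i _ => sum_le_sum fun c _ => hle i c] at hsum
  funext i c
  have h1 := (sum_eq_sum_iff_of_le fun c _ => hle i c).1 (hsum i (mem_univ i)) c (mem_univ c)
  obtain ⟨k, hk⟩ := card_eq_one.1 (hcard i c)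
  rw [hk, rowFilling, sum_singleton, sum_singleton] at h1
  rw [hk, rowFilling, Fin.ext h1]

open Classical in
theorem coeff_quasiLascoux {n : ℕ} (a : Fin n → ℕ) (m : Fin n →₀ ℕ) :
    MvPolynomial.coeff m (quasiLascoux a) =
      ∑ T : SetFilling a with IsQuasiFilling T, if wt T = m then Polynomial.X ^ excess T else 0 := by
  rw [quasiLascoux_eq_sum_quasi, MvPolynomial.coeff_sum]
  exact sum_congr rfl fun T _ => coeff_betaMonomial _ _ _

theorem exists_of_coeff_quasiLascoux_ne_zero {n : ℕ} {a : Fin n → ℕ} {m : Fin n →₀ ℕ}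
    (h : MvPolynomial.coeff m (quasiLascoux a) ≠ 0) :
    ∃ T : SetFilling a, IsQuasiFilling T ∧ wt T = m := by
  classical
  rw [coeff_quasiLascoux] at h
  obtain ⟨T, hT, hne⟩ := exists_ne_zero_of_sum_ne_zero h
  refine ⟨T, (mem_filter.1 hT).2, ?_⟩
  by_contra hw
  exact hne (if_neg hw)

theorem hasLeadingTerm_quasiLascoux {n : ℕ} (a : Fin n → ℕ) :
    HasLeadingTerm (quasiLascoux a) a := by
  classical
  refine ⟨?_, fun m hm => ?_, fun m hm k => ?_⟩
  · rw [coeff_quasiLascoux, Finset.sum_eq_single (rowFilling a)]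
    · rw [wt_rowFilling, excess_rowFilling, pow_zero]
      exact if_pos rfl
    · intro T hT hne
      exact if_neg fun hw => hne ((mem_filter.1 hT).2.eq_rowFilling hw)
    · exact fun h => absurd (mem_filter.2 ⟨mem_univ _, isQuasiFilling_rowFilling a⟩) h
  · obtain ⟨T, hT, hw⟩ := exists_of_coeff_quasiLascoux_ne_zero hm
    rw [← hw]; exact hT.dominates
  · obtain ⟨T, hT, hw⟩ := exists_of_coeff_quasiLascoux_ne_zero hm
    rw [← hw]; exact hT.semistandard.wt_le k

/-! ### Right-justified compositions -/

/-- All zeros precede the nonzero entries. -/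
def RightJustified {n : ℕ} (a : Fin n → ℕ) : Prop := ∀ i j, i < j → a i ≠ 0 → a j ≠ 0

theorem rightJustified_of_succ {n : ℕ} {a : Fin n → ℕ}
    (h : ∀ i j : Fin n, (j : ℕ) = i + 1 → a i ≠ 0 → a j ≠ 0) : RightJustified a := by
  intro i j hij hi
  have key : ∀ d : ℕ, ∀ j : Fin n, (j : ℕ) = i + d → a j ≠ 0 := by
    intro d
    induction d with
    | zero => intro j hj; rwa [Fin.ext hj]
    | succ d ih =>
      intro j hj
      exact h ⟨i + d, by omega⟩ j (by dsimp only; omega) (ih _ rfl)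
  rw [Fin.lt_def] at hij
  exact key (j - i) j (by omega)

/-- From position `p k` on there are no zeros, so there are as few positions after `p k` as the
remaining entries permit. -/
theorem RightJustified.le_position {n : ℕ} {a : Fin n → ℕ} (h : RightJustified a) {L : List ℕ}
    {p q : Fin L.length → Fin n} (hp : IsSpread a L p) (hq : StrictMono q) (k : Fin L.length) :
    q k ≤ p k := by
  have h1 : #(Ici (p k)) ≤ #(Ici k) := by
    refine (card_le_card (t := (Ici k).image p) fun i hi => ?_).trans card_image_le
    rw [mem_Ici] at hi
    have hi0 : a i ≠ 0 := by
      have hk : a (p k) ≠ 0 := by rw [hp.val]; exact (hp.pos _ (List.get_mem _ _)).ne'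
      rcases hi.eq_or_lt with hi | hi
      · rwa [← hi]
      · exact h _ _ hi hk
    obtain ⟨k', rfl⟩ := hp.supp i hi0
    exact mem_image_of_mem _ (mem_Ici.2 (hp.mono.le_iff_le.1 hi))
  have h2 : #(Ici k) ≤ #(Ici (q k)) := by
    refine card_le_card_of_injOn q (fun k' hk' => ?_) hq.injective.injOn
    rw [coe_Ici, Set.mem_Ici] at hk' ⊢
    exact hq.monotone hk'
  have h3 := h1.trans h2
  rw [Fin.card_Ici, Fin.card_Ici] at h3
  rw [Fin.le_def]
  omega

theorem exists_rightJustified {n : ℕ} {α : List ℕ} (h : ∀ x ∈ α, 0 < x) (hl : α.length ≤ n) :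
    ∃ a : Fin n → ℕ, RightJustified a ∧ positivePart a = α := by
  let p : Fin α.length → Fin n := fun k => ⟨n - α.length + k, by omega⟩
  have hp : StrictMono p := fun k k' hk => by
    rw [Fin.lt_def] at hk ⊢
    dsimp only [p]
    omega
  have hs := isSpread_spread hp h
  refine ⟨spread α p, fun i j hij hi => ?_, hs.positivePart_eq⟩
  obtain ⟨k, rfl⟩ := hs.supp i hi
  rw [Fin.lt_def] at hij
  dsimp only [p] at hij
  have hj : j = p ⟨j - (n - α.length), by omega⟩ := by
    rw [Fin.ext_iff]; dsimp only [p]; omega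
  rw [hj, hs.val]
  exact (h _ (List.get_mem _ _)).ne'

theorem length_positivePart_le {n : ℕ} (a : Fin n → ℕ) : (positivePart a).length ≤ n :=
  (List.length_filter_le _ _).trans (List.length_ofFn).le

theorem RightJustified.quasiGrothendieck_eq {n : ℕ} {a : Fin n → ℕ} (h : RightJustified a) :
    quasiGrothendieck n (positivePart a) = quasiLascoux a := by
  rw [quasiGrothendieck, quasiLascoux]
  refine sum_congr (ext fun b => ?_) fun _ _ => rfl
  rw [Set.Finite.mem_toFinset, Set.Finite.mem_toFinset]
  refine ⟨fun hb => ⟨?_, hb⟩, fun hb => hb.2⟩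
  obtain ⟨p, hp⟩ := exists_isSpread (rfl : positivePart a = positivePart a)
  obtain ⟨q, hq⟩ := exists_isSpread (show positivePart b = positivePart a from hb)
  exact (hp.dominates_iff hq).2 (h.le_position hp hq.mono)

/-! ### Quasisymmetry of glide polynomials -/

/-- For right-justified `w` the bounds on the cuts of a glide are automatic. -/
theorem isGlideSum_iff_of_rightJustified {n : ℕ} {w b : Fin n → ℕ} {R : Finset (Fin n)}
    (hw : RightJustified w) : IsGlideSum w b R ↔ (∀ k ∈ R, 0 < b k) ∧
      sumBelow (net b R) n = sumBelow w n ∧ BlackFrom b R 0 ∧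
      ∀ p ≤ n, ∃ e ≤ n, sumBelow (net b R) e = sumBelow w p ∧ BlackFrom b R e := by
  constructor
  · intro h
    refine ⟨h.pos, h.total, ?_, fun p hp => ?_⟩
    · obtain ⟨e, he, -, h2⟩ := h.cut 0 (Nat.zero_le _)
      rwa [Nat.le_zero.1 he] at h2
    · obtain ⟨e, he, h1⟩ := h.cut p hp
      exact ⟨e, he.trans hp, h1⟩
  · rintro ⟨hpos, htotal, h0, hcut⟩
    refine ⟨hpos, htotal, fun p hp => ?_⟩
    induction hp using Nat.decreasingInduction with
    | self => exact hcut n le_rfl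
    | of_succ p hp ih =>
      -- If the entry at `p` is zero, all earlier ones are, and the cut `0` serves. Otherwise the
      -- net sum up to the cut for `p + 1` is strictly larger, which forces any cut for `p` to lie
      -- further left.
      by_cases hwp : w ⟨p, hp⟩ = 0
      · refine ⟨0, Nat.zero_le _, ?_, h0⟩
        rw [sumBelow_zero, ← sumBelow_zero w, sumBelow_eq_iff _ (Nat.zero_le _)]
        intro k _ hk
        by_contra hne
        exact hw k ⟨p, hp⟩ hk hne hwp
      · obtain ⟨e, he, h1, -⟩ := ih
        obtain ⟨d, hd, h2, h3⟩ := hcut p (le_of_lt hp)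
        refine ⟨d, ?_, h2, h3⟩
        by_contra hlt
        have h4 := sumBelow_mono (net b R) (show e ≤ d by omega)
        have h5 := sumBelow_succ w ⟨p, hp⟩
        dsimp only at h5
        omega

section Swap

variable {n : ℕ} {i j : Fin n} {b : Fin n → ℕ} {R : Finset (Fin n)}

theorem mem_image_swap {k : Fin n} : k ∈ R.image (Equiv.swap i j) ↔ Equiv.swap i j k ∈ R := by
  rw [mem_image]
  constructor
  · rintro ⟨x, hx, rfl⟩
    rwa [Equiv.swap_apply_self]
  · exact fun h => ⟨_, h, Equiv.swap_apply_self _ _ _⟩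

theorem net_swap (k : Fin n) :
    net (b ∘ Equiv.swap i j) (R.image (Equiv.swap i j)) k = net b R (Equiv.swap i j k) := by
  simp only [net, mem_image_swap, Function.comp_apply]

theorem swap_lt_iff (hij : (j : ℕ) = i + 1) {e : ℕ} (he : e ≠ j) (k : Fin n) :
    (Equiv.swap i j k : ℕ) < e ↔ (k : ℕ) < e := by
  rw [Equiv.swap_apply_def]
  split_ifs with h1 h2
  · subst h1; omega
  · subst h2; omega
  · rfl

theorem sumBelow_swap (hij : (j : ℕ) = i + 1) {e : ℕ} (he : e ≠ j) (f : Fin n → ℕ) :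
    sumBelow (fun k => f (Equiv.swap i j k)) e = sumBelow f e := by
  rw [sumBelow, sumBelow]
  refine sum_bij (fun k _ => Equiv.swap i j k) (fun k hk => ?_)
    (fun k _ k' _ h => (Equiv.swap i j).injective h) (fun k hk => ⟨Equiv.swap i j k, ?_, by simp⟩)
    fun _ _ => rfl
  · simpa [swap_lt_iff hij he] using hk
  · simpa [swap_lt_iff hij he] using hk

theorem swap_lt_swap_of_lt (hij : (j : ℕ) = i + 1) {x y : Fin n} (h : x < y)
    (hne : ¬ (x = i ∧ y = j)) : Equiv.swap i j x < Equiv.swap i j y := by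
  rw [Equiv.swap_apply_def, Equiv.swap_apply_def]
  simp only [Fin.lt_def, Fin.ext_iff] at *
  split_ifs <;> omega

/-- The exchange of neighbours reverses the order of `i` and `j` only, and one of these two parts is
zero. -/
theorem BlackFrom.swap (hij : (j : ℕ) = i + 1) (hb : b i = 0 ∨ b j = 0) {e : ℕ} (he : e ≠ j)
    (h : BlackFrom b R e) : BlackFrom (b ∘ Equiv.swap i j) (R.image (Equiv.swap i j)) e := by
  intro k hk hk' hmin
  rw [mem_image_swap]
  have hge : ∀ x : Fin n, e ≤ x → e ≤ (Equiv.swap i j x : ℕ) := fun x hx => by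
    have := swap_lt_iff hij he x
    omega
  refine h _ (hge k hk) hk' fun x hx hlt => ?_
  by_cases hxi : x = i ∧ Equiv.swap i j k = j
  · obtain ⟨rfl, h2⟩ := hxi
    refine hb.resolve_right fun h3 => hk' ?_
    rw [Function.comp_apply, h2, h3]
  · have h1 := swap_lt_swap_of_lt hij hlt hxi
    rw [Equiv.swap_apply_self] at h1
    have := hmin _ (hge x hx) h1
    rwa [Function.comp_apply, Equiv.swap_apply_self] at this

theorem IsGlideSum.swap {w : Fin n → ℕ} (hw : RightJustified w) (hij : (j : ℕ) = i + 1)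
    (hb : b i = 0 ∨ b j = 0) (h : IsGlideSum w b R) :
    IsGlideSum w (b ∘ Equiv.swap i j) (R.image (Equiv.swap i j)) := by
  rw [isGlideSum_iff_of_rightJustified hw] at h ⊢
  obtain ⟨hpos, htotal, h0, hcut⟩ := h
  have hnet : net (b ∘ Equiv.swap i j) (R.image (Equiv.swap i j)) =
      fun k => net b R (Equiv.swap i j k) := funext net_swap
  have hzero : ∀ k, b k = 0 → net b R k = 0 := fun k hk => by simp [net, hk]
  refine ⟨fun k hk => hpos _ (mem_image_swap.1 hk), ?_, h0.swap hij hb (by omega), fun p hp => ?_⟩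
  · rw [hnet, sumBelow_swap hij (by omega), htotal]
  · obtain ⟨e, he, h1, h2⟩ := hcut p hp
    rw [hnet]
    -- Only a cut between `i` and `j` is not respected by the exchange; it is first pushed across
    -- whichever of the two parts vanishes.
    by_cases hej : e = j
    · rcases hb with hb' | hb'
      · refine ⟨i, i.2.le, ?_, BlackFrom.swap hij (Or.inl hb') (by omega) fun k hk hk' hmin => ?_⟩
        · rw [sumBelow_swap hij (by omega), ← h1, hej, hij, QuasiLascoux.sumBelow_succ (net b R), hzero i hb', add_zero]
        · have hki : k ≠ i := by rintro rfl; exact hk' hb'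
          rw [Ne, Fin.ext_iff] at hki
          exact h2 k (by omega) hk' fun k' hk1 hlt => hmin k' (by omega) hlt
      · refine ⟨j + 1, j.2, ?_, BlackFrom.swap hij (Or.inr hb') (by omega) fun k hk hk' hmin => ?_⟩
        · rw [sumBelow_swap hij (by omega), ← h1, hej, QuasiLascoux.sumBelow_succ (net b R), hzero j hb', add_zero]
        · refine h2 k (by omega) hk' fun k' hk1 hlt => ?_
          by_cases hkj : k' = j
          · rw [hkj, hb']
          · rw [Fin.ext_iff] at hkj
            exact hmin k' (by omega) hlt
    · exact ⟨e, he, by rw [sumBelow_swap hij hej, h1], h2.swap hij hb hej⟩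

end Swap

theorem coe_mapDomain_swap {n : ℕ} (m : Fin n →₀ ℕ) (i j : Fin n) :
    (m.mapDomain (Equiv.swap i j) : Fin n → ℕ) = m ∘ Equiv.swap i j := by
  funext k
  rw [← Equiv.swap_apply_self i j k, Finsupp.mapDomain_apply (Equiv.swap i j).injective,
    Equiv.swap_apply_self, Function.comp_apply]

theorem glide_mem_QSymBeta {n : ℕ} {w : Fin n → ℕ} (hw : RightJustified w) :
    glide w ∈ QSymBeta n := by
  classical
  intro m i j hij hm
  have hcoeff : ∀ m : Fin n →₀ ℕ, MvPolynomial.coeff m (glide w) =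
      ∑ p ∈ (finite_glides w).toFinset with p.1 = (m : Fin n → ℕ), Polynomial.X ^ p.2.card := by
    intro m
    rw [glide, MvPolynomial.coeff_sum, sum_filter]
    exact sum_congr rfl fun p _ => coeff_betaMonomial _ _ _
  rw [hcoeff, hcoeff, coe_mapDomain_swap]
  have hswap : ∀ b : Fin n → ℕ, (b ∘ Equiv.swap i j) ∘ Equiv.swap i j = b := fun b => by
    funext k; simp
  have hR : ∀ R : Finset (Fin n), (R.image (Equiv.swap i j)).image (Equiv.swap i j) = R := fun R => by
    ext k; rw [mem_image_swap, mem_image_swap, Equiv.swap_apply_self]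
  refine sum_nbij' (fun p => (p.1 ∘ Equiv.swap i j, p.2.image (Equiv.swap i j)))
    (fun p => (p.1 ∘ Equiv.swap i j, p.2.image (Equiv.swap i j))) ?_ ?_ ?_ ?_ ?_
  · rintro ⟨b, R⟩ hp
    rw [mem_filter, Set.Finite.mem_toFinset, Set.mem_ofPred_eq, isGlide_iff] at hp ⊢
    obtain ⟨hg, rfl⟩ := hp
    refine ⟨hg.swap hw hij ?_, hswap _⟩
    simpa [or_comm] using hm
  · rintro ⟨b, R⟩ hp
    rw [mem_filter, Set.Finite.mem_toFinset, Set.mem_ofPred_eq, isGlide_iff] at hp ⊢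
    obtain ⟨hg, rfl⟩ := hp
    exact ⟨hg.swap hw hij hm, rfl⟩
  · rintro ⟨b, R⟩ -
    simp only [hswap, hR]
  · rintro ⟨b, R⟩ -
    simp only [hswap, hR]
  · rintro ⟨b, R⟩ -
    rw [card_image_of_injective _ (Equiv.swap i j).injective]

/-! ### Right-justified quasiLascoux polynomials are quasisymmetric -/

theorem IsSemistandard.wt_ne_zero_iff {n : ℕ} {a : Fin n → ℕ} {T : SetFilling a}
    (h : IsSemistandard T) {k : Fin n} : wt T k ≠ 0 ↔ ∃ i c, k ∈ cell T i c := by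
  rw [h.wt_eq_card, card_ne_zero]
  constructor
  · rintro ⟨c, hc⟩
    obtain ⟨i, hi⟩ := mem_columnsWith.1 hc
    exact ⟨i, c, hi⟩
  · rintro ⟨i, c, hi⟩
    exact ⟨c, mem_columnsWith.2 ⟨i, hi⟩⟩

/-- If `k` occurs and the condition does not produce `k + 1` directly, then row `k` starts with
anchor `k`. As `a` is right-justified, row `k + 1` is nonempty, and its first anchor is above `k`
and at most `k + 1`. -/
theorem IsQuasiYamanouchi.rightJustified_wt {n : ℕ} {a : Fin n → ℕ} {S : SetFilling a}
    (h : IsQuasiYamanouchi S) (ha : RightJustified a) : RightJustified (wt S) := by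
  have hs := h.quasi.semistandard
  refine rightJustified_of_succ fun k l hkl hk => ?_
  rw [hs.wt_ne_zero_iff] at hk ⊢
  obtain ⟨i₀, c₀, hk₀⟩ := hk
  obtain ⟨c, hc, hmin⟩ := exists_min_image (columnsWith S k) id ⟨c₀, mem_columnsWith.2 ⟨i₀, hk₀⟩⟩
  obtain ⟨i, hi⟩ := mem_columnsWith.1 hc
  rcases h.yamanouchi k i c hi fun i' c' h' => hmin c' (mem_columnsWith.2 ⟨i', h'⟩) with
    ⟨rfl, rfl, hanc⟩ | ⟨k', h1, i', c', -, h2, -⟩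
  · have hil : i < l := by rw [Fin.lt_def]; omega
    have hl := Nat.pos_of_ne_zero (ha i l hil (Nat.pos_iff_ne_zero.1 (lt_of_mem_cell hi)))
    have hlt := h.quasi.first_lt i l hil (lt_of_mem_cell hi) hl
    rw [hanc, anchor, coe_lt_max_iff_exists] at hlt
    obtain ⟨y, hy, hiy⟩ := hlt
    have hyl := h.quasi.mem_zero_le hy
    obtain rfl : y = l := le_antisymm hyl (by rw [Fin.le_def]; rw [Fin.lt_def] at hiy; omega)
    exact ⟨y, 0, hy⟩
  · obtain rfl : k' = l := Fin.ext (by omega)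
    exact ⟨i', c', h2⟩

theorem RightJustified.quasiLascoux_mem {n : ℕ} {a : Fin n → ℕ} (h : RightJustified a) :
    quasiLascoux a ∈ QSymBeta n := by
  classical
  rw [quasiLascoux_eq_sum_glide]
  refine Submodule.sum_mem _ fun S hS => Submodule.smul_mem _ _ (glide_mem_QSymBeta ?_)
  exact (mem_filter.1 hS).2.rightJustified_wt h

/-! ### Bases -/

theorem exists_swap_of_not_rightJustified {n : ℕ} {a : Fin n → ℕ} (h : ¬ RightJustified a) :
    ∃ i j : Fin n, (j : ℕ) = i + 1 ∧ a j = 0 ∧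
      height (a ∘ Equiv.swap i j) < height a := by
  have h1 : ∃ i j : Fin n, (j : ℕ) = i + 1 ∧ a i ≠ 0 ∧ a j = 0 := by
    by_contra! hne
    exact h (rightJustified_of_succ hne)
  obtain ⟨i, j, hij, hi, hj⟩ := h1
  refine ⟨i, j, hij, hj, Dominates.height_lt (fun x => ?_) fun he => hi ?_⟩
  · have hsum : ∀ f : Fin n → ℕ, ∑ k ∈ Iic x, f k = sumBelow f (x + 1) := fun f => by
      rw [sumBelow]
      refine sum_congr (ext fun k => ?_) fun _ _ => rfl
      rw [mem_Iic, mem_filter, Fin.le_def]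
      simp only [mem_univ, true_and]
      omega
    rw [hsum, hsum]
    by_cases hx : (x : ℕ) + 1 = j
    · obtain rfl : x = i := Fin.ext (by omega)
      rw [sumBelow_succ, sumBelow_succ]
      have h2 := sumBelow_swap (i := x) hij (e := x) (by omega) a
      have h3 : (a ∘ Equiv.swap x j) = fun k => a (Equiv.swap x j k) := rfl
      have h4 : (a ∘ Equiv.swap x j) x = 0 := by
        rw [Function.comp_apply, Equiv.swap_apply_left, hj]
      rw [h4, h3, h2]
      omega
    · exact (sumBelow_swap hij hx a).le
  · have := congrFun he i
    rwa [Function.comp_apply, Equiv.swap_apply_left, hj] at this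

theorem coeff_eq_of_mem_QSymBeta {n : ℕ} {f : PolyBeta n} (hf : f ∈ QSymBeta n) {a : Fin n → ℕ}
    {i j : Fin n} (hij : (j : ℕ) = i + 1) (hj : a j = 0) :
    MvPolynomial.coeff (Finsupp.equivFunOnFinite.symm (a ∘ Equiv.swap i j)) f =
      MvPolynomial.coeff (Finsupp.equivFunOnFinite.symm a) f := by
  rw [← hf (Finsupp.equivFunOnFinite.symm a) i j hij (Or.inr hj)]
  congr 1
  refine DFunLike.coe_injective ?_
  rw [coe_mapDomain_swap]
  rfl

/-- Otherwise quasisymmetry carries the leading coefficient to an exponent of smaller height, which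
cannot dominate `a`. -/
theorem rightJustified_of_quasiLascoux_mem {n : ℕ} {a : Fin n → ℕ}
    (h : quasiLascoux a ∈ QSymBeta n) : RightJustified a := by
  by_contra hne
  obtain ⟨i, j, hij, hj, hlt⟩ := exists_swap_of_not_rightJustified hne
  have h1 := coeff_eq_of_mem_QSymBeta h hij hj
  rw [(hasLeadingTerm_quasiLascoux a).coeff_self] at h1
  have h2 := (hasLeadingTerm_quasiLascoux a).dominates _ (by rw [h1]; exact one_ne_zero)
  exact absurd h2.height_le (not_le.2 hlt)

/-- Subtracting the right-justified terms of the expansion of `f` leaves a quasisymmetric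
combination of the others. If it is nonzero, its coefficient at an index `a` of minimal height also
appears at an exponent of smaller height, where no term can contribute. -/
theorem QSymBeta_le_span {n : ℕ} :
    QSymBeta n ≤ Submodule.span ℤ[X] (quasiLascoux '' {a : Fin n → ℕ | RightJustified a}) := by
  classical
  intro f hf
  have htop := span_eq_top_of_hasLeadingTerm (n := n) hasLeadingTerm_quasiLascoux
  obtain ⟨l, rfl⟩ := (Finsupp.mem_span_range_iff_exists_finsupp (v := quasiLascoux (n := n))).1
    (by rw [htop]; trivial : f ∈ Submodule.span ℤ[X] (Set.range (quasiLascoux (n := n))))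
  change Finsupp.linearCombination ℤ[X] quasiLascoux l ∈ _ at hf
  change Finsupp.linearCombination ℤ[X] quasiLascoux l ∈ _
  set l₁ := l.filter fun a => ¬ RightJustified a with hl₁
  have hadd : l.filter RightJustified + l₁ = l := Finsupp.filter_add_filter_not l _
  have hmem : Finsupp.linearCombination ℤ[X] quasiLascoux (l.filter RightJustified) ∈
      Submodule.span ℤ[X] (quasiLascoux '' {a : Fin n → ℕ | RightJustified a}) := by
    rw [Finsupp.linearCombination_apply]
    refine Submodule.sum_mem _ fun a ha => Submodule.smul_mem _ _ (Submodule.subset_span ⟨a, ?_, rfl⟩)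
    rw [Finsupp.support_filter, mem_filter] at ha
    exact ha.2
  have hle : Submodule.span ℤ[X] (quasiLascoux '' {a : Fin n → ℕ | RightJustified a}) ≤
      QSymBeta n := by
    rw [Submodule.span_le]
    rintro _ ⟨a, ha, rfl⟩
    exact RightJustified.quasiLascoux_mem ha
  rw [← hadd, map_add] at hf ⊢
  have hf₁ := (Submodule.add_mem_iff_right _ (hle hmem)).1 hf
  suffices l₁ = 0 by rw [this, map_zero, add_zero]; exact hmem
  by_contra hne
  obtain ⟨a, ha, hmin⟩ := exists_minimal_of_ne_zero hne
  have hmina := coeff_linearCombination_of_minimal hasLeadingTerm_quasiLascoux hmin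
  have ha' : ¬ RightJustified a := by
    rw [hl₁, Finsupp.support_filter, mem_filter] at ha
    exact ha.2
  obtain ⟨i, j, hij, hj, hlt⟩ := exists_swap_of_not_rightJustified ha'
  rw [← coeff_eq_of_mem_QSymBeta hf₁ hij hj, Finsupp.linearCombination_apply, Finsupp.sum,
    MvPolynomial.coeff_sum] at hmina
  refine Finsupp.mem_support_iff.1 ha (hmina.symm.trans (sum_eq_zero fun b hb => ?_))
  rw [MvPolynomial.coeff_smul]
  by_contra hb'
  have h1 := (hasLeadingTerm_quasiLascoux b).dominates _ (right_ne_zero_of_smul hb')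
  exact absurd (h1.height_le.trans_lt hlt) (not_lt.2 (hmin b hb))

theorem range_quasiGrothendieck {n : ℕ} :
    (Set.range fun α : StrongComposition n => quasiGrothendieck n α.1) =
      quasiLascoux '' {a : Fin n → ℕ | RightJustified a} := by
  ext f
  constructor
  · rintro ⟨⟨α, h, hl⟩, rfl⟩
    obtain ⟨a, ha, rfl⟩ := exists_rightJustified h hl
    exact ⟨a, ha, ha.quasiGrothendieck_eq.symm⟩
  · rintro ⟨a, ha, rfl⟩
    exact ⟨⟨positivePart a, pos_of_mem_positivePart, length_positivePart_le a⟩,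
      RightJustified.quasiGrothendieck_eq ha⟩

theorem linearIndependent_quasiGrothendieck {n : ℕ} :
    LinearIndependent ℤ[X] (fun α : StrongComposition n => quasiGrothendieck n α.1) := by
  choose r hr hα using fun α : StrongComposition n => exists_rightJustified α.2.1 α.2.2
  have h : (fun α : StrongComposition n => quasiGrothendieck n α.1) = quasiLascoux ∘ r := by
    funext α
    rw [Function.comp_apply, ← (hr α).quasiGrothendieck_eq, hα]
  rw [h]
  refine (linearIndependent_of_hasLeadingTerm hasLeadingTerm_quasiLascoux).comp r fun α γ he => ?_
  exact Subtype.ext (by rw [← hα α, ← hα γ, he])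

theorem span_quasiGrothendieck {n : ℕ} :
    Submodule.span ℤ[X] (Set.range fun α : StrongComposition n => quasiGrothendieck n α.1) =
      QSymBeta n := by
  rw [range_quasiGrothendieck]
  refine le_antisymm (Submodule.span_le.2 ?_) QSymBeta_le_span
  rintro _ ⟨a, ha, rfl⟩
  exact RightJustified.quasiLascoux_mem ha

theorem range_quasiLascoux_inter {n : ℕ} :
    (Set.range fun a : Fin n → ℕ => quasiLascoux a) ∩ (QSymBeta n : Set (PolyBeta n)) =
      Set.range fun α : StrongComposition n => quasiGrothendieck n α.1 := by
  rw [range_quasiGrothendieck]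
  ext f
  constructor
  · rintro ⟨⟨a, rfl⟩, h⟩
    exact ⟨a, rightJustified_of_quasiLascoux_mem h, rfl⟩
  · rintro ⟨a, ha, rfl⟩
    exact ⟨⟨a, rfl⟩, RightJustified.quasiLascoux_mem ha⟩

/-! ### Positive expansions -/

theorem hasPositiveExpansion_sum {n : ℕ} {ι κ : Type} (B : ι → PolyBeta n) (s : Finset κ)
    (k : κ → ℕ) (b : κ → ι) :
    HasPositiveExpansion B (∑ x ∈ s, (Polynomial.X ^ k x : ℤ[X]) • B (b x)) := by
  classical
  -- Several `x` may share the same index `b x`, as fillings of equal weight do; their powers of `β`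
  -- add up in one coefficient.
  refine ⟨∑ x ∈ s, Finsupp.single (b x) (Polynomial.X ^ k x), ?_⟩
  rw [← Finsupp.sum_finsetSum_index]
  · refine sum_congr rfl fun x _ => ?_
    rw [Finsupp.sum_single_index (by simp)]
    simp
  · simp
  · intro i p q
    rw [Polynomial.map_add, add_smul]

theorem hasPositiveExpansion_sum_self {n : ℕ} {ι : Type} (B : ι → PolyBeta n) (s : Finset ι) :
    HasPositiveExpansion B (∑ x ∈ s, B x) := by
  simpa using hasPositiveExpansion_sum B s (fun _ => 0) id

end QuasiLascoux

end

open QuasiLascoux in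
open Classical in
theorem theorem1p3 (n : ℕ) :
    -- the quasiLascoux polynomials form a basis of `Poly_n[β]`
    (LinearIndependent ℤ[X] (fun a : Fin n → ℕ => quasiLascoux a) ∧
      Submodule.span ℤ[X] (Set.range fun a : Fin n → ℕ => quasiLascoux a) = ⊤) ∧
    -- the quasiGrothendieck polynomials form a basis of `QSym_n[β]`
    (LinearIndependent ℤ[X] (fun α : StrongComposition n => quasiGrothendieck n α.1) ∧
      Submodule.span ℤ[X] (Set.range fun α : StrongComposition n => quasiGrothendieck n α.1) =
        QSymBeta n) ∧
    -- which is lifted by the quasiLascoux polynomials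
    (Set.range fun a : Fin n → ℕ => quasiLascoux a) ∩ (QSymBeta n : Set (PolyBeta n)) =
      (Set.range fun α : StrongComposition n => quasiGrothendieck n α.1) ∧
    -- specialization at `β = 0`
    (∀ a : Fin n → ℕ, specializeZero (quasiLascoux a) = quasikey a) ∧
    -- Lascoux polynomials into quasiLascoux polynomials
    (∀ a : Fin n → ℕ,
      lascoux a = ∑ b ∈ (finite_Qlswap a).toFinset, quasiLascoux b ∧
      HasPositiveExpansion (fun b : Fin n → ℕ => quasiLascoux b) (lascoux a)) ∧
    -- quasiLascoux polynomials into glide polynomials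
    (∀ a : Fin n → ℕ,
      quasiLascoux a = ∑ S : SetFilling a with IsQuasiYamanouchi S,
        (Polynomial.X ^ excess S : ℤ[X]) • glide (wt S) ∧
      HasPositiveExpansion (fun b : Fin n → ℕ => glide b) (quasiLascoux a)) ∧
    -- quasiLascoux polynomials into Lascoux atoms
    (∀ a : Fin n → ℕ,
      quasiLascoux a = ∑ b ∈ (finite_dominatingRearrangements a).toFinset, lascouxAtom b ∧
      HasPositiveExpansion (fun b : Fin n → ℕ => lascouxAtom b) (quasiLascoux a)) := by
  exact ⟨⟨linearIndependent_of_hasLeadingTerm hasLeadingTerm_quasiLascoux,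
      span_eq_top_of_hasLeadingTerm hasLeadingTerm_quasiLascoux⟩,
    ⟨linearIndependent_quasiGrothendieck, span_quasiGrothendieck⟩, range_quasiLascoux_inter,
    specializeZero_quasiLascoux,
    fun a => ⟨lascoux_eq_sum_Qlswap a, lascoux_eq_sum_Qlswap a ▸ hasPositiveExpansion_sum_self _ _⟩,
    fun a => ⟨quasiLascoux_eq_sum_glide a,
      quasiLascoux_eq_sum_glide a ▸ hasPositiveExpansion_sum _ _ _ _⟩,
    fun a => ⟨rfl, hasPositiveExpansion_sum_self _ _⟩⟩
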